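/- \textbf{The system.} Each site $i\in\mathbb Z$ carries a triple $(a_i,b_i,c_i)$ of non-negative integers ($b_i$ baskets, $c_i$ balls, room for $a_i$ further balls) with $a_i+c_i=b_i+1$; a state has $(a_i,b_i,c_i)=V:=(1,0,0)$ (vacuum) for all but finitely many $i$. For $\ell\in\{1,2,\dots\}\cup\{\infty\}$ the time evolution $T_\ell$ is given by a carrier that starts as $(\ell,0,0)$ at the far left and passes all sites from left to right; when the carrier $(a,b,c)$ passes the site $(d,e,f)$, put $m_1=\min(a+b,a+c,b+f)$, $m_2=\min(e+c,d+c,d+b)$, $m_3=\min(a+e,d+f,e+f)$; the site becomes $(d+m_1-m_2,\;e+m_1-m_3,\;f+m_2-m_3)$ and the carrier becomes $(a+m_2-m_1,\;b+m_3-m_1,\;c+m_3-m_2)$ (with $a=\infty$ staying $\infty$). The box-basket-ball system is $T=T_\infty$. \textbf{Solitons.} Let $F=(0,0,1)$ and $B_a=(a+1,a,0)$ for $a\ge1$. A soliton of speed $v$ is a non-empty finite string of sites, not beginning or ending with $V$, which, placed anywhere on a vacuum background, is translated by $v$ under $T_\infty$. It is basic if it is not of the form $A'V^gA''$ with solitons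 $A',A''$ and $g\ge v$. Under $T_\ell$ a soliton of speed $v$ on its own has speed $\min(\ell,v)$. A disjoint union of solitons is a finite sequence of them, placed from left to right on a vacuum background, each followed by at least as many vacuum sites as its speed before the next one starts. We say that a state eventually consists of the freely propagating solitons $R$ under $T_\ell$ if, for all sufficiently large $n$, its image under $T_\ell^n$ is the union of the solitons in $R$, the position of a soliton of speed $v$ being $x+n\min(\ell,v)$ with $x$ independent of $n$, and neighbours are separated by at least as many vacuum sites as the speed of each of the two. \textbf{Pure solitons and amplitudes.} Pure solitons are $F_k=F\cdots F$ ($k\ge1$ letters; one ball soliton of amplitude $k$) and $B_{a_1}\cdots B_{a_r}$ ($r$ basket solitons of amplitudes $a_1,\dots,a_r$). A state $S$ has content $(X,Y)$, where $X$ and $Y$ are finite multisets of positive integers, if for every $k\ge2$ and all sufficiently large $M$, when $M$ copies of $F_k$, with $k$ vacuum sites between neighbours, are put sufficiently far to the left of $S$, the resulting state eventually, under $T_\infty$, consists of freely propagating pure solitons whose ball amplitudes are $X$ together with $M$ times $k$ and whose basket amplitudes are $Y$. For a basic soliton, the chunk content is as follows: $F_k$ has one ball soliton of amplitude $k$ and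 no basket soliton; any other basic soliton has one ball soliton of amplitude $1$ for each of its balls, and, after being cut in front of each letter that contains no ball, one basket soliton for each piece that contains a basket, its amplitude being the number of baskets of the piece. For a disjoint union of basic solitons one takes the sum of multisets. \textbf{Theorem.} The box-basket-ball system is solitonic in the following sense. (1) Every state eventually consists, under $T_\infty$, of freely propagating basic solitons, with non-decreasing speeds from left to right. (2) Every state has exactly one content $(X,Y)$, and for all $\ell\in\{1,2,\dots\}\cup\{\infty\}$ and $t\ge0$ the state $T_\ell^tS$ has the same content as $S$. The content of a disjoint union of basic solitons is its chunk content. In particular, if $S$ and $T_\ell^tS$ are both disjoint unions of basic solitons, they have the same chunk content: the numbers and the amplitudes of ball solitons and of basket solitons are conserved. (3) The scattering of $n$ solitons is factorized into two-body scatterings. In detail: let $\ell\in\{1,2,\dots\}\cup\{\infty\}$. If $P$ and $Q$ are solitons with positions $x_P,x_Q$ extrapolated to time $0$ and $P$ is faster under $T_\ell$, an outcome of their two-body scattering is a pair $Q',P'$ of solitons with positions, of the same speeds as $Q,P$, such that from every time $s\in\mathbb Z$ at which the freely propagating $P$ (left) and $Q$ (right) form a disjoint union, the state eventually consists, under $T_\ell$,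 of the freely propagating $Q'$ (left) and $P'$ (right), all positions being extrapolated to time $0$. Given solitons $A_1,\dots,A_n$ of non-increasing speeds (not necessarily basic, equal speeds allowed), there is $D\ge0$ such that the following holds for every $\ell$ and every disjoint union $L$ of $A_1,\dots,A_n$ in this order from left to right in which consecutive solitons of speed $1$ are at least $D$ vacuum sites apart. Start from the list $L$ of solitons with positions, and repeatedly replace some neighbours $P,Q$ in the list, where $P$ is faster under $T_\ell$, by an outcome $Q',P'$ of their two-body scattering. Then whatever neighbours are chosen, such an outcome always exists; a list $R$ with non-decreasing speeds under $T_\ell$ can be reached; and, for every such list $R$ that is reached in this way, in whatever order, the state $L$ eventually consists, under $T_\ell$, of the freely propagating solitons $R$ (with the internal structures and positions, hence total phase shifts, given by $R$). -/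

import Mathlib

namespace BoxBasketBall

/-- The state `(a, b, c)` of a site: `b` baskets, `c` balls, room for `a` extra balls. -/
@[ext] structure Site where
  a : ℕ
  b : ℕ
  c : ℕ
deriving DecidableEq

/-- Each site has one box, so `c ≤ b + 1` and `a = b - c + 1`. -/
def Site.Admissible (s : Site) : Prop := s.a + s.c = s.b + 1

/-- The vacuum site: an empty box. -/
def V : Site := ⟨1, 0, 0⟩

/-- A box with a ball. -/
def F : Site := ⟨0, 0, 1⟩

/-- A box with `a` empty baskets. -/
def B (a : ℕ) : Site := ⟨a + 1, a, 0⟩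

/-- An assignment of a triple to each site of `ℤ`; the genuine states satisfy `IsState`. -/
abbrev State := ℤ → Site

/-- A state of the system: all sites are admissible, and all but finitely many are vacuum. -/
def IsState (S : State) : Prop :=
  (∀ i, (S i).Admissible) ∧ {i | S i ≠ V}.Finite

/-- The carrier `(a, b, c)`: room for `a` extra balls (`a = ∞` is allowed), `b` baskets,
`c` balls. -/
structure Carrier where
  a : ℕ∞
  b : ℕ
  c : ℕ

/-- `min (a + b, a + c, b + f)`, a finite number. -/
noncomputable def min₁ (C : Carrier) (s : Site) : ℕ :=
  (min (C.a + C.b) (min (C.a + C.c) (C.b + s.c : ℕ))).toNat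

/-- `min (e + c, d + c, d + b)`. -/
def min₂ (C : Carrier) (s : Site) : ℕ :=
  min (s.b + C.c) (min (s.a + C.c) (s.a + C.b))

/-- `min (a + e, d + f, e + f)`, a finite number. -/
noncomputable def min₃ (C : Carrier) (s : Site) : ℕ :=
  (min (C.a + s.b) (min (s.a + s.c : ℕ) (s.b + s.c : ℕ))).toNat

/-- The site `(d', e', f')` after the carrier `(a, b, c)` has passed the site `(d, e, f)`. -/
noncomputable def newSite (C : Carrier) (s : Site) : Site where
  a := s.a + min₁ C s - min₂ C s
  b := s.b + min₁ C s - min₃ C s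
  c := s.c + min₂ C s - min₃ C s

/-- The carrier `(a', b', c')` after it has passed the site `(d, e, f)`. -/
noncomputable def newCarrier (C : Carrier) (s : Site) : Carrier where
  a := C.a + min₂ C s - min₁ C s
  b := C.b + min₃ C s - min₁ C s
  c := C.c + min₃ C s - min₂ C s

/-- The cast of natural numbers to `ℕ∞` commutes with minima. -/
theorem cast_min' (m n : ℕ) : min (m : ℕ∞) (n : ℕ∞) = ((min m n : ℕ) : ℕ∞) :=
  (Nat.mono_cast.map_min).symm

/-- The natural-number subtractions in `newSite` and `newCarrier` are never truncated. -/
theorem min_le (C : Carrier) (s : Site) :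
    min₂ C s ≤ s.a + min₁ C s ∧ min₃ C s ≤ s.b + min₁ C s ∧ min₃ C s ≤ s.c + min₂ C s ∧
    min₁ C s ≤ C.b + min₃ C s ∧ min₂ C s ≤ C.c + min₃ C s ∧
    (min₁ C s : ℕ∞) ≤ C.a + min₂ C s := by
  obtain ⟨a, b, c⟩ := C
  obtain ⟨d, e, f⟩ := s
  induction a using ENat.recTopCoe with
  | top =>
    simp only [min₁, min₂, min₃, top_add, le_top, min_eq_right, ENat.toNat_natCast,
      and_true, cast_min']
    omega
  | coe n =>
    simp only [min₁, min₂, min₃, ← Nat.cast_add, cast_min', ENat.toNat_natCast, Nat.cast_le]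
    omega

/-- The simpler formulas for a carrier with unlimited room. -/
theorem newSite_top (b c : ℕ) (s : Site) :
    newSite ⟨⊤, b, c⟩ s =
      ⟨s.a + b + s.c - min (s.b + c) (min (s.a + c) (s.a + b)),
        s.b + b - min s.a s.b,
        min (s.b + c) (min (s.a + c) (s.a + b)) - min s.a s.b⟩ ∧
    newCarrier ⟨⊤, b, c⟩ s =
      ⟨⊤, min s.a s.b,
        c + s.c + min s.a s.b - min (s.b + c) (min (s.a + c) (s.a + b))⟩ := by
  obtain ⟨d, e, f⟩ := s
  simp only [newSite, newCarrier, min₁, min₂, min₃, top_add, le_top, min_eq_right,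
    ENat.toNat_natCast, cast_min', Site.mk.injEq, Carrier.mk.injEq, ENat.top_sub_natCast, true_and]
  omega

/-- The leftmost non-vacuum site (an arbitrary site for the vacuum state). -/
noncomputable def leftEnd (S : State) : ℤ := sInf {i | S i ≠ V}

/-- The carrier that starts as `(ℓ, 0, 0)` at site `p`, after the sites `p, …, p + n - 1`. -/
noncomputable def scan (ℓ : ℕ∞) (S : State) (p : ℤ) : ℕ → Carrier
  | 0 => ⟨ℓ, 0, 0⟩
  | n + 1 => newCarrier (scan ℓ S p n) (S (p + n))

/-- One step of the time evolution `T_ℓ`: the carrier `(ℓ, 0, 0)` comes from the far left (she is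
unchanged by the vacuum sites to the left of the state) and moves through all sites.
`ℓ = ⊤` is the time evolution of the box-basket-ball system itself. -/
noncomputable def T (ℓ : ℕ∞) (S : State) : State := fun i =>
  newSite (scan ℓ S (leftEnd S) (i - leftEnd S).toNat) (S i)

/-- The state with the word `w` on the sites `p, p + 1, …`, and vacuum elsewhere. -/
def place (w : List Site) (p : ℤ) : State := fun i =>
  if p ≤ i then w.getD (i - p).toNat V else V

/-- `w` is a soliton of speed `v`: a string of sites, not starting or ending with a vacuum site,
which under the time evolution moves by `v` without changing. -/
def IsSoliton (w : List Site) (v : ℕ) : Prop :=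
  w ≠ [] ∧ w.head? ≠ some V ∧ w.getLast? ≠ some V ∧ (∀ s ∈ w, s.Admissible) ∧
    ∀ p : ℤ, T ⊤ (place w p) = place w (p + v)

/-- A basic soliton of speed `v` is not the union of two solitons that are separated by at least
`v` vacuum sites. -/
def IsBasicSoliton (w : List Site) (v : ℕ) : Prop :=
  IsSoliton w v ∧
    ¬ ∃ (w₁ w₂ : List Site) (v₁ v₂ g : ℕ), IsSoliton w₁ v₁ ∧ IsSoliton w₂ v₂ ∧ v ≤ g ∧
      w = w₁ ++ List.replicate g V ++ w₂

/-- A word with a position of its leftmost letter and a speed. -/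
structure Wave where
  word : List Site
  pos : ℤ
  speed : ℕ

/-- The first site to the right of the wave. -/
def Wave.rightEnd (P : Wave) : ℤ := P.pos + P.word.length

/-- The speed of the wave under `T_ℓ`. -/
noncomputable def Wave.speedAt (ℓ : ℕ∞) (P : Wave) : ℕ := (min ℓ (P.speed : ℕ∞)).toNat

/-- Free propagation under `T_ℓ` for time `t` (which may be negative). -/
noncomputable def Wave.move (ℓ : ℕ∞) (t : ℤ) (P : Wave) : Wave :=
  { P with pos := P.pos + t * P.speedAt ℓ }

/-- The union of two states (which will have disjoint supports). -/
def union (S S' : State) : State := fun i => if S i = V then S' i else S i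

/-- The state that consists of the given waves, on a vacuum background. -/
def superpose : List Wave → State
  | [] => fun _ => V
  | P :: L => union (place P.word P.pos) (superpose L)

/-- Waves listed from left to right, each followed by at least as many vacuum sites as its
speed before the next one starts. -/
def Separated (L : List Wave) : Prop :=
  L.IsChain fun (P Q : Wave) => P.rightEnd + P.speed ≤ Q.pos

/-- Waves listed from left to right, neighbours being separated by at least as many vacuum sites
as the speed of each of the two. -/
def WellSeparated (L : List Wave) : Prop :=
  L.IsChain fun (P Q : Wave) => P.rightEnd + max P.speed Q.speed ≤ Q.pos

/-- Under `T_ℓ` the state `S` eventually is, and remains, the disjoint union of the freely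
propagating waves `R`, whose positions are those extrapolated to the present time. -/
def EventuallyFree (ℓ : ℕ∞) (S : State) (R : List Wave) : Prop :=
  ∃ N : ℕ, ∀ n : ℕ, N ≤ n →
    (T ℓ)^[n] S = superpose (R.map (Wave.move ℓ n)) ∧ WellSeparated (R.map (Wave.move ℓ n))

/-- The pure solitons: the words `F ⋯ F` and the words `B_{a₁} ⋯ B_{aᵣ}`. -/
def IsPure (w : List Site) : Prop :=
  w ≠ [] ∧ ((∀ s ∈ w, s = F) ∨ (∀ s ∈ w, ∃ a, 1 ≤ a ∧ s = B a))

/-- Amplitudes of the ball solitons in a basic soliton: `F_k` is a single one of amplitude `k`,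
and each ball of another basic soliton gives one of amplitude `1`. -/
def ballAmplitudes (w : List Site) : Multiset ℕ :=
  if ∀ s ∈ w, s = F then {w.length} else Multiset.replicate (w.map Site.c).sum 1

/-- Amplitudes of the basket solitons in a slow word. The word is cut into chunks in front of every
letter without a ball (in a basic soliton: every letter `B_a`); each chunk with at least one basket
is a basket soliton, whose amplitude is the number of its baskets. The first argument is the
number of baskets of the chunk that is being read. -/
def basketAmplitudesAux : ℕ → List Site → Multiset ℕ
  | g, [] => if g = 0 then 0 else {g}
  | g, s :: w =>
      if s.c = 0 then (if g = 0 then 0 else {g}) + basketAmplitudesAux s.b w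
      else basketAmplitudesAux (g + s.b) w

/-- Amplitudes of the basket solitons in a basic soliton. -/
def basketAmplitudes (w : List Site) : Multiset ℕ := basketAmplitudesAux 0 w

/-- The amplitudes of the ball solitons and of the basket solitons of a disjoint union of basic
solitons. -/
def content (L : List Wave) : Multiset ℕ × Multiset ℕ :=
  ((L.map fun P => ballAmplitudes P.word).sum, (L.map fun P => basketAmplitudes P.word).sum)

/-- `M` copies of `F_k`, with `k` vacuum sites between consecutive ones, starting at `x`. -/
def train (k M : ℕ) (x : ℤ) : List Wave :=
  (List.range M).map fun j => ⟨List.replicate k F, x + 2 * k * j, k⟩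

/-- `S` contains ball and basket solitons of amplitudes `c.1`, `c.2`, in the sense of the
decomposition into pure solitons: for every `k ≥ 2`, when sufficiently many copies of `F_k`,
sent from sufficiently far to the left, are scattered with `S`, the system ends up as a disjoint
union of pure solitons, which have these amplitudes, apart from `k` for every `F_k` sent in. -/
def HasContent (S : State) (c : Multiset ℕ × Multiset ℕ) : Prop :=
  ∀ k : ℕ, 2 ≤ k → ∃ M₀ : ℕ, ∀ M : ℕ, M₀ ≤ M → ∃ x₀ : ℤ, ∀ x : ℤ, x ≤ x₀ →
    ∃ R : List Wave, (∀ P ∈ R, IsBasicSoliton P.word P.speed ∧ IsPure P.word) ∧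
      EventuallyFree ⊤ (union (superpose (train k M x)) S) R ∧
      content R = (c.1 + Multiset.replicate M k, c.2)

/-- Under `T_ℓ` the two-body scattering of `P` (left, faster) and `Q` has the outcome `Q'`
(left), `P'`: the same holds from every time `s` at which the freely propagating `P` and `Q` are
still separated. All positions are extrapolated to time `0`, so that `P'.pos - P.pos` and
`Q'.pos - Q.pos` are the phase shifts. -/
def TwoBody (ℓ : ℕ∞) (P Q Q' P' : Wave) : Prop :=
  IsSoliton P'.word P'.speed ∧ P'.speed = P.speed ∧
  IsSoliton Q'.word Q'.speed ∧ Q'.speed = Q.speed ∧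
  ∀ s : ℤ, Separated [P.move ℓ s, Q.move ℓ s] →
    EventuallyFree ℓ (superpose [P.move ℓ s, Q.move ℓ s]) [Q'.move ℓ s, P'.move ℓ s]

/-- `L'` arises from `L` by one two-body scattering of neighbours, the left one being faster. -/
def ScatterStep (ℓ : ℕ∞) (L L' : List Wave) : Prop :=
  ∃ (L₁ L₂ : List Wave) (P Q Q' P' : Wave), Q.speedAt ℓ < P.speedAt ℓ ∧ TwoBody ℓ P Q Q' P' ∧
    L = L₁ ++ P :: Q :: L₂ ∧ L' = L₁ ++ Q' :: P' :: L₂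

/-- `R` arises from `L` by a sequence of two-body scatterings. -/
def Scatters (ℓ : ℕ∞) : List Wave → List Wave → Prop := Relation.ReflTransGen (ScatterStep ℓ)

/-- The speeds under `T_ℓ` are non-decreasing from left to right. -/
def Sorted (ℓ : ℕ∞) (R : List Wave) : Prop :=
  R.Pairwise fun (P Q : Wave) => P.speedAt ℓ ≤ Q.speedAt ℓ

end BoxBasketBall

open BoxBasketBall

/-!
The box-basket-ball system is reduced to a smaller system of the same kind without baskets.

*Boxes.* A site `(a, b, c)` is replaced by `c` full and `a` empty boxes, the first of which is
marked. Then the carrier acts box by box as in the ordinary box-ball system, and carries the marks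
along (`brun`, `run_enc`).

*Skeleton, colours and marks.* A list of boxes is described uniquely by a skeleton `t`, which
consists of slow balls and slots, by the colours `X` of the slots, i.e. a state of a box-ball system
without baskets, and by marks `ys` (`inf`, `parse`, `WRep.unique`). The whole theorem rests on one
computation (`key`, `Rep.T`): `T_ℓ` moves the description by one site, leaves `t` and `ys` unchanged,
and acts on `X` as `T_{ℓ-1}`. Conversely, a soliton of speed `v` in the slots is seen in the original
system as a soliton of speed `v + 1`: each of its runs of `v` balls, and each gap, is longer by one
(`infl`, `infW`). When all balls in the slots have left the non-trivial part of the skeleton and of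
the marks, the latter form a word of empty slots which moves with speed `1`. Hence the solitons of
speed `1` are the slow words, in which no two adjacent boxes contain balls, and the solitons of speed
`v ≥ 2` are sequences of runs of `v` balls (`IsSoliton.classify`).

*Every state finally consists of solitons.* The slots contain fewer balls than the state, so that
induction applies to them; the solitons of the slots are inflated, and the slow ones are given by
`t` and `ys` (`EventuallyFree.inflate`, `exists_eventuallyFree`).

*Conserved amplitudes.* Each slow ball of the skeleton is a ball soliton of amplitude `1`, each ball
soliton of the slots is one whose amplitude is larger by one, and each run of `false` in the marks is
a basket soliton. These numbers (`AmpContent`) are conserved by `Rep.T`, and for a disjoint union of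
basic solitons they give the chunk content (`Separated.ampContent`). When `M` copies of `F_k` with
`k ≥ 2` are sent in from the left, they put trivial marks in front of `ys`, more of them than slots.
If `M` is large, the non-trivial marks are beyond all slow balls, which separates balls from baskets:
the final solitons are pure, and the content in the sense of scattering is the one above
(`AmpContent.hasContent`).

*Factorization.* A fast soliton with `m` runs that passes slow ones puts `m` trivial marks in front
of their marks (`Pushed`, `push`), and is itself moved by their `weight`, twice the number of balls
minus the number of baskets. Two fast solitons shift each other in the same way. These formal rules
(`outSlow`, `outFast`) satisfy the Yang-Baxter identities, since the marks add up and the weight is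
not changed; so the result `scatter` of all two-body scatterings does not depend on their order
(`insertWave_insertWave`, `scatter_step`). The rules are compatible with inflation (`scatter_infL`).
Therefore, if the fast solitons scatter under `T_{ℓ-1}` in the slots according to these rules, the
whole system does so under `T_ℓ`, and induction on the maximal speed shows that the rules are correct
(`eventuallyFree_scatter`). In particular they are the outcomes of two-body scatterings, which are
unique because fast and slow solitons are finally far apart (`twoBody_out`, `TwoBody.unique`).
-/

namespace BoxBasketBall

/-! ### Boxes -/

/-- A box: whether it contains a ball, and whether it is marked. A mark is set on the first box of
each site, so that a list of boxes determines the sites. -/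
abbrev Box := Bool × Bool

/-- Boxes with the given contents, of which only the first one may be marked, by `o`. -/
def mk (o : Bool) : List Bool → List Box
  | [] => []
  | x :: l => (x, o) :: l.map fun y => (y, false)

/-- `f` full boxes, followed by `d` empty ones. -/
def block (f d : ℕ) : List Bool := List.replicate f true ++ List.replicate d false

/-- The boxes of a site: `c` full ones and `a` empty ones, `b + 1` altogether. -/
def encS (s : Site) : List Box := mk true (block s.c s.a)

/-- The boxes of a list of sites. -/
def enc (l : List Site) : List Box := l.flatMap encS

/-- The boxes that a carrier leaves behind if it passes the given boxes one by one, with `K` balls on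
board at the beginning; `room K` tells whether there is room for another one. It takes a ball from
a full box if there is room, and drops a ball into an empty box if it has one. Marks are delayed by
one box: `o` is the mark that waits for the next box. A box that is emptied gets a mark only if a
mark is waiting and the box had one itself; otherwise the mark, if there is one, keeps waiting. -/
def brun (room : ℕ → Bool) : ℕ → Bool → List Box → List Box
  | _, _, [] => []
  | K, o, (true, m) :: W =>
      if room K then (false, m && o) :: brun room (K + 1) (m || o) W
      else (true, o) :: brun room K m W
  | K, o, (false, m) :: W =>
      if K = 0 then (false, o) :: brun room 0 m W else (true, o) :: brun room (K - 1) m W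

/-- The number of balls on board and the waiting mark after the carrier of `brun` has passed the
boxes. -/
def bst (room : ℕ → Bool) : ℕ → Bool → List Box → ℕ × Bool
  | K, o, [] => (K, o)
  | K, o, (true, m) :: W =>
      if room K then bst room (K + 1) (m || o) W else bst room K m W
  | K, _, (false, m) :: W =>
      if K = 0 then bst room 0 m W else bst room (K - 1) m W

/-- A carrier of capacity `ℓ` with `n` balls on board has room for another one. -/
def cap (ℓ : ℕ∞) (n : ℕ) : Bool := decide ((n : ℕ∞) < ℓ)

theorem brun_append (room : ℕ → Bool) (W W' : List Box) : ∀ (K : ℕ) (o : Bool),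
    brun room K o (W ++ W') =
      brun room K o W ++ brun room (bst room K o W).1 (bst room K o W).2 W' := by
  induction W with
  | nil => intro K o; rfl
  | cons x W ih =>
    intro K o
    obtain ⟨s, m⟩ := x
    cases s <;> simp only [List.cons_append, brun, bst] <;> split <;> simp [ih]

theorem bst_append (room : ℕ → Bool) (W W' : List Box) : ∀ (K : ℕ) (o : Bool),
    bst room K o (W ++ W') = bst room (bst room K o W).1 (bst room K o W).2 W' := by
  induction W with
  | nil => intro K o; rfl
  | cons x W ih =>
    intro K o
    obtain ⟨s, m⟩ := x
    cases s <;> simp only [List.cons_append, bst] <;> split <;> simp [ih]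

@[simp] theorem mk_nil (o : Bool) : mk o [] = [] := rfl

theorem mk_false (l : List Bool) : mk false l = l.map fun y => (y, false) := by
  cases l <;> rfl

@[simp] theorem mk_cons (o x : Bool) (l : List Bool) : mk o (x :: l) = (x, o) :: mk false l := by
  rw [mk_false]; rfl

/-- Reading a run of unmarked empty boxes. -/
theorem brun_empty (room : ℕ → Bool) (d : ℕ) : ∀ (K : ℕ) (o : Bool),
    brun room K o (List.replicate d (false, false)) = mk o (block (min K d) (d - min K d)) ∧
    bst room K o (List.replicate d (false, false)) = (K - min K d, if d = 0 then o else false) := by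
  induction d with
  | zero => intro K o; simp [brun, bst, block]
  | succ d ih =>
    intro K o
    rcases K with _ | K
    · have := ih 0 false
      simp only [Nat.zero_min, Nat.sub_zero] at this
      simp only [List.replicate_succ, brun, bst, if_true, this.1, this.2]
      simp [block, List.replicate_succ, mk_false]
    · have := ih K false
      simp only [List.replicate_succ, brun, bst, Nat.succ_ne_zero, if_false, Nat.add_sub_cancel,
        this.1, this.2]
      rw [show min (K + 1) (d + 1) = min K d + 1 by omega,
        show d + 1 - (min K d + 1) = d - min K d by omega,
        show K + 1 - (min K d + 1) = K - min K d by omega]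
      simp [block, List.replicate_succ, mk_false]

theorem brun_full (ℓ : ℕ∞) (K : ℕ) (h : (K : ℕ∞) = ℓ) (f : ℕ) : ∀ (o : Bool),
    brun (cap ℓ) K o (List.replicate f (true, false)) = mk o (block f 0) ∧
    bst (cap ℓ) K o (List.replicate f (true, false)) = (K, if f = 0 then o else false) := by
  have hc : cap ℓ K = false := by simp [cap, h]
  induction f with
  | zero => intro o; simp [brun, bst, block]
  | succ d ih =>
    intro o
    have := ih false
    simp only [List.replicate_succ, brun, bst, hc, this.1, this.2]
    simp [block, List.replicate_succ, mk_false]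

/-- A run of `f` full and `d` empty unmarked boxes: the carrier takes the first `j` balls, until all
balls are taken or the capacity is exhausted. -/
theorem brun_run (ℓ : ℕ∞) (f d : ℕ) : ∀ (K : ℕ) (o : Bool), (K : ℕ∞) ≤ ℓ → ∃ j ≤ f,
    ((K + j : ℕ) : ℕ∞) ≤ ℓ ∧ (j = f ∨ ((K + j : ℕ) : ℕ∞) = ℓ) ∧
    brun (cap ℓ) K o (List.replicate f (true, false) ++ List.replicate d (false, false)) =
      List.replicate j (false, false) ++
        mk o (block (f - j + min (K + j) d) (d - min (K + j) d)) ∧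
    bst (cap ℓ) K o (List.replicate f (true, false) ++ List.replicate d (false, false)) =
      (K + j - min (K + j) d, if f - j + d = 0 then o else false) := by
  induction f with
  | zero =>
    intro K o hK
    refine ⟨0, le_rfl, by simpa using hK, Or.inl rfl, ?_, ?_⟩
    · simpa using (brun_empty (cap ℓ) d K o).1
    · simpa using (brun_empty (cap ℓ) d K o).2
  | succ f ih =>
    intro K o hK
    rcases hK.lt_or_eq with h | h
    · obtain ⟨j, hj, h1, h2, h3, h4⟩ := ih (K + 1) o (by
        rw [Nat.cast_add_one]; exact Order.add_one_le_of_lt h)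
      have e : K + 1 + j = K + (j + 1) := by omega
      rw [e] at h1 h2 h3 h4
      refine ⟨j + 1, by omega, h1, h2.imp (by omega) id, ?_, ?_⟩
      · have hc : cap ℓ K = true := by simp [cap, h]
        simp only [List.replicate_succ, List.cons_append, brun, hc, if_true, Bool.false_and,
          Bool.false_or, h3, Nat.add_sub_add_right]
      · have hc : cap ℓ K = true := by simp [cap, h]
        simp only [List.replicate_succ, List.cons_append, bst, hc, if_true,
          Bool.false_or, h4, Nat.add_sub_add_right]
    · refine ⟨0, by omega, hK, Or.inr h, ?_, ?_⟩
      · rw [brun_append, (brun_full ℓ K h (f + 1) o).1, (brun_full ℓ K h (f + 1) o).2]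
        rw [(brun_empty (cap ℓ) d _ _).1]
        simp only [block, List.replicate_succ, mk_cons, mk_false, List.map_append, List.map_replicate,
          Nat.sub_zero, Nat.add_zero, Nat.add_right_comm f 1, List.cons_append, List.replicate_zero,
          List.append_nil, Nat.succ_ne_zero, if_false, ← List.append_assoc,
          List.replicate_append_replicate, List.nil_append]
      · rw [bst_append, (brun_full ℓ K h (f + 1) o).2, (brun_empty (cap ℓ) d _ _).2]
        simp

/-- The carrier `(a, b, c)` of the box-basket-ball system that has `K` balls on board, in the sense
of `brun`, and that holds back a part of the next site, namely `g` full and `h` empty boxes that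
`brun` has left behind already. -/
noncomputable def carr (ℓ : ℕ∞) (K g h : ℕ) : Carrier := ⟨ℓ - K + h, g + h, K + g⟩

theorem new_of_empty (ℓ : ℕ∞) (K g h : ℕ) (e : ℕ) (hl : 1 ≤ ℓ) (hK : (K : ℕ∞) ≤ ℓ)
    (hh : K = 0 ∨ h = 0) :
    newSite (carr ℓ K g h) ⟨e + 1, e, 0⟩ =
      (if K = 0 then ⟨h + 1, g + h, g⟩ else ⟨0, g, g + 1⟩) ∧
    newCarrier (carr ℓ K g h) ⟨e + 1, e, 0⟩ =
      carr ℓ (K - 1 - min (K - 1) e) (min (K - 1) e) (e - min (K - 1) e) := by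
  induction ℓ using ENat.recTopCoe with
  | top =>
    have : carr ⊤ K g h = ⟨⊤, g + h, K + g⟩ := by simp [carr]
    rw [this, (newSite_top _ _ _).1, (newSite_top _ _ _).2]
    constructor
    · split <;> simp only [Site.mk.injEq] <;> omega
    · simp only [carr, ENat.top_sub_natCast, top_add, Carrier.mk.injEq, true_and]
      omega
  | coe n =>
    have hK' : K ≤ n := by exact_mod_cast hK
    have hl' : 1 ≤ n := by exact_mod_cast hl
    simp only [carr, newSite, newCarrier, min₁, min₂, min₃, ← Nat.cast_add, cast_min',
      ENat.toNat_natCast, ← ENat.natCast_sub]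
    constructor
    · split <;> simp only [Site.mk.injEq] <;> omega
    · simp only [Carrier.mk.injEq, Nat.cast_inj]
      omega

theorem new_of_full (ℓ : ℕ∞) (K g h j : ℕ) (d f : ℕ) (hl : 1 ≤ ℓ)
    (hh : K = 0 ∨ h = 0) (hf : 1 ≤ f) (hj : j ≤ f) (hKj : ((K + j : ℕ) : ℕ∞) ≤ ℓ)
    (hj' : j = f ∨ ((K + j : ℕ) : ℕ∞) = ℓ) :
    newSite (carr ℓ K g h) ⟨d, d + f - 1, f⟩ =
      (if j = 0 then ⟨0, g, g + 1⟩ else ⟨h + j, g + h + j - 1, g⟩) ∧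
    newCarrier (carr ℓ K g h) ⟨d, d + f - 1, f⟩ =
      carr ℓ (K + j - min (K + j) d) ((if j = 0 then f - 1 else f - j) + min (K + j) d)
        (d - min (K + j) d) := by
  induction ℓ using ENat.recTopCoe with
  | top =>
    have : carr ⊤ K g h = ⟨⊤, g + h, K + g⟩ := by simp [carr]
    have hj : j = f := by simpa using hj'
    subst hj
    rw [this, (newSite_top _ _ _).1, (newSite_top _ _ _).2]
    constructor
    · split <;> simp only [Site.mk.injEq] <;> omega
    · simp only [carr, ENat.top_sub_natCast, top_add, Carrier.mk.injEq, true_and]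
      split <;> omega
  | coe n =>
    have hK' : K + j ≤ n := by exact_mod_cast hKj
    have hl' : 1 ≤ n := by exact_mod_cast hl
    have hj'' : j = f ∨ K + j = n := by exact_mod_cast hj'
    have h1 : min₁ (carr n K g h) ⟨d, d + f - 1, f⟩ = g + h + j := by
      simp only [carr, min₁, ← Nat.cast_add, cast_min', ENat.toNat_natCast, ← ENat.natCast_sub]
      rcases hh with rfl | rfl <;> omega
    have h2 : min₂ (carr n K g h) ⟨d, d + f - 1, f⟩ = d + g := by
      simp only [carr, min₂]
      rcases hh with rfl | rfl <;> omega
    have h3 : min₃ (carr n K g h) ⟨d, d + f - 1, f⟩ = if j = 0 then d + f - 1 else d + f := by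
      simp only [carr, min₃, ← Nat.cast_add, cast_min', ENat.toNat_natCast, ← ENat.natCast_sub]
      split <;> rcases hh with rfl | rfl <;> omega
    simp only [newSite, newCarrier, h1, h2, h3]
    simp only [carr, ← Nat.cast_add, ← ENat.natCast_sub]
    constructor
    · split <;> simp only [Site.mk.injEq] <;> refine ⟨?_, ?_, ?_⟩ <;> omega
    · simp only [Carrier.mk.injEq, Nat.cast_inj]
      split <;> refine ⟨?_, ?_, ?_⟩ <;> omega

/-- While the carrier passes one site of the box-basket-ball system, `brun` passes its boxes. -/
theorem site_step (ℓ : ℕ∞) (K g h : ℕ) (s : Site) (hl : 1 ≤ ℓ) (hK : (K : ℕ∞) ≤ ℓ)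
    (hh : K = 0 ∨ h = 0) (hs : s.Admissible) :
    ∃ K' g' h' : ℕ, (K' : ℕ∞) ≤ ℓ ∧ (K' = 0 ∨ h' = 0) ∧
      newCarrier (carr ℓ K g h) s = carr ℓ K' g' h' ∧
      (newSite (carr ℓ K g h) s).Admissible ∧
      mk true (block g h) ++ brun (cap ℓ) K (decide (g + h = 0)) (encS s) =
        encS (newSite (carr ℓ K g h) s) ++ mk true (block g' h') ∧
      bst (cap ℓ) K (decide (g + h = 0)) (encS s) = (K', decide (g' + h' = 0)) := by
  obtain ⟨d, e, f⟩ := s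
  simp only [Site.Admissible] at hs
  have hmk : ∀ g h, mk true (block g h) ++ [(false, decide (g + h = 0))] =
      mk true (block g (h + 1)) := by
    intro g h
    rcases g with _ | g
    · rcases h with _ | h
      · simp [block]
      · simp [block, List.replicate_succ, mk_false,
          ← List.replicate_succ']
    · simp [block, List.replicate_succ, mk_false, ← List.replicate_succ']
  have hmk' : ∀ g, mk true (block g 0) ++ [(true, decide (g + 0 = 0))] =
      mk true (block (g + 1) 0) := by
    intro g
    rcases g with _ | g
    · simp [block]
    · simp [block, List.replicate_succ, mk_false, ← List.replicate_succ']
  rcases Nat.eq_zero_or_pos f with rfl | hf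
  · obtain rfl : d = e + 1 := by omega
    obtain ⟨h1, h2⟩ := new_of_empty ℓ K g h e hl hK hh
    refine ⟨_, _, _, ?_, ?_, h2, ?_, ?_, ?_⟩
    · refine le_trans ?_ hK
      exact_mod_cast (by omega)
    · omega
    · rw [h1]
      split <;> simp only [Site.Admissible] <;> omega
    · have he : encS ⟨e + 1, e, 0⟩ = (false, true) :: List.replicate e (false, false) := by
        simp [encS, block, List.replicate_succ, mk_false]
      rw [he, h1]
      rcases Nat.eq_zero_or_pos K with rfl | hK0
      · simp only [brun, if_true, (brun_empty _ _ _ _).1]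
        rw [List.append_cons, hmk]
        simp [encS]
      · obtain rfl : h = 0 := by omega
        simp only [brun, hK0.ne', if_false, (brun_empty _ _ _ _).1]
        rw [List.append_cons, hmk']
        simp [encS]
    · have he : encS ⟨e + 1, e, 0⟩ = (false, true) :: List.replicate e (false, false) := by
        simp [encS, block, List.replicate_succ, mk_false]
      rw [he]
      have hx : min (K - 1) e + (e - min (K - 1) e) = e := by omega
      rcases Nat.eq_zero_or_pos K with rfl | hK0
      · simp only [bst, if_true, (brun_empty _ _ _ _).2, hx]
        simp only [Prod.mk.injEq]
        refine ⟨trivial, ?_⟩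
        by_cases h0 : e = 0 <;> simp [h0]
      · simp only [bst, hK0.ne', if_false, (brun_empty _ _ _ _).2, hx]
        simp only [Prod.mk.injEq]
        refine ⟨trivial, ?_⟩
        by_cases h0 : e = 0 <;> simp [h0]
  · obtain ⟨f, rfl⟩ : ∃ f', f = f' + 1 := ⟨f - 1, by omega⟩
    have he : encS ⟨d, e, f + 1⟩ = (true, true) :: (List.replicate f (true, false) ++
        List.replicate d (false, false)) := by
      simp [encS, block, List.replicate_succ, mk_false]
    obtain rfl : e = d + (f + 1) - 1 := by omega
    rw [he]
    rcases hK.lt_or_eq with hlt | heq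
    · obtain ⟨j, hj, h1, h2, h3, h4⟩ := brun_run ℓ f d (K + 1) true (by
        rw [Nat.cast_add_one]; exact Order.add_one_le_of_lt hlt)
      have e : K + 1 + j = K + (j + 1) := by omega
      rw [e] at h1 h2 h3 h4
      obtain ⟨h5, h6⟩ := new_of_full ℓ K g h (j + 1) d (f + 1) hl hh (by omega) (by omega) h1
        (h2.imp (by omega) id)
      have hc : cap ℓ K = true := by simp [cap, hlt]
      refine ⟨_, _, _, ?_, ?_, h6, ?_, ?_, ?_⟩
      · refine le_trans ?_ h1
        exact_mod_cast (by omega)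
      · omega
      · rw [h5]
        split <;> simp only [Site.Admissible] <;> omega
      · rw [h5]
        simp only [brun, hc, if_true, Bool.true_and, Bool.true_or, h3, Nat.succ_ne_zero, if_false,
          Nat.add_sub_add_right]
        rw [List.append_cons, hmk, ← List.append_assoc]
        congr 1
        simp only [encS]
        rcases g with _ | g <;>
        simp [block, List.replicate_succ, mk_false, List.replicate_append_replicate,
          ← Nat.add_assoc]
      · simp only [bst, hc, if_true, Bool.true_or, h4, Nat.succ_ne_zero, if_false,
          Nat.add_sub_add_right, Prod.mk.injEq, true_and]
        split <;> rename_i h0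
        · symm; rw [decide_eq_true_iff]; omega
        · symm; rw [decide_eq_false_iff_not]; omega
    · have hK0 : K ≠ 0 := by
        rintro rfl
        rw [← heq] at hl
        simp at hl
      obtain rfl : h = 0 := by omega
      obtain ⟨h5, h6⟩ := new_of_full ℓ K g 0 0 d (f + 1) hl hh (by omega) (by omega)
        (by simpa using hK) (Or.inr (by simpa using heq))
      have hc : cap ℓ K = false := by simp [cap, heq]
      obtain ⟨j, hj, h1, h2, h3, h4⟩ := brun_run ℓ f d K true hK
      obtain rfl : j = 0 := by
        rw [← heq] at h1
        have : K + j ≤ K := by exact_mod_cast h1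
        omega
      refine ⟨_, _, _, ?_, ?_, h6, ?_, ?_, ?_⟩
      · refine le_trans ?_ hK
        exact_mod_cast (by omega)
      · omega
      · rw [h5]
        simp [Site.Admissible]
      · rw [h5]
        simp only [brun, hc, if_true, Bool.false_eq_true, if_false, h3]
        rw [List.append_cons, hmk']
        simp [encS]
      · simp only [bst, hc, Bool.false_eq_true, if_true, h4, if_false, Prod.mk.injEq]
        refine ⟨by simp, ?_⟩
        split <;> rename_i h0
        · symm; rw [decide_eq_true_iff]; omega
        · symm; rw [decide_eq_false_iff_not]; omega

/-! ### The sites that the carrier passes -/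

/-- The sites after the carrier has passed them. -/
noncomputable def runSites : Carrier → List Site → List Site
  | _, [] => []
  | C, s :: l => newSite C s :: runSites (newCarrier C s) l

/-- The carrier after it has passed the sites. -/
noncomputable def runCarrier : Carrier → List Site → Carrier
  | C, [] => C
  | C, s :: l => runCarrier (newCarrier C s) l

theorem enc_cons (s : Site) (l : List Site) : enc (s :: l) = encS s ++ enc l := rfl

theorem enc_append (l l' : List Site) : enc (l ++ l') = enc l ++ enc l' := by
  simp [enc]

/-- The carrier of the box-basket-ball system, seen box by box. -/
theorem run_enc (ℓ : ℕ∞) (hl : 1 ≤ ℓ) (l : List Site) : ∀ (K g h : ℕ), (K : ℕ∞) ≤ ℓ →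
    (K = 0 ∨ h = 0) → (∀ s ∈ l, s.Admissible) →
    ∃ K' g' h' : ℕ, (K' : ℕ∞) ≤ ℓ ∧ (K' = 0 ∨ h' = 0) ∧
      runCarrier (carr ℓ K g h) l = carr ℓ K' g' h' ∧
      (∀ s ∈ runSites (carr ℓ K g h) l, s.Admissible) ∧
      mk true (block g h) ++ brun (cap ℓ) K (decide (g + h = 0)) (enc l) =
        enc (runSites (carr ℓ K g h) l) ++ mk true (block g' h') ∧
      bst (cap ℓ) K (decide (g + h = 0)) (enc l) = (K', decide (g' + h' = 0)) := by
  induction l with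
  | nil =>
    intro K g h hK hh _
    exact ⟨K, g, h, hK, hh, rfl, by simp [runSites], by simp [enc, brun, runSites], rfl⟩
  | cons s l ih =>
    intro K g h hK hh hs
    obtain ⟨K1, g1, h1, a1, a2, a3, a4, a5, a6⟩ :=
      site_step ℓ K g h s hl hK hh (hs s (by simp))
    obtain ⟨K2, g2, h2, b1, b2, b3, b4, b5, b6⟩ :=
      ih K1 g1 h1 a1 a2 (fun s hs' => hs s (by simp [hs']))
    refine ⟨K2, g2, h2, b1, b2, by simp [runCarrier, a3, b3], ?_, ?_, ?_⟩
    · intro s' hs'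
      simp only [runSites, List.mem_cons, a3] at hs'
      rcases hs' with rfl | hs'
      · exact a4
      · exact b4 _ hs'
    · rw [enc_cons, brun_append, a6, ← List.append_assoc, a5, List.append_assoc, b5]
      simp [runSites, enc_cons, a3]
    · rw [enc_cons, bst_append, a6, b6]

theorem carr_zero (ℓ : ℕ∞) : carr ℓ 0 0 0 = ⟨ℓ, 0, 0⟩ := by simp [carr]

theorem newSite_V (ℓ : ℕ∞) (hl : 1 ≤ ℓ) : newSite ⟨ℓ, 0, 0⟩ V = V := by
  rw [← carr_zero]
  exact (new_of_empty ℓ 0 0 0 0 hl (by simp) (Or.inl rfl)).1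

theorem newCarrier_V (ℓ : ℕ∞) (hl : 1 ≤ ℓ) : newCarrier ⟨ℓ, 0, 0⟩ V = ⟨ℓ, 0, 0⟩ := by
  rw [← carr_zero]
  exact (new_of_empty ℓ 0 0 0 0 hl (by simp) (Or.inl rfl)).2

theorem place_of_lt (w : List Site) (p i : ℤ) (h : i < p) : place w p i = V := by
  simp [place, h]

theorem place_add (w : List Site) (p : ℤ) (n : ℕ) : place w p (p + n) = w.getD n V := by
  simp [place]

theorem runCarrier_append (C : Carrier) (l l' : List Site) :
    runCarrier C (l ++ l') = runCarrier (runCarrier C l) l' := by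
  induction l generalizing C with
  | nil => rfl
  | cons s l ih => simp [runCarrier, ih]

theorem runSites_append (C : Carrier) (l l' : List Site) :
    runSites C (l ++ l') = runSites C l ++ runSites (runCarrier C l) l' := by
  induction l generalizing C with
  | nil => rfl
  | cons s l ih => simp [runCarrier, runSites, ih]

theorem runSites_length (C : Carrier) (l : List Site) : (runSites C l).length = l.length := by
  induction l generalizing C with
  | nil => rfl
  | cons s l ih => simp [runSites, ih]

theorem scan_eq_init (ℓ : ℕ∞) (hl : 1 ≤ ℓ) (S : State) (q : ℤ) (n : ℕ)
    (h : ∀ i : ℤ, q ≤ i → i < q + n → S i = V) : scan ℓ S q n = ⟨ℓ, 0, 0⟩ := by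
  induction n with
  | zero => rfl
  | succ n ih =>
    rw [scan, ih (fun i h1 h2 => h i h1 (by push_cast; omega)),
      h _ (by omega) (by push_cast; omega), newCarrier_V ℓ hl]

theorem scan_add (ℓ : ℕ∞) (S : State) (q : ℤ) (n m : ℕ) (h : scan ℓ S q n = ⟨ℓ, 0, 0⟩) :
    scan ℓ S q (n + m) = scan ℓ S (q + n) m := by
  induction m with
  | zero => exact h
  | succ m ih =>
    rw [← Nat.add_assoc, scan, ih, scan]
    push_cast
    rw [add_assoc]

/-- The carrier may start at any place to the left of the state. -/
theorem T_eq_scan (ℓ : ℕ∞) (hl : 1 ≤ ℓ) (S : State) (q : ℤ) (h : ∀ i < q, S i = V) (i : ℤ) :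
    T ℓ S i = newSite (scan ℓ S q (i - q).toNat) (S i) := by
  by_cases hS : ∀ i, S i = V
  · rw [T, scan_eq_init ℓ hl S _ _ (fun i _ _ => hS i), scan_eq_init ℓ hl S _ _ (fun i _ _ => hS i)]
  · push Not at hS
    have hb : BddBelow {i | S i ≠ V} := ⟨q, fun i hi => not_lt.1 fun h' => hi (h i h')⟩
    have hlow : ∀ i < leftEnd S, S i = V := by
      intro i hi
      by_contra h'
      exact absurd (csInf_le hb h') (not_le.2 hi)
    have hq : q ≤ leftEnd S := by
      have := Int.csInf_mem (s := {i | S i ≠ V}) hS hb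
      exact not_lt.1 fun h' => this (h _ h')
    rcases lt_or_ge i (leftEnd S) with hi | hi
    · rw [T, hlow i hi, show (i - leftEnd S).toNat = 0 by omega]
      rw [scan_eq_init ℓ hl S q _ (fun j h1 h2 => hlow j (by omega))]
      rfl
    · rw [T]
      congr 1
      obtain ⟨n, hn⟩ := Int.le.dest hq
      obtain ⟨m, rfl⟩ := Int.le.dest hi
      rw [← hn, show (q + (n : ℤ) + m - q).toNat = n + m by omega,
        scan_add ℓ S q n m (scan_eq_init ℓ hl S _ _ fun j h1 h2 => hlow j (by omega))]
      simp

theorem scan_place (ℓ : ℕ∞) (l : List Site) (p : ℤ) (n : ℕ) (hn : n ≤ l.length) :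
    scan ℓ (place l p) p n = runCarrier ⟨ℓ, 0, 0⟩ (l.take n) := by
  induction n with
  | zero => simp [scan, runCarrier]
  | succ n ih =>
    rw [scan, ih (by omega), place_add, List.take_add_one, runCarrier_append,
      List.getD_eq_getElem _ _ (by omega), List.getElem?_eq_getElem (by omega)]
    rfl

/-- The time evolution of a list of sites that ends with enough vacuum. -/
theorem T_place (ℓ : ℕ∞) (hl : 1 ≤ ℓ) (l : List Site) (p : ℤ)
    (h : runCarrier ⟨ℓ, 0, 0⟩ l = ⟨ℓ, 0, 0⟩) :
    T ℓ (place l p) = place (runSites ⟨ℓ, 0, 0⟩ l) p := by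
  funext i
  rw [T_eq_scan ℓ hl _ p (fun i hi => place_of_lt _ _ _ hi)]
  rcases lt_or_ge i p with hi | hi
  · rw [place_of_lt _ _ _ hi, place_of_lt _ _ _ hi, show (i - p).toNat = 0 by omega]
    exact newSite_V ℓ hl
  · obtain ⟨n, rfl⟩ := Int.le.dest hi
    rw [place_add, place_add, show (p + (n : ℤ) - p).toNat = n by omega]
    rcases lt_or_ge n l.length with hn | hn
    · rw [scan_place _ _ _ _ hn.le, List.getD_eq_getElem _ _ hn,
        List.getD_eq_getElem _ _ (by rwa [runSites_length])]
      have : runSites ⟨ℓ, 0, 0⟩ l = runSites ⟨ℓ, 0, 0⟩ (l.take n) ++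
          runSites (runCarrier ⟨ℓ, 0, 0⟩ (l.take n)) (l[n] :: l.drop (n + 1)) := by
        rw [← runSites_append, List.cons_getElem_drop_succ, List.take_append_drop]
      simp only [this]
      rw [List.getElem_append_right (by simp [runSites_length])]
      simp [runSites_length, runSites, hn.le]
    · obtain ⟨m, rfl⟩ := Nat.exists_eq_add_of_le hn
      have h0 : scan ℓ (place l p) p l.length = ⟨ℓ, 0, 0⟩ := by
        rw [scan_place _ _ _ _ le_rfl, List.take_length, h]
      rw [scan_add _ _ _ _ _ h0, scan_eq_init ℓ hl]
      · rw [List.getD_eq_default _ _ hn, List.getD_eq_default _ _ (by rwa [runSites_length])]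
        exact newSite_V ℓ hl
      · intro i h1 _
        obtain ⟨k, rfl⟩ := Int.le.dest h1
        rw [show p + (l.length : ℤ) + k = p + ((l.length + k : ℕ) : ℤ) by push_cast; ring, place_add,
          List.getD_eq_default _ _ (by omega)]

/-! ### Skeleton, colours and marks -/

/-- The first entry of a list that is continued by `d`. -/
def hd (d : Bool) (l : List Bool) : Bool := l.headD d

@[simp] theorem hd_nil (d : Bool) : hd d [] = d := rfl

@[simp] theorem hd_cons (d x : Bool) (l : List Bool) : hd d (x :: l) = x := rfl

/-- The boxes that are described by the skeleton `t`, the colours `X` and the marks `ys`. An entry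
`true` of the skeleton stands for a slow ball, which occupies two boxes, a full and an empty one in
the order that keeps it apart from the last slot; an entry `false` stands for a slot, which has a
colour (`true` for a ball), and occupies one box if its colour is that of the preceding slot, and
two boxes otherwise. `c` is the colour of the last slot before these boxes. Full boxes that follow
an empty one carry a mark in any case; the marks `ys` are those of the other boxes. Colours and
marks that are not listed are `false` and `true`. -/
def inf : Bool → List Bool → List Bool → List Bool → List Box
  | _, [], _, _ => []
  | c, true :: t, X, ys =>
      if c then (false, hd true ys) :: (true, true) :: inf c t X ys.tail
      else (true, true) :: (false, hd true ys) :: inf c t X ys.tail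
  | c, false :: t, X, ys =>
      if hd false X then
        if c then (true, hd true ys) :: inf true t X.tail ys.tail
        else (true, true) :: (true, hd true ys) :: inf true t X.tail ys.tail
      else
        if c then (false, hd true ys) :: (false, hd true ys.tail) ::
          inf false t X.tail ys.tail.tail
        else (false, hd true ys) :: inf false t X.tail ys.tail

@[simp] theorem inf_hd_tail (c : Bool) (t X ys : List Bool) :
    inf c t X (hd true ys :: ys.tail) = inf c t X ys := by
  cases t with
  | nil => rfl
  | cons a t => cases a <;> rfl

/-! ### The carrier acts on the colours -/

/-- The new colour of a slot of colour `d` that is passed by a carrier with `δ` balls, in the ordinary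
box-ball system. -/
def bout (room : ℕ → Bool) (δ : ℕ) (d : Bool) : Bool := if d then !room δ else decide (δ ≠ 0)

/-- The number of balls that the carrier has after it has passed a slot of colour `d`. -/
def bnext (room : ℕ → Bool) (δ : ℕ) (d : Bool) : ℕ :=
  if d then (if room δ then δ + 1 else δ) else δ - 1

/-- The colours after a carrier that starts with `δ` balls has passed the slots; the balls that
remain on board are put into the next slots. -/
def bev (room : ℕ → Bool) : ℕ → List Bool → List Bool
  | δ, [] => List.replicate δ true
  | δ, d :: X => bout room δ d :: bev room (bnext room δ d) X

theorem bev_headD (room : ℕ → Bool) (δ : ℕ) (X : List Bool) :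
    hd false (bev room δ X) = bout room δ (hd false X) := by
  cases X with
  | nil => cases δ <;> simp [bev, bout, List.replicate_succ]
  | cons d X => rfl

theorem bev_tail (room : ℕ → Bool) (δ : ℕ) (X : List Bool) :
    (bev room δ X).tail = bev room (bnext room δ (hd false X)) X.tail := by
  cases X with
  | nil => cases δ <;> simp [bev, bnext, List.replicate_succ]
  | cons d X => rfl

/-- The states that may occur while the carrier passes described boxes: `c` and `c'` are the old and
the new colour of the last slot, `δ` is the number of balls of the carrier that passes the slots,
`o` is the waiting mark. The carrier that passes the boxes has `δ` balls, and another one if `c` is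
`true`. -/
def Inv (room : ℕ → Bool) : Bool → Bool → ℕ → Bool → Prop
  | false, false, δ, _ => δ = 0
  | true, true, δ, _ => room δ = true ∧ room (δ + 1) = false
  | false, true, δ, _ => room (δ + 1) = true
  | true, false, δ, o => δ ≠ 0 ∧ o = true ∧ room δ = true

/-- The state, in the sense of `Inv`, after the carrier has passed the described boxes. -/
def fstate (room : ℕ → Bool) : Bool → Bool → ℕ → Bool → List Bool → List Bool → List Bool →
    Bool × Bool × ℕ × Bool
  | c, c', δ, o, [], _, _ => (c, c', δ, o)
  | c, c', δ, _, true :: t, X, ys => fstate room c c' δ (c || hd true ys) t X ys.tail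
  | c, _, δ, _, false :: t, X, ys =>
      fstate room (hd false X) (bout room δ (hd false X)) (bnext room δ (hd false X))
        (if c && !hd false X then hd true ys.tail
          else (hd false X && !bout room δ (hd false X)) || hd true ys) t X.tail
        (if c && !hd false X then ys.tail.tail else ys.tail)

/-- The lag between the boxes that the carrier leaves behind and the boxes of the new description: it
is one box, unless the last slot has changed its colour. -/
def pre (c c' o : Bool) : List Box := if c = c' then [(c, o)] else []

/-- The central computation. When the carrier passes the boxes described by `t`, `X` and `ys`, it
leaves behind boxes that are described by the same skeleton and the same marks, and by colours that
evolve by a carrier whose capacity is smaller by one. -/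
theorem key (room : ℕ → Bool) (h0 : room 0 = true) (hr : ∀ n, room (n + 1) = true → room n = true)
    (t : List Bool) : ∀ (c c' : Bool) (δ : ℕ) (o : Bool) (X ys : List Bool), Inv room c c' δ o →
    (bst room (δ + c.toNat) o (inf c t X ys) =
      ((fstate (fun n => room (n + 1)) c c' δ o t X ys).2.2.1 +
        (fstate (fun n => room (n + 1)) c c' δ o t X ys).1.toNat,
        (fstate (fun n => room (n + 1)) c c' δ o t X ys).2.2.2)) ∧
    pre c c' o ++ inf c' t (bev (fun n => room (n + 1)) δ X) (if !c && c' then o :: ys else ys) =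
      brun room (δ + c.toNat) o (inf c t X ys) ++
        pre (fstate (fun n => room (n + 1)) c c' δ o t X ys).1
          (fstate (fun n => room (n + 1)) c c' δ o t X ys).2.1
          (fstate (fun n => room (n + 1)) c c' δ o t X ys).2.2.2 := by
  induction t with
  | nil =>
    intro c c' δ o X ys _
    simp [inf, brun, bst, fstate]
  | cons a t ih =>
    intro c c' δ o X ys hI
    cases a with
    | true =>
      cases c <;> cases c' <;> simp only [Inv] at hI
      · subst hI
        have := ih false false 0 (hd true ys) X ys.tail rfl
        simp [pre] at this
        simp [inf, brun, bst, h0, fstate, this, pre]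
      · have := ih false true δ (hd true ys) X ys.tail hI
        simp [pre] at this
        simp [inf, brun, bst, fstate, this, pre, hr _ hI]
      · obtain ⟨h1, rfl, h2⟩ := hI
        have := ih true false δ true X ys.tail ⟨h1, rfl, h2⟩
        simp [pre] at this
        simp [inf, brun, bst, fstate, this, pre, h2]
      · have := ih true true δ true X ys.tail hI
        simp [pre] at this
        simp [inf, brun, bst, fstate, this, pre, hI.1]
    | false =>
      have hb := bev_headD (fun n => room (n + 1)) δ X
      have hb' := bev_tail (fun n => room (n + 1)) δ X
      cases hX : hd false X <;> rw [hX] at hb hb' <;>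
        cases c <;> cases c' <;> simp only [Inv] at hI
      · subst hI
        have := ih false false 0 (hd true ys) X.tail ys.tail rfl
        simp [pre] at this
        simp [bout, bnext] at hb hb'
        simp [inf, brun, bst, fstate, hX, hb, hb', this, pre, bout, bnext]
      · rcases Nat.eq_zero_or_pos δ with rfl | hδ
        · have := ih false false 0 (hd true ys) X.tail ys.tail rfl
          simp [pre] at this
          simp [bout, bnext] at hb hb'
          simp [inf, brun, bst, fstate, hX, hb, hb', this, pre, bout, bnext]
        · obtain ⟨δ, rfl⟩ : ∃ n, δ = n + 1 := ⟨δ - 1, by omega⟩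
          have := ih false true δ (hd true ys) X.tail ys.tail (hr _ hI)
          simp [pre] at this
          simp [bout, bnext] at hb hb'
          simp [inf, brun, bst, fstate, hX, hb, hb', this, pre, bout, bnext]
      · obtain ⟨h1, rfl, h2⟩ := hI
        obtain ⟨δ, rfl⟩ : ∃ n, δ = n + 1 := ⟨δ - 1, by omega⟩
        have := ih false true δ (hd true ys.tail) X.tail ys.tail.tail h2
        simp [pre] at this
        simp [bout, bnext] at hb hb'
        simp [inf, brun, bst, fstate, hX, hb, hb', this, pre, bout, bnext]
      · rcases Nat.eq_zero_or_pos δ with rfl | hδ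
        · have := ih false false 0 (hd true ys.tail) X.tail ys.tail.tail rfl
          simp [pre] at this
          simp [bout, bnext] at hb hb'
          simp [inf, brun, bst, fstate, hX, hb, hb', this, pre, bout, bnext]
        · obtain ⟨δ, rfl⟩ : ∃ n, δ = n + 1 := ⟨δ - 1, by omega⟩
          have := ih false true δ (hd true ys.tail) X.tail ys.tail.tail hI.1
          simp [pre] at this
          simp [bout, bnext] at hb hb'
          simp [inf, brun, bst, fstate, hX, hb, hb', this, pre, bout, bnext]
      · subst hI
        cases h1 : room 1
        · have := ih true true 0 (hd true ys) X.tail ys.tail ⟨h0, h1⟩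
          simp [pre] at this
          simp [bout, bnext, h1] at hb hb'
          simp [inf, brun, bst, fstate, hX, hb, hb', this, pre, bout, bnext, h1, h0]
        · have := ih true false 1 true X.tail ys.tail ⟨by simp, rfl, h1⟩
          simp [pre] at this
          simp [bout, bnext, h1] at hb hb'
          simp [inf, brun, bst, fstate, hX, hb, hb', this, pre, bout, bnext, h1, h0]
      · have := ih true false (δ + 1) true X.tail ys.tail ⟨by simp, rfl, hI⟩
        simp [pre] at this
        simp [bout, bnext, hI] at hb hb'
        simp [inf, brun, bst, fstate, hX, hb, hb', this, pre, bout, bnext, hI, hr _ hI]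
      · obtain ⟨h1, rfl, h2⟩ := hI
        cases h3 : room (δ + 1)
        · have := ih true true δ (hd true ys) X.tail ys.tail ⟨h2, h3⟩
          simp [pre] at this
          simp [bout, bnext, h3] at hb hb'
          simp [inf, brun, bst, fstate, hX, hb, hb', this, pre, bout, bnext, h3]
        · have := ih true false (δ + 1) true X.tail ys.tail ⟨by simp, rfl, h3⟩
          simp [pre] at this
          simp [bout, bnext, h3] at hb hb'
          simp [inf, brun, bst, fstate, hX, hb, hb', this, pre, bout, bnext, h3]
      · have := ih true true δ (hd true ys) X.tail ys.tail hI
        simp [pre] at this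
        simp [bout, bnext, hI.2] at hb hb'
        simp [inf, brun, bst, fstate, hX, hb, hb', this, pre, bout, bnext, hI.2]

theorem fstate_fixed (room : ℕ → Bool) (N : ℕ) :
    fstate room false false 0 true (List.replicate N false) [] [] = (false, false, 0, true) := by
  induction N with
  | zero => rfl
  | succ N ih => simpa [List.replicate_succ, fstate, bout, bnext] using ih

/-- After sufficiently many slots without balls the carrier is empty. -/
theorem fstate_final (room : ℕ → Bool) (t X ys : List Bool) : ∀ (c c' : Bool) (δ : ℕ) (o : Bool),
    ∃ N₀, ∀ N ≥ N₀, fstate room c c' δ o (t ++ List.replicate N false) X ys =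
      (false, false, 0, true) := by
  have h0 : ∀ (δ : ℕ) (c c' o : Bool), ∃ N₀, ∀ N ≥ N₀,
      fstate room c c' δ o (List.replicate N false) [] [] = (false, false, 0, true) := by
    intro δ
    induction δ with
    | zero =>
      intro c c' o
      refine ⟨1, fun N hN => ?_⟩
      obtain ⟨N, rfl⟩ := Nat.exists_eq_add_of_le' hN
      simpa [List.replicate_succ, fstate, bout, bnext] using fstate_fixed room N
    | succ δ ih =>
      intro c c' o
      obtain ⟨N₀, h⟩ := ih false true true
      refine ⟨N₀ + 1, fun N hN => ?_⟩
      obtain ⟨N, rfl⟩ := Nat.exists_eq_add_of_le' (show 1 ≤ N by omega)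
      simpa [List.replicate_succ, fstate, bout, bnext] using h N (by omega)
  have h1 : ∀ (n : ℕ) (X ys : List Bool), X.length + ys.length ≤ n → ∀ (c c' : Bool) (δ : ℕ)
      (o : Bool), ∃ N₀, ∀ N ≥ N₀, fstate room c c' δ o (List.replicate N false) X ys =
      (false, false, 0, true) := by
    intro n
    induction n with
    | zero =>
      intro X ys h
      obtain rfl : X = [] := List.length_eq_zero_iff.1 (by omega)
      obtain rfl : ys = [] := List.length_eq_zero_iff.1 (by omega)
      exact fun c c' δ o => h0 δ c c' o
    | succ n ih =>
      intro X ys h c c' δ o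
      by_cases hXY : X = [] ∧ ys = []
      · obtain ⟨rfl, rfl⟩ := hXY
        exact h0 δ c c' o
      · obtain ⟨N₀, hN₀⟩ := ih X.tail
          (if c && !hd false X then ys.tail.tail else ys.tail) (by
            have : X ≠ [] ∨ ys ≠ [] := by tauto
            have h3 : 0 < X.length ∨ 0 < ys.length := by
              simpa [List.length_pos_iff] using this
            split <;> simp only [List.length_tail] <;> omega)
          (hd false X) (bout room δ (hd false X)) (bnext room δ (hd false X))
          (if c && !hd false X then hd true ys.tail
            else (hd false X && !bout room δ (hd false X)) || hd true ys)
        refine ⟨N₀ + 1, fun N hN => ?_⟩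
        obtain ⟨N, rfl⟩ := Nat.exists_eq_add_of_le' (show 1 ≤ N by omega)
        rw [List.replicate_succ, fstate]
        exact hN₀ N (by omega)
  induction t generalizing X ys with
  | nil => exact fun c c' δ o => h1 _ X ys le_rfl c c' δ o
  | cons a t ih =>
    intro c c' δ o
    cases a <;> simp only [List.cons_append, fstate] <;> exact ih _ _ _ _ _ _

/-! ### Decoding -/

/-- Each full box that follows an empty one is marked: the property that distinguishes the boxes of a
list of sites. `b` tells whether the preceding box is full. -/
def wf : Bool → List Box → Prop
  | _, [] => True
  | b, (s, m) :: W => (s = true → b = false → m = true) ∧ wf s W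

theorem encS_eq (s : Site) (hs : s.Admissible) : ∃ x u, block s.c s.a = x :: u ∧
    encS s = (x, true) :: u.map fun y => (y, false) := by
  obtain ⟨a, b, c⟩ := s
  simp only [Site.Admissible] at hs
  rcases c with _ | c
  · obtain ⟨a, rfl⟩ : ∃ a', a = a' + 1 := ⟨a - 1, by omega⟩
    exact ⟨false, List.replicate a false, by simp [block, List.replicate_succ],
      by simp [encS, block, List.replicate_succ, mk_false]⟩
  · exact ⟨true, block c a, by simp [block, List.replicate_succ],
      by simp [encS, block, List.replicate_succ, mk_false]⟩

theorem block_inj {f d f' d' : ℕ} (h : block f d = block f' d') : f = f' ∧ d = d' := by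
  have h1 := congrArg (List.count true) h
  have h2 := congrArg (List.count false) h
  simpa [block, List.count_append, List.count_replicate] using And.intro h1 h2

theorem append_unmarked {u : List Bool} {W A B : List Box}
    (h : (u.map fun y => (y, false)) ++ W = A ++ B) (hB : ∀ x ∈ B.head?, x.2 = true) :
    ∃ A', A = (u.map fun y => (y, false)) ++ A' ∧ W = A' ++ B := by
  rcases List.append_eq_append_iff.1 h with ⟨A', h1, h2⟩ | ⟨C, h1, h2⟩
  · exact ⟨A', h1, h2⟩
  · rcases C with _ | ⟨x, C⟩
    · exact ⟨[], by simpa using h1.symm, by simpa using h2.symm⟩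
    · have h3 := hB x (by simp [h2])
      have h4 : x ∈ u.map fun y => (y, false) := by rw [h1]; simp
      obtain ⟨y, -, rfl⟩ := List.mem_map.1 h4
      simp at h3

theorem enc_head (l : List Site) (hl : ∀ s ∈ l, s.Admissible) : ∀ x ∈ (enc l).head?, x.2 = true := by
  rcases l with _ | ⟨s, l⟩
  · simp [enc]
  · obtain ⟨x, u, -, h⟩ := encS_eq s (hl s (by simp))
    simp [enc_cons, h]

/-- A list of sites may be cut wherever a marked box follows. -/
theorem enc_split (l : List Site) : ∀ (A B : List Box), (∀ s ∈ l, s.Admissible) → enc l = A ++ B →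
    (∀ x ∈ B.head?, x.2 = true) → ∃ l₁ l₂, l = l₁ ++ l₂ ∧ enc l₁ = A ∧ enc l₂ = B := by
  induction l with
  | nil =>
    intro A B _ h _
    have : A = [] ∧ B = [] := by simpa [enc] using h
    exact ⟨[], [], rfl, by simp [enc, this], by simp [enc, this]⟩
  | cons s l ih =>
    intro A B hl h hB
    obtain ⟨x, u, -, hx⟩ := encS_eq s (hl s (by simp))
    rcases A with _ | ⟨y, A⟩
    · exact ⟨[], s :: l, rfl, rfl, by simpa using h⟩
    · rw [enc_cons, hx, List.cons_append, List.cons_append, List.cons.injEq] at h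
      obtain ⟨rfl, h⟩ := h
      obtain ⟨A', rfl, h2⟩ := append_unmarked h hB
      obtain ⟨l₁, l₂, rfl, h3, h4⟩ := ih A' B (fun s hs => hl s (by simp [hs])) h2 hB
      exact ⟨s :: l₁, l₂, rfl, by simp [enc_cons, hx, h3], h4⟩

theorem enc_inj (l : List Site) : ∀ (l' : List Site), (∀ s ∈ l, s.Admissible) →
    (∀ s ∈ l', s.Admissible) → enc l = enc l' → l = l' := by
  induction l with
  | nil =>
    intro l' _ hl' h
    rcases l' with _ | ⟨s, l'⟩
    · rfl
    · obtain ⟨x, u, -, hx⟩ := encS_eq s (hl' s (by simp))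
      simp [hx, enc] at h
  | cons s l ih =>
    intro l' hl hl' h
    obtain ⟨x, u, hb, hx⟩ := encS_eq s (hl s (by simp))
    rcases l' with _ | ⟨s', l'⟩
    · simp [hx, enc] at h
    · obtain ⟨x', u', hb', hx'⟩ := encS_eq s' (hl' s' (by simp))
      have hl1 : ∀ s ∈ l, s.Admissible := fun s hs => hl s (by simp [hs])
      have hl1' : ∀ s ∈ l', s.Admissible := fun s hs => hl' s (by simp [hs])
      simp only [enc_cons, hx, hx', List.cons_append, List.cons.injEq, Prod.mk.injEq, and_true] at h
      obtain ⟨rfl, h⟩ := h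
      obtain ⟨A, h1, h2⟩ := append_unmarked h (enc_head l' hl1')
      obtain ⟨A', h1', h2'⟩ := append_unmarked h.symm (enc_head l hl1)
      have hA : A = [] := by
        have := congrArg List.length h1
        have := congrArg List.length h1'
        simp only [List.length_append, List.length_map] at *
        exact List.length_eq_zero_iff.1 (by omega)
      subst hA
      have hu : u = u' := by
        have := congrArg (List.map Prod.fst) h1
        simpa [Function.comp_def] using this.symm
      subst hu
      have hs : s = s' := by
        have h3 := block_inj (hb.trans hb'.symm)
        have h4 := hl s (by simp)
        have h5 := hl' s' (by simp)
        simp only [Site.Admissible] at h4 h5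
        ext <;> omega
      rw [hs, ih l' hl1 hl1' (by simpa using h2)]

theorem wf_map_block (f d : ℕ) (W : List Box) (hW : ∀ b, wf b W) :
    wf true ((block f d).map (fun y => (y, false)) ++ W) ∧
    wf false ((block 0 d).map (fun y => (y, false)) ++ W) := by
  have h : ∀ (b : Bool) (d : ℕ), wf b (List.replicate d ((false, false) : Box) ++ W) := by
    intro b d
    induction d generalizing b with
    | zero => simpa using hW b
    | succ d ih => simpa [List.replicate_succ, wf] using ih false
  refine ⟨?_, by simpa [block] using h false d⟩
  induction f with
  | zero => simpa [block] using h true d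
  | succ f ih => simpa [block, List.replicate_succ, wf] using ih

theorem wf_enc (l : List Site) (hl : ∀ s ∈ l, s.Admissible) : ∀ b, wf b (enc l) := by
  induction l with
  | nil => intro b; simp [enc, wf]
  | cons s l ih =>
    intro b
    have ih' := ih fun s hs => hl s (by simp [hs])
    obtain ⟨a, e, c⟩ := s
    have hs := hl _ (List.mem_cons_self)
    simp only [Site.Admissible] at hs
    rcases c with _ | c
    · obtain ⟨a, rfl⟩ : ∃ a', a = a' + 1 := ⟨a - 1, by omega⟩
      simpa [enc_cons, encS, block, List.replicate_succ, wf, mk_false] using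
        (wf_map_block 0 a _ ih').2
    · simpa [enc_cons, encS, block, List.replicate_succ, wf, mk_false] using
        (wf_map_block c a _ ih').1

/-- The boxes in front of the first mark belong to an unfinished site. -/
theorem exists_enc' (W : List Box) : ∀ b, wf b W → ∃ i j l, (b = false → i = 0) ∧
    (∀ s ∈ l, s.Admissible) ∧ W = ((block i j).map fun y => (y, false)) ++ enc l := by
  induction W with
  | nil => intro b _; exact ⟨0, 0, [], by simp, by simp, by simp [block, enc]⟩
  | cons x W ih =>
    intro b h
    obtain ⟨s, m⟩ := x
    obtain ⟨h1, h2⟩ := h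
    obtain ⟨i, j, l, h3, h4, rfl⟩ := ih s h2
    cases m with
    | true =>
      cases s with
      | true =>
        refine ⟨0, 0, ⟨j, i + j, i + 1⟩ :: l, by simp, ?_, ?_⟩
        · simpa [Site.Admissible, add_comm, add_assoc, add_left_comm] using h4
        · simp [enc_cons, encS, block, List.replicate_succ, mk_false]
      | false =>
        obtain rfl := h3 rfl
        refine ⟨0, 0, ⟨j + 1, j, 0⟩ :: l, by simp, ?_, ?_⟩
        · simpa [Site.Admissible] using h4
        · simp [enc_cons, encS, block, List.replicate_succ, mk_false]
    | false =>
      cases s with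
      | true =>
        refine ⟨i + 1, j, l, ?_, h4, ?_⟩
        · intro hb; simpa using h1 rfl hb
        · simp [block, List.replicate_succ]
      | false =>
        obtain rfl := h3 rfl
        exact ⟨0, j + 1, l, by simp, h4, by simp [block, List.replicate_succ]⟩

theorem exists_enc (W : List Box) (b : Bool) (h : wf b W) (hW : ∀ x ∈ W.head?, x.2 = true) :
    ∃ l, (∀ s ∈ l, s.Admissible) ∧ enc l = W := by
  obtain ⟨i, j, l, h1, h2, rfl⟩ := exists_enc' W b h
  refine ⟨l, h2, ?_⟩
  rcases hu : block i j with _ | ⟨x, u⟩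
  · simp
  · simp [hu] at hW

/-! ### Parsing -/

/-- The number of balls. -/
def balls (W : List Box) : ℕ := (W.map Prod.fst).count true

/-- Every list of boxes that satisfies `wf`, followed by vacuum, has a description. The colours
involve fewer balls than the boxes, because each run of balls is longer by one in the boxes; this
makes inductions on the number of balls possible. -/
theorem parse (n : ℕ) : ∀ (W : List Box) (c : Bool), W.length ≤ n → wf c W → ∃ t X ys,
    (∀ N, W ++ List.replicate (N + 2) (false, true) = inf c (t ++ List.replicate N false) X ys) ∧
    X.count true ≤ balls W ∧ (c = false → true ∈ X → X.count true < balls W) := by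
  have hV : ∀ N, inf false (List.replicate N false) [] [] = List.replicate N (false, true) := by
    intro N
    induction N with
    | zero => rfl
    | succ N ih => simpa [List.replicate_succ, inf] using ih
  have nilcase : ∀ c, ∃ t X ys,
      (∀ N, [] ++ List.replicate (N + 2) (false, true) = inf c (t ++ List.replicate N false) X ys) ∧
      X.count true ≤ balls [] ∧ (c = false → true ∈ X → X.count true < balls []) := by
    intro c
    cases c with
    | false =>
      refine ⟨[false, false], [], [], fun N => ?_, by simp [balls], by simp⟩
      simpa [inf, List.replicate_succ] using (hV N).symm
    | true =>
      refine ⟨[false], [], [], fun N => ?_, by simp [balls], by simp⟩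
      simpa [inf, List.replicate_succ] using (hV N).symm
  induction n with
  | zero =>
    intro W c hW _
    obtain rfl : W = [] := List.length_eq_zero_iff.1 (by omega)
    exact nilcase c
  | succ n ih =>
    intro W c hW hwf
    rcases W with _ | ⟨⟨s, m⟩, W⟩
    · exact nilcase c
    simp only [List.length_cons, Nat.add_le_add_iff_right] at hW
    obtain ⟨hm, hwf⟩ := hwf
    cases c <;> cases s
    · obtain ⟨t, X, ys, h1, h2, h3⟩ := ih W false hW hwf
      refine ⟨false :: t, false :: X, m :: ys, fun N => ?_, ?_, ?_⟩
      · simp [inf, ← h1]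
      · simpa [balls] using h2
      · simpa [balls] using h3
    · obtain rfl := hm rfl rfl
      rcases W with _ | ⟨⟨s', m'⟩, W⟩
      · refine ⟨[true, false], [], [], fun N => ?_, by simp, by simp⟩
        simpa [inf, List.replicate_succ] using (hV N).symm
      · simp only [List.length_cons] at hW
        cases s' with
        | false =>
          obtain ⟨t, X, ys, h1, h2, h3⟩ := ih W false (by omega) hwf.2
          refine ⟨true :: t, X, m' :: ys, fun N => ?_, ?_, ?_⟩
          · simp [inf, ← h1]
          · simp only [balls, List.map_cons, List.count_cons] at h2 ⊢; omega
          · intro _ hX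
            have := h3 rfl hX
            simp only [balls, List.map_cons, List.count_cons] at this ⊢; omega
        | true =>
          obtain ⟨t, X, ys, h1, h2, h3⟩ := ih W true (by omega) hwf.2
          refine ⟨false :: t, true :: X, m' :: ys, fun N => ?_, ?_, ?_⟩
          · simp [inf, ← h1]
          · simp [balls] at h2 ⊢; omega
          · intro _ _
            simp [balls] at h2 ⊢; omega
    · rcases W with _ | ⟨⟨s', m'⟩, W⟩
      · refine ⟨[false, false], [], [m], fun N => ?_, by simp [balls], by simp⟩
        simpa [inf, List.replicate_succ] using (hV N).symm
      · simp only [List.length_cons] at hW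
        cases s' with
        | false =>
          obtain ⟨t, X, ys, h1, h2, h3⟩ := ih W false (by omega) hwf.2
          refine ⟨false :: t, false :: X, m :: m' :: ys, fun N => ?_, ?_, by simp⟩
          · simp [inf, ← h1]
          · simpa [balls] using h2
        | true =>
          obtain rfl := hwf.1 rfl rfl
          obtain ⟨t, X, ys, h1, h2, h3⟩ := ih W true (by omega) hwf.2
          refine ⟨true :: t, X, m :: ys, fun N => ?_, ?_, by simp⟩
          · simp [inf, ← h1]
          · simp [balls] at h2 ⊢; omega
    · obtain ⟨t, X, ys, h1, h2, h3⟩ := ih W true hW hwf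
      refine ⟨false :: t, true :: X, m :: ys, fun N => ?_, ?_, by simp⟩
      · simp [inf, ← h1]
      · simp [balls] at h2 ⊢; omega

/-! ### Words and states -/

theorem place_ext_iff (l l' : List Site) (p : ℤ) :
    place l p = place l' p ↔ ∀ n, l.getD n V = l'.getD n V := by
  constructor
  · intro h n
    rw [← place_add l p n, h, place_add]
  · intro h
    funext i
    rcases lt_or_ge i p with hi | hi
    · rw [place_of_lt _ _ _ hi, place_of_lt _ _ _ hi]
    · obtain ⟨n, rfl⟩ := Int.le.dest hi
      rw [place_add, place_add, h]

theorem getD_replicate_self {α : Type*} (d : α) (n i : ℕ) : (List.replicate n d).getD i d = d := by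
  by_cases h : i < n
  · rw [List.getD_eq_getElem _ _ (by simpa using h)]
    simp
  · rw [List.getD_eq_default _ _ (by simpa using h)]

theorem place_append_V (l : List Site) (p : ℤ) (n : ℕ) :
    place (l ++ List.replicate n V) p = place l p := by
  rw [place_ext_iff]
  intro i
  rcases lt_or_ge i l.length with h | h
  · rw [List.getD_append _ _ _ _ h]
  · rw [List.getD_append_right _ _ _ _ h, List.getD_eq_default _ _ h]
    exact getD_replicate_self _ _ _

theorem place_V_append (l : List Site) (p : ℤ) (n : ℕ) :
    place (List.replicate n V ++ l) p = place l (p + n) := by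
  funext i
  rcases lt_or_ge i p with hi | hi
  · rw [place_of_lt _ _ _ hi, place_of_lt _ _ _ (by omega)]
  · obtain ⟨m, rfl⟩ := Int.le.dest hi
    rw [place_add]
    rcases lt_or_ge m n with h | h
    · rw [List.getD_append _ _ _ _ (by simpa using h), getD_replicate_self,
        place_of_lt _ _ _ (by omega)]
    · obtain ⟨k, rfl⟩ := Nat.exists_eq_add_of_le h
      rw [List.getD_append_right _ _ _ _ (by simp), List.length_replicate, Nat.add_sub_cancel_left,
        show p + ((n + k : ℕ) : ℤ) = p + n + k by push_cast; ring, place_add]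

theorem place_V (n : ℕ) (p : ℤ) : place (List.replicate n V) p = fun _ => V := by
  have := place_append_V [] p n
  rw [List.nil_append] at this
  rw [this]
  funext i
  simp [place]

theorem union_place (w l : List Site) (p : ℤ) :
    union (place w p) (place l (p + w.length)) = place (w ++ l) p := by
  funext i
  rcases lt_or_ge i p with hi | hi
  · simp [union, place_of_lt _ _ _ hi, place_of_lt l (p + w.length) i (by omega)]
  · obtain ⟨m, rfl⟩ := Int.le.dest hi
    simp only [union, place_add]
    rcases lt_or_ge m w.length with h | h
    · rw [List.getD_append _ _ _ _ h, place_of_lt l _ _ (by omega)]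
      split <;> simp_all
    · obtain ⟨k, rfl⟩ := Nat.exists_eq_add_of_le h
      rw [List.getD_eq_default _ _ h, if_pos rfl, List.getD_append_right _ _ _ _ h,
        Nat.add_sub_cancel_left,
        show p + ((w.length + k : ℕ) : ℤ) = p + w.length + k by push_cast; ring, place_add]

/-- The sites from `q` on of a disjoint union of waves. -/
def flat : ℤ → List Wave → List Site
  | _, [] => []
  | q, P :: L => List.replicate (P.pos - q).toNat V ++ (P.word ++ flat P.rightEnd L)

/-- Waves listed from left to right that do not overlap. -/
def Disjoint' (L : List Wave) : Prop := L.IsChain fun P Q => P.rightEnd ≤ Q.pos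

theorem superpose_eq (L : List Wave) : ∀ (q : ℤ), Disjoint' L → (∀ P ∈ L.head?, q ≤ P.pos) →
    superpose L = place (flat q L) q := by
  induction L with
  | nil => intro q _ _; funext i; simp [superpose, flat, place]
  | cons P L ih =>
    intro q h hq
    have hq' : q ≤ P.pos := hq P (by simp)
    have hL : Disjoint' L := h.of_cons
    have hP : ∀ Q ∈ L.head?, P.rightEnd ≤ Q.pos := by
      intro Q hQ
      rcases L with _ | ⟨Q', L⟩
      · simp at hQ
      · simp only [List.head?_cons, Option.mem_def, Option.some.injEq] at hQ
        subst hQ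
        exact (List.isChain_cons_cons.1 h).1
    rw [superpose, ih P.rightEnd hL hP, Wave.rightEnd, union_place, flat, place_V_append]
    congr 1
    omega

theorem exists_place (S : State) (hS : IsState S) :
    ∃ l p, (∀ s ∈ l, s.Admissible) ∧ S = place l p := by
  obtain ⟨h1, h2⟩ := hS
  obtain ⟨a, ha⟩ := h2.bddBelow
  obtain ⟨b, hb⟩ := h2.bddAbove
  refine ⟨(List.range (b - a + 1).toNat).map fun n : ℕ => S (a + n), a, ?_, ?_⟩
  · intro s hs
    obtain ⟨n, -, rfl⟩ := List.mem_map.1 hs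
    exact h1 _
  · funext i
    rcases lt_or_ge i a with hi | hi
    · rw [place_of_lt _ _ _ hi]
      by_contra h
      exact absurd (ha h) (by omega)
    · obtain ⟨n, rfl⟩ := Int.le.dest hi
      rw [place_add]
      rcases lt_or_ge n (b - a + 1).toNat with h | h
      · rw [List.getD_eq_getElem _ _ (by simpa using h)]
        simp
      · rw [List.getD_eq_default _ _ (by simpa using h)]
        by_contra h'
        exact absurd (hb h') (by omega)

/-! ### The evolution in terms of slots -/

/-- Lists of colours that agree up to entries `false` at their ends. -/
def Xeq (X X' : List Bool) : Prop := ∀ i, X.getD i false = X'.getD i false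

theorem Xeq.hd {X X' : List Bool} (h : Xeq X X') : hd false X = hd false X' := by
  have := h 0
  cases X <;> cases X' <;> simpa [BoxBasketBall.hd] using this

theorem getD_tail (X : List Bool) (i : ℕ) : X.tail.getD i false = X.getD (i + 1) false := by
  cases X <;> simp

theorem Xeq.tail {X X' : List Bool} (h : Xeq X X') : Xeq X.tail X'.tail := by
  intro i
  rw [getD_tail, getD_tail, h]

theorem Xeq.inf {X X' : List Bool} (h : Xeq X X') (c : Bool) (t ys : List Bool) :
    inf c t X ys = BoxBasketBall.inf c t X' ys := by
  induction t generalizing c X X' ys with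
  | nil => rfl
  | cons a t ih =>
    cases a <;> simp only [BoxBasketBall.inf]
    · rw [h.hd, ih h.tail, ih h.tail, ih h.tail]
    · rw [ih h]

theorem hd_eq_getD (X : List Bool) : hd false X = X.getD 0 false := by cases X <;> rfl

theorem Xeq.bev {X X' : List Bool} (h : Xeq X X') (room : ℕ → Bool) (δ : ℕ) :
    Xeq (bev room δ X) (bev room δ X') := by
  intro i
  induction i generalizing δ X X' with
  | zero => rw [← hd_eq_getD, ← hd_eq_getD, bev_headD, bev_headD, h.hd]
  | succ i ih => rw [← getD_tail, ← getD_tail, bev_tail, bev_tail, h.hd, ih h.tail]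

theorem Xeq_append_false (X : List Bool) (n : ℕ) : Xeq (X ++ List.replicate n false) X := by
  intro i
  rcases lt_or_ge i X.length with h | h
  · rw [List.getD_append _ _ _ _ h]
  · rw [List.getD_append_right _ _ _ _ h, List.getD_eq_default _ _ h]
    exact getD_replicate_self _ _ _

/-- The site with a ball or without, in a system without baskets. -/
def vf (b : Bool) : Site := if b then F else V

/-- The state without baskets whose sites from `0` on have the colours `X`. -/
def XS (X : List Bool) : State := place (X.map vf) 0

theorem vf_inj {b b' : Bool} (h : vf b = vf b') : b = b' := by
  revert h; cases b <;> cases b' <;> decide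

theorem vf_adm (b : Bool) : (vf b).Admissible := by
  cases b <;> simp [vf, Site.Admissible, V, F]

theorem getD_map_vf (X : List Bool) (n : ℕ) : (X.map vf).getD n V = vf (X.getD n false) := by
  rw [← List.getD_map (f := vf)]
  rfl

theorem XS_eq_iff (X X' : List Bool) : XS X = XS X' ↔ Xeq X X' := by
  rw [XS, XS, place_ext_iff]
  simp only [getD_map_vf, Xeq]
  exact ⟨fun h n => vf_inj (h n), fun h n => by rw [h n]⟩

theorem enc_vf (X : List Bool) : enc (X.map vf) = X.map fun x => (x, true) := by
  induction X with
  | nil => rfl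
  | cons x X ih =>
    rw [List.map_cons, enc_cons, ih]
    cases x <;> rfl

theorem brun_marked (room : ℕ → Bool) (X : List Bool) : ∀ K : ℕ,
    (bst room K true (X.map fun x => (x, true))).2 = true ∧
    brun room K true (X.map fun x => (x, true)) ++
      List.replicate (bst room K true (X.map fun x => (x, true))).1 (true, true) =
      (bev room K X).map fun x => (x, true) := by
  induction X with
  | nil => intro K; simp [brun, bst, bev]
  | cons x X ih =>
    intro K
    cases x with
    | true =>
      cases h : room K
      · simpa [brun, bst, bev, bout, bnext, h] using ih K
      · simpa [brun, bst, bev, bout, bnext, h] using ih (K + 1)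
    | false =>
      by_cases h : K = 0
      · subst h
        simpa [brun, bst, bev, bout, bnext] using ih 0
      · simpa [brun, bst, bev, bout, bnext, h] using ih (K - 1)

theorem bst_marked_V (room : ℕ → Bool) (N : ℕ) : ∀ K : ℕ,
    bst room K true (List.replicate N (false, true)) = (K - N, true) := by
  induction N with
  | zero => intro K; rfl
  | succ N ih =>
    intro K
    rw [List.replicate_succ, bst]
    split
    · rw [ih]; simp_all
    · rw [ih]; congr 1; omega

/-- The capacity is smaller by one for the slots than for the boxes. -/
theorem cap_pred (ℓ : ℕ∞) (hl : 1 ≤ ℓ) (n : ℕ) : cap (ℓ - 1) n = cap ℓ (n + 1) := by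
  induction ℓ using ENat.recTopCoe with
  | top => simp [cap]
  | coe m =>
    have : 1 ≤ m := by exact_mod_cast hl
    have h1 : ((m : ℕ∞) - 1) = ((m - 1 : ℕ) : ℕ∞) := by simp
    simp only [cap, h1, Nat.cast_lt]
    congr 1
    rw [eq_iff_iff]
    omega

theorem T_run (ℓ : ℕ∞) (hl : 1 ≤ ℓ) (l : List Site) (p : ℤ) (hs : ∀ s ∈ l, s.Admissible)
    (hb : bst (cap ℓ) 0 true (enc l) = (0, true)) :
    ∃ l', (∀ s ∈ l', s.Admissible) ∧ enc l' = brun (cap ℓ) 0 true (enc l) ∧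
      T ℓ (place l p) = place l' p := by
  obtain ⟨K, g, h, -, -, h3, h4, h5, h6⟩ := run_enc ℓ hl l 0 0 0 (by simp) (Or.inl rfl) hs
  simp only [Nat.add_zero, decide_true, hb, Prod.mk.injEq] at h6
  obtain ⟨rfl, h7⟩ := h6
  have : g = 0 ∧ h = 0 := by simpa using h7.symm
  obtain ⟨rfl, rfl⟩ := this
  rw [carr_zero] at h3 h4 h5
  refine ⟨_, h4, ?_, T_place ℓ hl l p h3⟩
  simpa [block] using h5.symm

/-- Without baskets, the time evolution is the one of the ordinary box-ball system. -/
theorem T_XS (ℓ : ℕ∞) (hl : 1 ≤ ℓ) (X : List Bool) : T ℓ (XS X) = XS (bev (cap ℓ) 0 X) := by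
  obtain ⟨N, hN⟩ : ∃ N, N = (bst (cap ℓ) 0 true (X.map fun x => (x, true))).1 := ⟨_, rfl⟩
  have hX := Xeq_append_false X N
  have hb : bst (cap ℓ) 0 true ((X ++ List.replicate N false).map fun x => (x, true)) =
      (0, true) := by
    have h1 := (brun_marked (cap ℓ) X 0).1
    rw [List.map_append, bst_append, h1, ← hN, List.map_replicate, bst_marked_V, Nat.sub_self]
  rw [← (XS_eq_iff _ _).2 hX, ← (XS_eq_iff _ _).2 (hX.bev (cap ℓ) 0)]
  obtain ⟨l', h1, h2, h3⟩ := T_run ℓ hl ((X ++ List.replicate N false).map vf) 0 (by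
    intro s hs
    obtain ⟨b, -, rfl⟩ := List.mem_map.1 hs
    exact vf_adm b) (by rw [enc_vf]; exact hb)
  rw [XS, h3, XS]
  congr 1
  apply enc_inj _ _ h1
  · intro s hs
    obtain ⟨b, -, rfl⟩ := List.mem_map.1 hs
    exact vf_adm b
  · rw [h2, enc_vf, enc_vf, ← (brun_marked (cap ℓ) _ 0).2, hb]
    simp

/-- The sites of `S` from `p` on are described by the skeleton `t`, the colours `X` of the slots
and the marks `ys`; `S` is vacuum to the left of `p`. The skeleton is understood to be continued by
slots, sufficiently many of which have to be included to complete the last site. -/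
def WRep (S : State) (p : ℤ) (t X ys : List Bool) : Prop :=
  ∃ N₀, ∀ N ≥ N₀, ∃ l, (∀ s ∈ l, s.Admissible) ∧
    enc l = inf false (t ++ List.replicate N false) X ys ∧ S = place l p

/-- A description whose first mark is trivial, so that it may be preceded by any site. -/
def Rep (S : State) (p : ℤ) (t X ys : List Bool) : Prop :=
  hd true ys = true ∧ WRep S p t X ys

theorem Rep.congr {S : State} {p : ℤ} {t X X' ys : List Bool} (h : Rep S p t X ys)
    (hX : Xeq X X') : Rep S p t X' ys := by
  obtain ⟨h1, N₀, h2⟩ := h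
  refine ⟨h1, N₀, fun N hN => ?_⟩
  rw [← hX.inf]
  exact h2 N hN

theorem inf_head (t X ys : List Bool) (hy : hd true ys = true) :
    ∀ x ∈ (inf false t X ys).head?, x.2 = true := by
  rcases t with _ | ⟨a, t⟩
  · simp [inf]
  · cases a
    · cases h : hd false X <;> simp [inf, h, hy]
    · simp [inf]

theorem encS_V : encS V = [(false, true)] := rfl

theorem enc_V (n : ℕ) : enc (List.replicate n V) = List.replicate n (false, true) := by
  induction n with
  | zero => rfl
  | succ n ih => rw [List.replicate_succ, enc_cons, ih]; rfl

theorem adm_V : V.Admissible := by simp [V, Site.Admissible]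

/-- The time evolution `T_ℓ` moves the description by one site, keeps the skeleton and the marks, and
acts on the colours by `T_{ℓ-1}`. -/
theorem Rep.T {S : State} {p : ℤ} {t X ys : List Bool} (h : Rep S p t X ys) (ℓ : ℕ∞)
    (hl : 1 ≤ ℓ) : Rep (T ℓ S) (p + 1) t (bev (cap (ℓ - 1)) 0 X) ys := by
  obtain ⟨hy, N₀, h⟩ := h
  have h0 : cap ℓ 0 = true := by
    simp only [cap, decide_eq_true_eq]
    exact lt_of_lt_of_le (by simp) hl
  have hr : ∀ n, cap ℓ (n + 1) = true → cap ℓ n = true := by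
    intro n hn
    simp only [cap, decide_eq_true_eq] at hn ⊢
    exact lt_trans (by exact_mod_cast Nat.lt_succ_self n) hn
  have hc : (fun n => cap ℓ (n + 1)) = cap (ℓ - 1) := funext fun n => (cap_pred ℓ hl n).symm
  obtain ⟨N₁, hN₁⟩ := fstate_final (cap (ℓ - 1)) t X ys false false 0 true
  refine ⟨hy, max N₀ N₁, fun N hN => ?_⟩
  obtain ⟨l, h1, h2, rfl⟩ := h N (le_trans (le_max_left _ _) hN)
  -- The boxes left behind, followed by a vacuum site, are a vacuum site followed by the new
  -- description.
  have hk := key (cap ℓ) h0 hr (t ++ List.replicate N false) false false 0 true X ys rfl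
  rw [hc, hN₁ N (le_trans (le_max_right _ _) hN)] at hk
  simp only [Bool.toNat_false, Nat.add_zero, ← h2] at hk
  obtain ⟨l', h3, h4, h5⟩ := T_run ℓ hl l p h1 hk.1
  have h6 : enc (l' ++ [V]) = [(false, true)] ++
      inf false (t ++ List.replicate N false) (bev (cap (ℓ - 1)) 0 X) ys := by
    rw [enc_append, h4]
    simpa [pre, enc, encS_V] using hk.2.symm
  have h7 : ∀ s ∈ l' ++ [V], s.Admissible := by
    intro s hs
    rcases List.mem_append.1 hs with hs | hs
    · exact h3 s hs
    · rw [List.mem_singleton.1 hs]; exact adm_V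
  obtain ⟨l₁, l₂, h8, h9, h10⟩ := enc_split _ _ _ h7 h6 (inf_head _ _ _ hy)
  have h11 : l₁ = [V] := by
    apply enc_inj _ _ (fun s hs => h7 s (by rw [h8]; simp [hs])) (by simp [adm_V])
    rw [h9]; rfl
  refine ⟨l₂, fun s hs => h7 s (by rw [h8]; simp [hs]), h10, ?_⟩
  rw [h5, ← place_append_V l' p 1, List.replicate_one, h8, h11]
  exact place_V_append l₂ p 1

theorem Rep.iterate {S : State} {p : ℤ} {t X ys : List Bool} (h : Rep S p t X ys) (ℓ : ℕ∞)
    (hl : 1 ≤ ℓ) (n : ℕ) :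
    Rep ((BoxBasketBall.T ℓ)^[n] S) (p + n) t ((bev (cap (ℓ - 1)) 0)^[n] X) ys := by
  induction n with
  | zero => simpa using h
  | succ n ih =>
    rw [Function.iterate_succ_apply', Function.iterate_succ_apply']
    have := ih.T ℓ hl
    rwa [add_assoc] at this

theorem XS_iterate (ℓ : ℕ∞) (hl : 1 ≤ ℓ) (X : List Bool) (n : ℕ) :
    (T ℓ)^[n] (XS X) = XS ((bev (cap ℓ) 0)^[n] X) := by
  induction n with
  | zero => rfl
  | succ n ih => rw [Function.iterate_succ_apply', Function.iterate_succ_apply', ih, T_XS ℓ hl]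

theorem bev_zero (X : List Bool) : bev (cap 0) 0 X = X := by
  induction X with
  | nil => rfl
  | cons x X ih => cases x <;> simp [bev, bout, bnext, cap] <;> exact ih

theorem WRep.cons {S : State} {p : ℤ} {t X ys : List Bool} (h : WRep S p t X ys) :
    Rep S (p - 1) (false :: t) (false :: X) (true :: ys) := by
  obtain ⟨N₀, h⟩ := h
  refine ⟨rfl, N₀, fun N hN => ?_⟩
  obtain ⟨l, h1, h2, rfl⟩ := h N hN
  refine ⟨V :: l, ?_, by simp [enc_cons, h2, inf, encS_V], ?_⟩
  · intro s hs
    rcases List.mem_cons.1 hs with rfl | hs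
    · exact adm_V
    · exact h1 s hs
  · have := place_V_append l (p - 1) 1
    simpa using this.symm

/-- The balls in the slots are fewer than the balls of the state, unless there are none. -/
theorem exists_wrep (l : List Site) (hl : ∀ s ∈ l, s.Admissible) : ∃ t X ys,
    (∀ p, WRep (place l p) p t X ys) ∧ X.count true ≤ balls (enc l) ∧
    (true ∈ X → X.count true < balls (enc l)) := by
  obtain ⟨t, X, ys, h1, h2, h3⟩ := parse _ (enc l) false le_rfl (wf_enc l hl false)
  refine ⟨t, X, ys, fun p => ⟨0, fun N _ => ?_⟩, h2, h3 rfl⟩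
  refine ⟨l ++ List.replicate (N + 2) V, ?_, ?_, (place_append_V _ _ _).symm⟩
  · intro s hs
    simp only [List.mem_append, List.mem_replicate] at hs
    rcases hs with hs | ⟨-, rfl⟩
    · exact hl s hs
    · exact adm_V
  · rw [enc_append, enc_V, h1]

/-! ### Inflation of words without baskets -/

/-- The word in which each site that differs from the preceding one is doubled; `c` is the site that
precedes the word. A run of `v` balls becomes a run of `v + 1` balls. -/
def infl : Site → List Site → List Site
  | _, [] => []
  | c, s :: l => if s = c then s :: infl c l else s :: s :: infl s l

/-- The colour of the last slot after the skeleton has been read. -/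
def endc : Bool → List Bool → List Bool → Bool
  | c, [], _ => c
  | c, true :: t, X => endc c t X
  | _, false :: t, X => endc (hd false X) t X.tail

/-- The marks that have not been used when the skeleton has been read. -/
def ydrop : Bool → List Bool → List Bool → List Bool → List Bool
  | _, [], _, ys => ys
  | c, true :: t, X, ys => ydrop c t X ys.tail
  | c, false :: t, X, ys =>
      ydrop (hd false X) t X.tail (if c && !hd false X then ys.tail.tail else ys.tail)

theorem inf_append (t₁ t₂ : List Bool) : ∀ (c : Bool) (X ys : List Bool),
    inf c (t₁ ++ t₂) X ys = inf c t₁ X ys ++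
      inf (endc c t₁ X) t₂ (X.drop (t₁.count false)) (ydrop c t₁ X ys) := by
  induction t₁ with
  | nil => intro c X ys; rfl
  | cons a t ih =>
    intro c X ys
    cases a
    · cases c <;> cases h : hd false X <;> simp [inf, endc, ydrop, h, ih]
    · cases c <;> simp [inf, endc, ydrop, ih]

theorem wf_inf (t : List Bool) : ∀ (c : Bool) (X ys : List Bool), wf c (inf c t X ys) := by
  induction t with
  | nil => intro c X ys; trivial
  | cons a t ih =>
    intro c X ys
    cases a
    · cases c <;> cases h : hd false X <;> simp [inf, h, ih, wf]
    · cases c <;> simp [inf, ih, wf]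

/-- As long as the slots are empty, only the skeleton and the marks matter. -/
theorem inf_zero (t : List Bool) : ∀ (u ys : List Bool) (n : ℕ), t.count false ≤ n →
    inf false t (List.replicate n false ++ u) ys = inf false t [] ys ∧
    endc false t (List.replicate n false ++ u) = false ∧
    ydrop false t (List.replicate n false ++ u) ys = ys.drop t.length := by
  induction t with
  | nil => intro u ys n _; simp [inf, endc, ydrop]
  | cons a t ih =>
    intro u ys n hn
    cases a
    · obtain ⟨n, rfl⟩ : ∃ m, n = m + 1 := by
        simp at hn; exact ⟨n - 1, by omega⟩
      have := ih u ys.tail n (by simpa using hn)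
      simp [inf, endc, ydrop, List.replicate_succ, this]
    · have := ih u ys.tail n (by simpa using hn)
      simp [inf, endc, ydrop, this]

/-- When the skeleton and the marks are trivial, the boxes are those of the inflated word. -/
theorem inf_slots (X : List Bool) : ∀ c,
    inf c (List.replicate X.length false) X [] = enc (infl (vf c) (X.map vf)) := by
  induction X with
  | nil => intro c; rfl
  | cons x X ih =>
    intro c
    cases c <;> cases x <;>
      simp [List.replicate_succ, inf, infl, ih, enc_cons, vf, encS_V,
        show encS F = [(true, true)] from rfl, show V ≠ F by decide, show F ≠ V by decide]

theorem infl_V (n : ℕ) (l : List Site) :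
    infl V (List.replicate n V ++ l) = List.replicate n V ++ infl V l := by
  induction n with
  | zero => rfl
  | succ n ih => simp [List.replicate_succ, infl, ih]

theorem infl_append_V (l : List Site) (n : ℕ) : ∀ c, ∃ m,
    infl c (l ++ List.replicate n V) = infl c l ++ List.replicate m V := by
  induction l with
  | nil =>
    intro c
    rcases n with _ | n
    · exact ⟨0, by simp [infl]⟩
    · have h := infl_V n []
      simp only [List.append_nil, infl] at h
      by_cases hc : V = c
      · subst hc
        exact ⟨n + 1, by simp [List.replicate_succ, infl, h]⟩
      · exact ⟨n + 2, by simp [List.replicate_succ, infl, h, hc]⟩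
  | cons s l ih =>
    intro c
    by_cases h : s = c
    · obtain ⟨m, hm⟩ := ih c
      exact ⟨m, by simp [infl, h, hm]⟩
    · obtain ⟨m, hm⟩ := ih s
      exact ⟨m, by simp [infl, h, hm]⟩

theorem infl_map_mem (l : List Site) : ∀ c, ∀ s ∈ infl c l, s ∈ l := by
  induction l with
  | nil => intro c s h; simp [infl] at h
  | cons x l ih =>
    intro c s h
    rw [infl] at h
    split at h
    · rcases List.mem_cons.1 h with rfl | h
      · simp
      · exact List.mem_cons_of_mem _ (ih _ _ h)
    · simp only [List.mem_cons] at h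
      rcases h with rfl | rfl | h
      · simp
      · simp
      · exact List.mem_cons_of_mem _ (ih _ _ h)

/-- All letters are `V` or `F`. -/
def NoBaskets (l : List Site) : Prop := ∀ s ∈ l, s = V ∨ s = F

theorem NoBaskets.exists_map {l : List Site} (h : NoBaskets l) : ∃ X : List Bool, l = X.map vf := by
  induction l with
  | nil => exact ⟨[], rfl⟩
  | cons s l ih =>
    obtain ⟨X, rfl⟩ := ih fun s hs => h s (by simp [hs])
    rcases h s (by simp) with rfl | rfl
    · exact ⟨false :: X, rfl⟩
    · exact ⟨true :: X, rfl⟩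

theorem noBaskets_map (X : List Bool) : NoBaskets (X.map vf) := by
  intro s hs
  obtain ⟨b, -, rfl⟩ := List.mem_map.1 hs
  cases b
  · exact Or.inl rfl
  · exact Or.inr rfl

theorem NoBaskets.adm {l : List Site} (h : NoBaskets l) : ∀ s ∈ l, s.Admissible := by
  intro s hs
  rcases h s hs with rfl | rfl
  · exact adm_V
  · simp [Site.Admissible, F]

/-- When all balls in the slots have passed the non-trivial part of the skeleton and of the marks,
the slow word `l₀` is followed by the inflation of the word of the remaining slots. -/
theorem eval_place {S : State} {p : ℤ} {t X ys : List Bool} (h : Rep S p t X ys) (A : ℕ)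
    (hA : ys.length ≤ A) (u : List Bool)
    (hX : Xeq X (List.replicate (t.count false + A) false ++ u)) (l₀ : List Site)
    (hl₀ : ∀ s ∈ l₀, s.Admissible)
    (he : enc l₀ = inf false (t ++ List.replicate A false) [] ys) :
    S = place (l₀ ++ infl V (u.map vf)) p := by
  obtain ⟨hy, N₀, h⟩ := h.congr hX
  obtain ⟨l, h1, h2, rfl⟩ := h (A + (u.length + N₀)) (by omega)
  have hz : (t ++ List.replicate A false).count false = t.count false + A := by
    simp
  have h3 := inf_zero (t ++ List.replicate A false) u ys _ hz.le
  have h4 : Xeq u (u ++ List.replicate N₀ false) := fun i => (Xeq_append_false u N₀ i).symm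
  rw [List.replicate_add, ← List.append_assoc, inf_append, h3.1, h3.2.1, h3.2.2, hz,
    List.drop_left' (by simp), List.drop_eq_nil_of_le (by simp; omega), ← he, h4.inf,
    show u.length + N₀ = (u ++ List.replicate N₀ false).length by simp, inf_slots, ← enc_append] at h2
  obtain ⟨m, hm⟩ := infl_append_V (u.map vf) N₀ V
  have h5 := enc_inj _ _ h1 (by
    intro s hs
    rcases List.mem_append.1 hs with hs | hs
    · exact hl₀ s hs
    · exact (noBaskets_map _).adm s (infl_map_mem _ _ s hs)) h2
  rw [h5, List.map_append, List.map_replicate, show vf false = V from rfl, hm,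
    ← List.append_assoc, place_append_V]

/-! ### Inflation of waves -/

/-- The number of runs of balls. -/
def cntF : Site → List Site → ℕ
  | _, [] => 0
  | c, s :: l => (if s = F ∧ c ≠ F then 1 else 0) + cntF s l

/-- The number of runs of balls of a wave (without baskets). -/
def Wave.cnt (P : Wave) : ℕ := cntF V P.word

/-- A wave without baskets that starts and ends with a ball. -/
def Good (P : Wave) : Prop :=
  NoBaskets P.word ∧ P.word.head? = some F ∧ P.word.getLast? = some F

/-- The inflation of a wave, translated by `a`. -/
def infW (a : ℤ) (P : Wave) : Wave := ⟨infl V P.word, P.pos + a, P.speed + 1⟩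

/-- The inflation of a sequence of waves. Each run of balls to the left of a wave and the gap behind
this run become longer by one, which moves the wave by two sites. -/
def infL : ℤ → List Wave → List Wave
  | _, [] => []
  | a, P :: L => infW a P :: infL (a + 2 * P.cnt) L

theorem infl_append (l l' : List Site) : ∀ c,
    infl c (l ++ l') = infl c l ++ infl (l.getLast?.getD c) l' := by
  induction l with
  | nil => intro c; rfl
  | cons s l ih =>
    intro c
    by_cases h : s = c
    · subst h
      simp [infl, ih, List.getLast?_cons]
    · simp [infl, ih, List.getLast?_cons, h]

theorem infl_length (l : List Site) (hl : NoBaskets l) : ∀ c, (c = V ∨ c = F) →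
    (infl c l).length + (if l.getLast?.getD c = F then 1 else 0) =
      l.length + 2 * cntF c l + if c = F then 1 else 0 := by
  induction l with
  | nil => intro c _; by_cases h : c = F <;> simp [infl, cntF, h]
  | cons s l ih =>
    intro c hc
    have ih := ih (fun s hs => hl s (by simp [hs])) s (hl s (by simp))
    have hVF : V ≠ F := by decide
    have hFV : F ≠ V := by decide
    simp only [List.getLast?_cons, Option.getD_some]
    rcases hc with rfl | rfl <;> rcases hl s (by simp) with rfl | rfl <;>
      simp only [infl, cntF, List.length_cons, hVF, hFV, if_true, if_false, ne_eq,
        not_true_eq_false, not_false_eq_true, and_true, and_false] at ih ⊢ <;> omega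

theorem Good.length {P : Wave} (h : Good P) :
    (infl V P.word).length + 1 = P.word.length + 2 * P.cnt := by
  have := infl_length P.word h.1 V (Or.inl rfl)
  rw [h.2.2] at this
  simpa [Wave.cnt, show V ≠ F by decide] using this

theorem infW_rightEnd {P : Wave} (h : Good P) (a : ℤ) :
    (infW a P).rightEnd = P.rightEnd + a + 2 * P.cnt - 1 := by
  have := h.length
  simp only [Wave.rightEnd, infW]
  omega

theorem head?_infL (a : ℤ) (L : List Wave) : (infL a L).head? = L.head?.map (infW a) := by
  cases L <;> rfl

theorem flat_pred (q : ℤ) (L : List Wave) (hL : L ≠ []) (h : ∀ P ∈ L.head?, q ≤ P.pos) :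
    flat (q - 1) L = V :: flat q L := by
  rcases L with _ | ⟨P, L⟩
  · exact absurd rfl hL
  · have := h P (by simp)
    rw [flat, flat, show (P.pos - (q - 1)).toNat = (P.pos - q).toNat + 1 by omega,
      List.replicate_succ]
    rfl

/-- Waves from left to right, separated by at least one vacuum site. -/
def Gapped (L : List Wave) : Prop := L.IsChain fun P Q => P.rightEnd + 1 ≤ Q.pos

theorem isChain_head {α : Type*} {r : α → α → Prop} {P : α} {L : List α} (h : (P :: L).IsChain r) :
    ∀ Q ∈ L.head?, r P Q := by
  intro Q hQ
  rcases L with _ | ⟨Q', L⟩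
  · simp at hQ
  · simp only [List.head?_cons, Option.mem_def, Option.some.injEq] at hQ
    subst hQ
    exact (List.isChain_cons_cons.1 h).1

theorem flat_infL (L : List Wave) : ∀ (q a : ℤ), (∀ P ∈ L, Good P) → Gapped L →
    (∀ P ∈ L.head?, q ≤ P.pos) → infl V (flat q L) = flat (q + a) (infL a L) := by
  induction L with
  | nil => intro q a _ _ _; rfl
  | cons P L ih =>
    intro q a hG hL hq
    have hP := hG P (by simp)
    have hh := isChain_head hL
    have ih' := ih P.rightEnd (a + 2 * P.cnt) (fun Q hQ => hG Q (by simp [hQ])) hL.of_cons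
      (fun Q hQ => by have := hh Q hQ; omega)
    rw [flat, infl_V, infl_append, hP.2.2, Option.getD_some, infL, flat, infW_rightEnd hP]
    congr 1
    · congr 1
      simp only [infW]
      congr 1
      ring
    · simp only [infW]
      congr 1
      rcases L with _ | ⟨Q, L⟩
      · rfl
      · have h1 := hh Q (by simp)
        rw [show P.rightEnd + a + 2 * (P.cnt : ℤ) - 1 = (P.rightEnd + (a + 2 * P.cnt)) - 1 by ring,
          flat_pred _ _ (by simp [infL]) (by simp only [head?_infL, List.head?_cons]; simp [infW]; omega),
          ← ih', flat]
        obtain ⟨m, hm⟩ : ∃ m, (Q.pos - P.rightEnd).toNat = m + 1 :=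
          ⟨(Q.pos - P.rightEnd).toNat - 1, by omega⟩
        rw [hm, List.replicate_succ, List.cons_append, infl, if_neg (by decide), infl, if_pos rfl]

/-! ### Uniqueness of the description -/

/-- The state `S`, translated by `k`. -/
def shift (k : ℤ) (S : State) : State := fun i => S (i - k)

theorem shift_place (l : List Site) (p k : ℤ) : shift k (place l p) = place l (p + k) := by
  funext i
  simp only [shift, place]
  rw [show i - k - p = i - (p + k) by ring]
  congr 1
  rw [eq_iff_iff]
  omega

theorem shift_shift (k m : ℤ) (S : State) : shift k (shift m S) = shift (m + k) S := by
  funext i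
  simp only [shift]
  congr 1
  ring

theorem shift_zero (S : State) : shift 0 S = S := by
  funext i
  simp [shift]

theorem WRep.shift {S : State} {p : ℤ} {t X ys : List Bool} (h : WRep S p t X ys) (k : ℤ) :
    WRep (shift k S) (p + k) t X ys := by
  obtain ⟨N₀, h⟩ := h
  refine ⟨N₀, fun N hN => ?_⟩
  obtain ⟨l, h1, h2, rfl⟩ := h N hN
  exact ⟨l, h1, h2, shift_place l p k⟩

theorem WRep.eq {S S' : State} {p : ℤ} {t X ys : List Bool} (h : WRep S p t X ys)
    (h' : WRep S' p t X ys) : S = S' := by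
  obtain ⟨N₀, h⟩ := h
  obtain ⟨N₁, h'⟩ := h'
  obtain ⟨l, h1, h2, rfl⟩ := h (max N₀ N₁) (le_max_left _ _)
  obtain ⟨l', h1', h2', rfl⟩ := h' (max N₀ N₁) (le_max_right _ _)
  rw [enc_inj l l' h1 h1' (h2.trans h2'.symm)]

/-- The first `n` entries of two sequences agree. -/
def Agree (d : Bool) (n : ℕ) (l l' : List Bool) : Prop := ∀ i < n, l.getD i d = l'.getD i d

theorem Agree.cons {d : Bool} {n : ℕ} {l l' : List Bool} (h : hd d l = hd d l')
    (h' : Agree d n l.tail l'.tail) : Agree d (n + 1) l l' := by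
  intro i hi
  rcases i with _ | i
  · cases l <;> cases l' <;> simpa [hd] using h
  · have := h' i (by omega)
    cases l <;> cases l' <;> simpa using this

theorem Agree.mono {d : Bool} {n m : ℕ} {l l' : List Bool} (h : Agree d n l l') (hm : m ≤ n) :
    Agree d m l l' := fun i hi => h i (by omega)

/-- Reading the boxes from left to right, one recovers the description. -/
theorem inf_inj (t : List Bool) : ∀ (c : Bool) (t' X X' ys ys' : List Bool),
    inf c t X ys = inf c t' X' ys' →
    t = t' ∧ Agree false (t.count false) X X' ∧ Agree true t.length ys ys' := by
  have h0 : ∀ (d : Bool) (l l' : List Bool), Agree d 0 l l' := fun d l l' i hi => by omega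
  have hne : ∀ (c a : Bool) (t X ys : List Bool), inf c (a :: t) X ys ≠ [] := by
    intro c a t X ys
    cases c <;> cases a <;> cases h : hd false X <;> simp [inf, h]
  induction t with
  | nil =>
    intro c t' X X' ys ys' h
    rcases t' with _ | ⟨a, t'⟩
    · exact ⟨rfl, h0 _ _ _, h0 _ _ _⟩
    · exact absurd h.symm (hne _ _ _ _ _)
  | cons a t ih =>
    intro c t' X X' ys ys' h
    rcases t' with _ | ⟨a', t'⟩
    · exact absurd h (hne _ _ _ _ _)
    · cases a <;> cases a'
      · cases c <;> cases hX : hd false X <;> cases hX' : hd false X' <;>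
          simp only [inf, hX, hX', if_true, if_false, Bool.false_eq_true, List.cons.injEq,
            Prod.mk.injEq, true_and, false_and, reduceCtorEq] at h
        · obtain ⟨hy, h⟩ := h
          obtain ⟨rfl, h1, h2⟩ := ih _ _ _ _ _ _ h
          refine ⟨rfl, ?_, h2.cons hy⟩
          simpa using h1.cons (hX.trans hX'.symm)
        · obtain ⟨hy, h⟩ := h
          obtain ⟨rfl, h1, h2⟩ := ih _ _ _ _ _ _ h
          refine ⟨rfl, ?_, h2.cons hy⟩
          simpa using h1.cons (hX.trans hX'.symm)
        · obtain ⟨hy, hy', h⟩ := h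
          obtain ⟨rfl, h1, h2⟩ := ih _ _ _ _ _ _ h
          refine ⟨rfl, ?_, ((h2.cons hy').mono (Nat.le_succ _)).cons hy⟩
          simpa using h1.cons (hX.trans hX'.symm)
        · obtain ⟨hy, h⟩ := h
          obtain ⟨rfl, h1, h2⟩ := ih _ _ _ _ _ _ h
          refine ⟨rfl, ?_, h2.cons hy⟩
          simpa using h1.cons (hX.trans hX'.symm)
      · cases c <;> cases hX : hd false X <;>
          simp [inf, hX] at h
      · cases c <;> cases hX' : hd false X' <;>
          simp [inf, hX'] at h
      · cases c <;>
          simp only [inf, if_true, if_false, Bool.false_eq_true, List.cons.injEq,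
            Prod.mk.injEq, true_and] at h
        all_goals
          obtain ⟨hy, h⟩ := h
          obtain ⟨rfl, h1, h2⟩ := ih _ _ _ _ _ _ h
          exact ⟨rfl, by simpa using h1, h2.cons hy⟩

theorem inf_V (N : ℕ) : inf false (List.replicate N false) [] [] = List.replicate N (false, true) := by
  induction N with
  | zero => rfl
  | succ N ih => simpa [List.replicate_succ, inf] using ih

theorem endc_slots (n : ℕ) : ∀ (c : Bool) (X : List Bool), X.length < n →
    endc c (List.replicate n false) X = false := by
  have h0 : ∀ n, endc false (List.replicate n false) [] = false := by
    intro n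
    induction n with
    | zero => rfl
    | succ n ih => simpa [List.replicate_succ, endc] using ih
  induction n with
  | zero => intro c X h; omega
  | succ n ih =>
    intro c X h
    rw [List.replicate_succ, endc]
    rcases X with _ | ⟨x, X⟩
    · exact h0 n
    · exact ih _ _ (by simpa using h)

theorem endc_append (t t' : List Bool) : ∀ (c : Bool) (X : List Bool),
    endc c (t ++ t') X = endc (endc c t X) t' (X.drop (t.count false)) := by
  induction t with
  | nil => intro c X; rfl
  | cons a t ih => intro c X; cases a <;> simp [endc, ih]

theorem ydrop_length (t : List Bool) : ∀ (c : Bool) (X ys : List Bool),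
    (ydrop c t X ys).length ≤ ys.length - t.length := by
  induction t with
  | nil => intro c X ys; simp [ydrop]
  | cons a t ih =>
    intro c X ys
    cases a
    · rw [ydrop]
      split
      · have := ih (hd false X) X.tail ys.tail.tail
        simp at this ⊢; omega
      · have := ih (hd false X) X.tail ys.tail
        simp at this ⊢; omega
    · have := ih c X ys.tail
      simp [ydrop] at this ⊢; omega

theorem inf_pad (t X ys : List Bool) (N k : ℕ) (hN : X.length + ys.length < N) :
    inf false (t ++ List.replicate (N + k) false) X ys =
      inf false (t ++ List.replicate N false) X ys ++ List.replicate k (false, true) := by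
  rw [List.replicate_add, ← List.append_assoc, inf_append]
  have h1 : endc false (t ++ List.replicate N false) X = false := by
    rw [endc_append]
    exact endc_slots _ _ _ (by simp; omega)
  have h2 : ydrop false (t ++ List.replicate N false) X ys = [] := by
    have := ydrop_length (t ++ List.replicate N false) false X ys
    rw [List.length_append, List.length_replicate] at this
    exact List.length_eq_zero_iff.1 (by omega)
  rw [h1, h2, List.drop_eq_nil_of_le (by simp; omega), inf_V]

theorem eq_pad_of_getD {α : Type*} {d : α} {l l' : List α} (h : ∀ i, l.getD i d = l'.getD i d) :
    l ++ List.replicate l'.length d = l' ++ List.replicate l.length d := by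
  have h0 : ∀ (l : List α) (n i : ℕ), (l ++ List.replicate n d).getD i d = l.getD i d := by
    intro l n i
    rcases lt_or_ge i l.length with hi | hi
    · rw [List.getD_append _ _ _ _ hi]
    · rw [List.getD_append_right _ _ _ _ hi, List.getD_eq_default _ _ hi, getD_replicate_self]
  apply List.ext_getElem?
  intro i
  have h1 := (h0 l l'.length i).trans ((h i).trans (h0 l' l.length i).symm)
  by_cases hi : i < l.length + l'.length
  · rw [List.getD_eq_getElem _ _ (by simpa using hi),
      List.getD_eq_getElem _ _ (by simp; omega)] at h1
    rw [List.getElem?_eq_getElem (by simpa using hi), List.getElem?_eq_getElem (by simp; omega), h1]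
  · rw [List.getElem?_eq_none (by simp; omega), List.getElem?_eq_none (by simp; omega)]

theorem place_eq_pad {l l' : List Site} {p : ℤ} (h : place l p = place l' p) :
    l ++ List.replicate l'.length V = l' ++ List.replicate l.length V :=
  eq_pad_of_getD ((place_ext_iff _ _ p).1 h)

/-- A state determines its description from a given site on, up to trivial entries at the ends. -/
theorem WRep.unique {S : State} {p : ℤ} {t X ys t' X' ys' : List Bool} (h : WRep S p t X ys)
    (h' : WRep S p t' X' ys') : Xeq t t' ∧ Xeq X X' ∧ ∀ i, ys.getD i true = ys'.getD i true := by
  obtain ⟨N₀, h⟩ := h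
  obtain ⟨N₁, h'⟩ := h'
  have key : ∀ n, ∃ N ≥ n, ∃ N' ≥ n,
      inf false (t ++ List.replicate N false) X ys =
        inf false (t' ++ List.replicate N' false) X' ys' := by
    intro n
    obtain ⟨M, hM⟩ : ∃ M, M = N₀ + N₁ + n + X.length + ys.length + X'.length + ys'.length + 1 :=
      ⟨_, rfl⟩
    obtain ⟨l, h1, h2, h3⟩ := h M (by omega)
    obtain ⟨l', h1', h2', h3'⟩ := h' M (by omega)
    have h4 := congrArg enc (place_eq_pad (h3.symm.trans h3'))
    rw [enc_append, enc_append, enc_V, enc_V, h2, h2', ← inf_pad _ _ _ _ _ (by omega),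
      ← inf_pad _ _ _ _ _ (by omega)] at h4
    exact ⟨_, by omega, _, by omega, h4⟩
  refine ⟨fun i => ?_, fun i => ?_, fun i => ?_⟩
  · obtain ⟨N, h1, N', h2, h3⟩ := key (i + 1)
    have h4 := (inf_inj _ _ _ _ _ _ _ h3).1
    rw [← Xeq_append_false t N i, ← Xeq_append_false t' N' i, h4]
  · obtain ⟨N, h1, N', h2, h3⟩ := key (i + 1)
    exact (inf_inj _ _ _ _ _ _ _ h3).2.1 i (by simp; omega)
  · obtain ⟨N, h1, N', h2, h3⟩ := key (i + 1)
    exact (inf_inj _ _ _ _ _ _ _ h3).2.2 i (by simp; omega)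

/-- A different choice of the skeleton and of the marks. -/
theorem WRep.congr' {S : State} {p : ℤ} {t X ys t' X' ys' : List Bool} (h : WRep S p t X ys)
    (n n' : ℕ) (ht : t ++ List.replicate n false = t' ++ List.replicate n' false)
    (hX : Xeq X X') (hy : ∀ t X, inf false t X ys = inf false t X ys') : WRep S p t' X' ys' := by
  obtain ⟨N₀, h⟩ := h
  refine ⟨N₀ + n', fun N hN => ?_⟩
  obtain ⟨k, rfl⟩ := Nat.exists_eq_add_of_le hN
  obtain ⟨l, h1, h2, h3⟩ := h (n + (N₀ + k)) (by omega)
  refine ⟨l, h1, ?_, h3⟩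
  rw [h2, show N₀ + n' + k = n' + (N₀ + k) by omega, List.replicate_add n', ← List.append_assoc,
    ← ht, List.append_assoc, ← List.replicate_add, hX.inf, hy]

/-! ### Segments of a description -/

/-- The boxes `W` are described by `t`, `X`, `ys`, whatever comes next; the colour of the last slot
is `c` before and `c'` after them. -/
def Seg (c c' : Bool) (W : List Box) (t X ys : List Bool) : Prop :=
  X.length = t.count false ∧
    ∀ t' X' ys', inf c (t ++ t') (X ++ X') (ys ++ ys') = W ++ inf c' t' X' ys'

theorem Seg.nil (c : Bool) : Seg c c [] [] [] [] := ⟨rfl, fun _ _ _ => rfl⟩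

theorem Seg.append {c c' c'' : Bool} {W W' : List Box} {t t' X X' ys ys' : List Bool}
    (h : Seg c c' W t X ys) (h' : Seg c' c'' W' t' X' ys') :
    Seg c c'' (W ++ W') (t ++ t') (X ++ X') (ys ++ ys') := by
  refine ⟨by simp [h.1, h'.1], fun t'' X'' ys'' => ?_⟩
  rw [List.append_assoc, List.append_assoc, List.append_assoc, h.2, h'.2, List.append_assoc]

theorem Seg.vacuum (n : ℕ) : Seg false false (enc (List.replicate n V)) (List.replicate n false)
    (List.replicate n false) (List.replicate n true) := by
  induction n with
  | zero => exact Seg.nil false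
  | succ n ih =>
    have h : Seg false false [(false, true)] [false] [false] [true] :=
      ⟨rfl, fun _ _ _ => by simp [inf]⟩
    exact h.append ih

theorem Seg.colors (X : List Bool) : ∀ c, ∃ k,
    Seg c (X.getLast?.getD c) (enc (infl (vf c) (X.map vf))) (List.replicate X.length false) X
      (List.replicate k true) ∧
    k + (X.getLast?.getD c).toNat = X.length + cntF (vf c) (X.map vf) + c.toNat := by
  have hVF : V ≠ F := by decide
  have hFV : F ≠ V := by decide
  have hF : encS F = [(true, true)] := rfl
  induction X with
  | nil => intro c; exact ⟨0, Seg.nil c, by simp [cntF]⟩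
  | cons x X ih =>
    intro c
    obtain ⟨k, h1, h2⟩ := ih x
    simp only [List.getLast?_cons, Option.getD_some]
    have h3 : ∃ j, Seg c x (enc (infl (vf c) [vf x])) [false] [x] (List.replicate j true) ∧
        j + x.toNat = 1 + (if vf x = F ∧ vf c ≠ F then 1 else 0) + c.toNat := by
      cases c <;> cases x
      · exact ⟨1, ⟨rfl, fun _ _ _ => by simp [inf, infl, vf, encS_V, enc]⟩, by
          simp [vf, hVF]⟩
      · exact ⟨1, ⟨rfl, fun _ _ _ => by simp [inf, infl, vf, hF, enc, hFV]⟩, by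
          simp [vf, hVF]⟩
      · exact ⟨2, ⟨rfl, fun _ _ _ => by
          simp [inf, infl, vf, encS_V, enc, hVF, List.replicate_succ]⟩, by simp [vf, hVF]⟩
      · exact ⟨1, ⟨rfl, fun _ _ _ => by simp [inf, infl, vf, hF, enc]⟩, by simp [vf]⟩
    obtain ⟨j, h3, h4⟩ := h3
    refine ⟨j + k, ?_, ?_⟩
    · have := h3.append h1
      rw [← List.replicate_add, ← enc_append] at this
      have he := infl_append [vf x] (X.map vf) (vf c)
      simp only [List.getLast?_singleton, Option.getD_some] at he
      rw [← he] at this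
      exact this
    · simp only [List.map_cons, cntF, List.length_cons]
      omega

theorem union_V (S : State) : union S (fun _ => V) = S := by
  funext i
  simp only [union]
  split <;> simp_all

theorem wrep_vacuum (p : ℤ) : WRep (fun _ => V) p [] [] [] :=
  ⟨0, fun N _ => ⟨List.replicate N V, by simp [adm_V], by simp [enc_V, inf_V], (place_V N p).symm⟩⟩

/-- The description of a segment is put in front of the description of the remaining state. -/
theorem Seg.wrep_union {l : List Site} {t X ys t' X' ys' : List Bool} {S : State} {p : ℤ}
    (h : Seg false false (enc l) t X ys) (hl : ∀ s ∈ l, s.Admissible)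
    (h' : WRep S (p + l.length) t' X' ys') :
    WRep (union (place l p) S) p (t ++ t') (X ++ X') (ys ++ ys') := by
  obtain ⟨N₀, h'⟩ := h'
  refine ⟨N₀, fun N hN => ?_⟩
  obtain ⟨l', h1, h2, rfl⟩ := h' N hN
  refine ⟨l ++ l', ?_, ?_, union_place l l' p⟩
  · intro s hs
    rcases List.mem_append.1 hs with hs | hs
    · exact hl s hs
    · exact h1 s hs
  · rw [enc_append, h2, List.append_assoc, h.2]

theorem Seg.wrep {l : List Site} {t X ys : List Bool} (h : Seg false false (enc l) t X ys)
    (hl : ∀ s ∈ l, s.Admissible) (p : ℤ) : WRep (place l p) p t X ys := by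
  have := h.wrep_union (p := p) hl (wrep_vacuum _)
  simpa [union_V] using this

/-! ### Words without baskets -/

/-- Runs of `v` balls, separated by `v + g` vacuum sites for the entries `g` of a list. -/
def fastWord (v : ℕ) : List ℕ → List Site
  | [] => List.replicate v F
  | g :: gs => List.replicate v F ++ (List.replicate (v + g) V ++ fastWord v gs)

theorem infl_same (c : Site) (n : ℕ) (l : List Site) :
    infl c (List.replicate n c ++ l) = List.replicate n c ++ infl c l := by
  induction n with
  | zero => rfl
  | succ n ih => simp [List.replicate_succ, infl, ih]

theorem infl_other (c d : Site) (h : d ≠ c) (n : ℕ) (l : List Site) :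
    infl c (List.replicate (n + 1) d ++ l) = List.replicate (n + 2) d ++ infl d l := by
  simp [List.replicate_succ, infl, h, infl_same]

theorem infl_fastWord (v : ℕ) (hv : 1 ≤ v) (gs : List ℕ) :
    infl V (fastWord v gs) = fastWord (v + 1) gs := by
  obtain ⟨v, rfl⟩ : ∃ u, v = u + 1 := ⟨v - 1, by omega⟩
  have h0 : ∀ l, infl V (List.replicate (v + 1) F ++ l) = List.replicate (v + 2) F ++ infl F l :=
    infl_other V F (by decide) v
  induction gs with
  | nil => simpa [infl, fastWord] using h0 []
  | cons g gs ih =>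
    rw [fastWord, h0, show v + 1 + g = v + g + 1 by omega, infl_other F V (by decide), ih, fastWord,
      show v + 1 + 1 + g = v + g + 2 by omega]

theorem noBaskets_fastWord (v : ℕ) (gs : List ℕ) : NoBaskets (fastWord v gs) := by
  induction gs with
  | nil =>
    intro s hs
    exact Or.inr (List.eq_of_mem_replicate hs)
  | cons g gs ih =>
    intro s hs
    simp only [fastWord, List.mem_append, List.mem_replicate] at hs
    rcases hs with ⟨-, rfl⟩ | ⟨-, rfl⟩ | hs
    · exact Or.inr rfl
    · exact Or.inl rfl
    · exact ih s hs

theorem fastWord_head (v : ℕ) (hv : 1 ≤ v) (gs : List ℕ) : ∃ l, fastWord v gs = F :: l := by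
  obtain ⟨v, rfl⟩ : ∃ u, v = u + 1 := ⟨v - 1, by omega⟩
  cases gs <;> simp [fastWord, List.replicate_succ]

theorem fastWord_last (v : ℕ) (hv : 1 ≤ v) (gs : List ℕ) : (fastWord v gs).getLast? = some F := by
  induction gs with
  | nil => simp [fastWord, List.getLast?_replicate]; omega
  | cons g gs ih => simp [fastWord, List.getLast?_append, ih]

theorem cntF_append (l l' : List Site) : ∀ c,
    cntF c (l ++ l') = cntF c l + cntF (l.getLast?.getD c) l' := by
  induction l with
  | nil => intro c; simp [cntF]
  | cons s l ih => intro c; simp [cntF, ih, List.getLast?_cons, add_assoc]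

theorem cntF_F (n : ℕ) : cntF F (List.replicate n F) = 0 := by
  induction n with
  | zero => rfl
  | succ n ih => simp [List.replicate_succ, cntF, ih]

theorem cntF_V (n : ℕ) : ∀ c, cntF c (List.replicate n V) = 0 := by
  induction n with
  | zero => intro c; rfl
  | succ n ih => intro c; simp [List.replicate_succ, cntF, ih, show V ≠ F by decide]

theorem cntF_fastWord (v : ℕ) (hv : 1 ≤ v) (gs : List ℕ) :
    cntF V (fastWord v gs) = gs.length + 1 := by
  obtain ⟨v, rfl⟩ : ∃ u, v = u + 1 := ⟨v - 1, by omega⟩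
  have h0 : cntF V (List.replicate (v + 1) F) = 1 := by
    simp [List.replicate_succ, cntF, cntF_F, show V ≠ F by decide]
  induction gs with
  | nil => simpa [fastWord] using h0
  | cons g gs ih =>
    rw [fastWord, cntF_append, cntF_append, h0, cntF_V]
    simp [List.getLast?_replicate, ih]
    omega

/-- Twice the number of balls minus the number of baskets. -/
def weight (w : List Site) : ℤ := 2 * (w.map Site.c).sum - (w.map Site.b).sum

theorem weight_append (w w' : List Site) : weight (w ++ w') = weight w + weight w' := by
  simp [weight]; ring

theorem weight_V (n : ℕ) : weight (List.replicate n V) = 0 := by simp [weight, V]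

theorem weight_fastWord (v : ℕ) (gs : List ℕ) :
    weight (fastWord v gs) = 2 * v * (gs.length + 1) := by
  have h : weight (List.replicate v F) = 2 * v := by simp [weight, F]
  induction gs with
  | nil => simpa [fastWord] using h
  | cons g gs ih => rw [fastWord, weight_append, weight_append, h, weight_V, ih]; push_cast [List.length_cons]; ring

/-- A soliton without baskets. -/
def IsFast (P : Wave) : Prop := 1 ≤ P.speed ∧ ∃ gs, P.word = fastWord P.speed gs

theorem IsFast.good {P : Wave} (h : IsFast P) : Good P := by
  obtain ⟨h1, gs, h2⟩ := h
  refine ⟨h2 ▸ noBaskets_fastWord _ _, ?_, h2 ▸ fastWord_last _ h1 _⟩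
  obtain ⟨l, hl⟩ := fastWord_head _ h1 gs
  rw [h2, hl]
  rfl

theorem IsFast.infW {P : Wave} (h : IsFast P) (a : ℤ) : IsFast (infW a P) := by
  obtain ⟨h1, gs, h2⟩ := h
  exact ⟨by simp [BoxBasketBall.infW], gs, by
    simp only [BoxBasketBall.infW, h2, infl_fastWord _ h1]⟩

theorem IsFast.cnt_infW {P : Wave} (h : IsFast P) (a : ℤ) : (BoxBasketBall.infW a P).cnt = P.cnt := by
  obtain ⟨h1, gs, h2⟩ := h
  simp only [Wave.cnt, BoxBasketBall.infW, h2]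
  rw [infl_fastWord _ h1, cntF_fastWord _ h1, cntF_fastWord _ (by omega)]

theorem IsFast.weight_eq {P : Wave} (h : IsFast P) : weight P.word = 2 * P.speed * P.cnt := by
  obtain ⟨h1, gs, h2⟩ := h
  simp only [Wave.cnt, h2]
  rw [cntF_fastWord _ h1, weight_fastWord]
  push_cast
  ring

/-- Fast waves of speed at least `2` are inflated ones. -/
theorem IsFast.exists_deflate {P : Wave} (h : IsFast P) (hP : 2 ≤ P.speed) (a : ℤ) :
    ∃ Q, IsFast Q ∧ BoxBasketBall.infW a Q = P := by
  obtain ⟨h1, gs, h2⟩ := h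
  refine ⟨⟨fastWord (P.speed - 1) gs, P.pos - a, P.speed - 1⟩, ⟨by simp only; omega, gs, rfl⟩, ?_⟩
  obtain ⟨w, p, v⟩ := P
  simp only at h1 h2 hP
  subst h2
  simp only [BoxBasketBall.infW, Wave.mk.injEq]
  rw [infl_fastWord _ (by omega)]
  refine ⟨?_, by ring, by omega⟩
  congr 1
  omega

/-! ### Slow words -/

/-- No two adjacent boxes contain balls. -/
def NoTwo (W : List Box) : Prop := W.IsChain fun x y => x.1 = true → y.1 = false

theorem noTwo_inf (t : List Bool) : ∀ ys, NoTwo (inf false t [] ys) := by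
  have h0 : ∀ x (W : List Box), x.1 = false → NoTwo W → NoTwo (x :: W) := by
    intro x W hx h
    cases W with
    | nil => exact List.isChain_singleton _
    | cons y W => exact List.isChain_cons_cons.2 ⟨by simp [hx], h⟩
  induction t with
  | nil => intro ys; exact List.IsChain.nil
  | cons a t ih =>
    intro ys
    cases a
    · simpa [inf] using h0 _ _ rfl (ih _)
    · simp only [inf, Bool.false_eq_true, if_false]
      exact List.isChain_cons_cons.2 ⟨by simp, h0 _ _ rfl (ih _)⟩

theorem NoTwo.infix {W A : List Box} (h : NoTwo W) (hA : A <:+: W) : NoTwo A :=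
  List.IsChain.infix h hA

/-- The marks of the empty boxes. -/
def emptyMarks (W : List Box) : List Bool := (W.filter fun x => !x.1).map Prod.snd

/-- If no two adjacent boxes contain balls, all slots are empty. -/
theorem exists_inf_of_noTwo (n : ℕ) : ∀ W : List Box, W.length ≤ n → wf false W → NoTwo W →
    ∃ t ys, ys.length = t.length ∧ W ++ [(false, true)] = inf false t [] ys := by
  induction n with
  | zero =>
    intro W hW _ _
    obtain rfl := List.length_eq_zero_iff.1 (Nat.le_zero.1 hW)
    exact ⟨[false], [true], rfl, by simp [inf]⟩
  | succ n ih =>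
    intro W hW h1 h2
    rcases W with _ | ⟨⟨x, m⟩, W⟩
    · exact ⟨[false], [true], rfl, by simp [inf]⟩
    · simp only [List.length_cons, Nat.add_le_add_iff_right] at hW
      cases x
      · obtain ⟨t, ys, h3, h4⟩ := ih W hW h1.2 h2.of_cons
        exact ⟨false :: t, m :: ys, by simp [h3], by simp [inf, h4]⟩
      · obtain rfl := h1.1 rfl rfl
        rcases W with _ | ⟨⟨x', m'⟩, W⟩
        · exact ⟨[true], [true], rfl, by simp [inf]⟩
        · have h5 := (List.isChain_cons_cons.1 h2).1 rfl
          simp only at h5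
          subst h5
          simp only [List.length_cons] at hW
          obtain ⟨t, ys, h3, h4⟩ := ih W (by omega) h1.2.2 h2.of_cons.of_cons
          exact ⟨true :: t, m' :: ys, by simp [h3], by simp [inf, h4]⟩

/-- Boxes described with exactly one mark per skeleton entry form a segment with empty slots. -/
theorem seg_inf (t : List Bool) : ∀ ys : List Bool, ys.length = t.length →
    Seg false false (inf false t [] ys) t (List.replicate (t.count false) false) ys := by
  induction t with
  | nil =>
    intro ys h
    obtain rfl := List.length_eq_zero_iff.1 h
    exact Seg.nil false
  | cons a t ih =>
    intro ys h
    rcases ys with _ | ⟨y, ys⟩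
    · simp at h
    · obtain ⟨h1, h2⟩ := ih ys (by simpa using h)
      cases a <;> refine ⟨by simp, fun t' X' ys' => ?_⟩ <;>
        simp [inf, List.replicate_succ, h2]

theorem emptyMarks_inf (t : List Bool) : ∀ ys : List Bool, ys.length = t.length →
    emptyMarks (inf false t [] ys) = ys := by
  induction t with
  | nil =>
    intro ys h
    obtain rfl := List.length_eq_zero_iff.1 h
    rfl
  | cons a t ih =>
    intro ys h
    rcases ys with _ | ⟨y, ys⟩
    · simp at h
    · have := ih ys (by simpa using h)
      cases a <;> simpa [inf, emptyMarks] using this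

theorem balls_inf (t : List Bool) : ∀ ys : List Bool,
    balls (inf false t [] ys) = t.count true ∧
    (inf false t [] ys).length = t.count false + 2 * t.count true := by
  induction t with
  | nil => intro ys; exact ⟨rfl, rfl⟩
  | cons a t ih =>
    intro ys
    have := ih ys.tail
    cases a <;> simp [inf, balls] at this ⊢ <;> omega

theorem balls_append (W W' : List Box) : balls (W ++ W') = balls W + balls W' := by
  simp [balls]

theorem balls_enc (l : List Site) : balls (enc l) = (l.map Site.c).sum := by
  induction l with
  | nil => rfl
  | cons s l ih =>
    rw [enc_cons, balls_append, ih]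
    have : balls (encS s) = s.c := by
      have h : ∀ (o : Bool) (u : List Bool), (mk o u).map Prod.fst = u := by
        intro o u
        cases u <;> simp [mk_false, Function.comp_def]
      simp [balls, encS, h, block, List.count_append, List.count_replicate]
    simp [this]

theorem length_enc (l : List Site) (hl : ∀ s ∈ l, s.Admissible) :
    (enc l).length = l.length + (l.map Site.b).sum := by
  induction l with
  | nil => rfl
  | cons s l ih =>
    have hs := hl s (by simp)
    rw [enc_cons, List.length_append, ih fun s hs => hl s (by simp [hs])]
    have : (encS s).length = s.c + s.a := by
      have h : ∀ (o : Bool) (u : List Bool), (mk o u).length = u.length := by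
        intro o u
        cases u <;> simp [mk_false]
      simp [encS, h, block]
    simp only [Site.Admissible] at hs
    simp [this]
    omega

/-- A slow word has as many sites as slots, apart from its weight. -/
theorem length_eq_weight {l : List Site} (hl : ∀ s ∈ l, s.Admissible) {t ys : List Bool}
    (h : enc l = inf false t [] ys) : (l.length : ℤ) = t.count false + weight l := by
  have h1 := length_enc l hl
  have h2 := balls_enc l
  rw [h, (balls_inf t ys).1] at h2
  rw [h, (balls_inf t ys).2] at h1
  simp only [weight]
  omega

/-! ### Classification of solitons -/

theorem Xeq.symm {X X' : List Bool} (h : Xeq X X') : Xeq X' X := fun i => (h i).symm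

theorem Xeq.trans {X X' X'' : List Bool} (h : Xeq X X') (h' : Xeq X' X'') : Xeq X X'' :=
  fun i => (h i).trans (h' i)

theorem xeq_false (n : ℕ) : Xeq (List.replicate n false) [] := Xeq_append_false [] n

theorem Xeq.cons {X X' : List Bool} (h : Xeq X X') (x : Bool) : Xeq (x :: X) (x :: X') := by
  intro i
  rcases i with _ | i
  · rfl
  · simpa using h i

theorem Xeq.of_cons {x : Bool} {X X' : List Bool} (h : Xeq (x :: X) (x :: X')) : Xeq X X' := by
  intro i
  simpa using h (i + 1)

theorem XS_nil : XS [] = fun _ => V := place_V 0 0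

theorem XS_false_append (n : ℕ) (X : List Bool) :
    XS (List.replicate n false ++ X) = shift n (XS X) := by
  rw [XS, XS, shift_place, List.map_append, List.map_replicate, show vf false = V from rfl,
    place_V_append]

theorem WRep.prepend {S : State} {p : ℤ} {t X ys : List Bool} (n : ℕ) (h : WRep S (p + n) t X ys) :
    WRep S p (List.replicate n false ++ t) (List.replicate n false ++ X)
      (List.replicate n true ++ ys) := by
  have h2 := (Seg.vacuum n).wrep_union (S := S) (p := p) (by simp [adm_V])
    (by simpa using h)
  rw [place_V] at h2
  have h3 : union (fun _ => BoxBasketBall.V) S = S := by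
    funext i
    simp [union]
  rwa [h3] at h2

/-- The time evolution commutes with translations. -/
theorem WRep.T_shift {S : State} {p : ℤ} {t X ys : List Bool} (h : WRep S p t X ys) (ℓ : ℕ∞)
    (hl : 1 ≤ ℓ) (k : ℤ) : T ℓ (BoxBasketBall.shift k S) = BoxBasketBall.shift k (T ℓ S) := by
  have h1 := (h.cons.T ℓ hl).2.shift k
  have h2 := ((h.shift k).cons.T ℓ hl).2
  rw [show p + k - 1 + 1 = p - 1 + 1 + k by ring] at h2
  exact h2.eq h1

theorem T_shift_place (l : List Site) (hl : ∀ s ∈ l, s.Admissible) (p : ℤ) (ℓ : ℕ∞) (h1 : 1 ≤ ℓ)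
    (k : ℤ) : T ℓ (place l (p + k)) = shift k (T ℓ (place l p)) := by
  obtain ⟨t, X, ys, h, -, -⟩ := exists_wrep l hl
  rw [← (h p).T_shift ℓ h1, shift_place]

theorem slow_inf {l : List Site} (hl : ∀ s ∈ l, s.Admissible) (h : NoTwo (enc l)) :
    ∃ t ys, ys.length = t.length ∧ enc (l ++ [V]) = inf false t [] ys := by
  obtain ⟨t, ys, h1, h2⟩ := exists_inf_of_noTwo _ _ le_rfl (wf_enc l hl false) h
  refine ⟨t, ys, h1, ?_⟩
  rw [enc_append, ← h2]
  rfl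

/-- A slow word has a description with empty slots. -/
theorem slow_wrep {l : List Site} (hl : ∀ s ∈ l, s.Admissible) {t ys : List Bool}
    (h1 : ys.length = t.length) (h2 : enc (l ++ [V]) = inf false t [] ys) (p : ℤ) :
    WRep (place l p) p t [] ys := by
  have h3 := seg_inf t ys h1
  rw [← h2] at h3
  have h4 := h3.wrep (by
    intro s hs
    rcases List.mem_append.1 hs with hs | hs
    · exact hl s hs
    · rw [List.mem_singleton.1 hs]; exact adm_V) p
  have h5 := place_append_V l p 1
  rw [List.replicate_one] at h5
  rw [h5] at h4
  exact h4.congr' 0 0 rfl (xeq_false _) fun _ _ => rfl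

/-- Slow words move by one site, whatever the capacity. -/
theorem T_slow {l : List Site} (hl : ∀ s ∈ l, s.Admissible) (h : NoTwo (enc l)) (ℓ : ℕ∞)
    (h1 : 1 ≤ ℓ) (p : ℤ) : T ℓ (place l p) = place l (p + 1) := by
  obtain ⟨t, ys, h2, h3⟩ := slow_inf hl h
  have h4 := ((slow_wrep hl h2 h3 p).cons.T ℓ h1).2
  have h5 := (slow_wrep hl h2 h3 (p + 1)).cons.2
  have h6 : Xeq (bev (cap (ℓ - 1)) 0 [false]) [false] := by
    have := (xeq_false 1).bev (cap (ℓ - 1)) 0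
    exact this.trans (xeq_false 1).symm
  rw [show p + 1 - 1 = p - 1 + 1 by ring] at h5
  exact (h4.congr' 0 0 rfl h6 fun _ _ => rfl).eq h5

/-- A word that starts and ends with a site that is not vacuum. -/
def Trimmed (w : List Site) : Prop := w ≠ [] ∧ w.head? ≠ some V ∧ w.getLast? ≠ some V

theorem Trimmed.getD_zero {w : List Site} (h : Trimmed w) : w.getD 0 V ≠ V := by
  obtain ⟨h1, h2, -⟩ := h
  rcases w with _ | ⟨s, w⟩
  · exact absurd rfl h1
  · simpa using h2

theorem Trimmed.getD_last {w : List Site} (h : Trimmed w) : w.getD (w.length - 1) V ≠ V := by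
  obtain ⟨h1, -, h3⟩ := h
  have : 0 < w.length := List.length_pos_iff.2 h1
  rw [List.getLast?_eq_getElem?, List.getElem?_eq_getElem (by omega)] at h3
  rw [List.getD_eq_getElem _ _ (by omega)]
  simpa using h3

theorem Trimmed.length_pos {w : List Site} (h : Trimmed w) : 0 < w.length :=
  List.length_pos_iff.2 h.1

/-- A state determines its leftmost and its rightmost site that is not vacuum. -/
theorem trimmed_place {w w' : List Site} (h : Trimmed w) (h' : Trimmed w') {p p' : ℤ}
    (e : place w p = place w' p') : w = w' ∧ p = p' := by
  have h1 : ∀ {w w' : List Site} {p p' : ℤ}, Trimmed w → place w p = place w' p' →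
      p' ≤ p ∧ p + w.length ≤ p' + w'.length := by
    intro w w' p p' h e
    constructor
    · by_contra hp
      have := place_add w p 0
      rw [e, place_of_lt _ _ _ (by simpa using hp)] at this
      exact h.getD_zero this.symm
    · by_contra hp
      have h0 := h.length_pos
      have := place_add w p (w.length - 1)
      rw [e] at this
      rw [place] at this
      apply h.getD_last
      rw [← this]
      split
      · rw [List.getD_eq_default _ _ (by omega)]
      · rfl
  have h2 := h1 h e
  have h3 := h1 h' e.symm
  obtain rfl : p = p' := by omega
  refine ⟨?_, rfl⟩
  have h4 := place_eq_pad e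
  exact (List.append_inj h4 (by omega)).1

/-- A non-empty word, without vacuum at its ends, in which no two adjacent boxes contain balls. -/
def SlowWord (w : List Site) : Prop :=
  Trimmed w ∧ (∀ s ∈ w, s.Admissible) ∧ NoTwo (enc w)

theorem SlowWord.isSoliton {w : List Site} (h : SlowWord w) : IsSoliton w 1 :=
  ⟨h.1.1, h.1.2.1, h.1.2.2, h.2.1, fun p => T_slow h.2.1 h.2.2 ⊤ le_top p⟩

theorem inf_true (t : List Bool) : ∀ (c : Bool) (X : List Bool) (k : ℕ),
    inf c t X (List.replicate k true) = inf c t X [] := by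
  induction t with
  | nil => intro c X k; rfl
  | cons a t ih =>
    intro c X k
    have h1 : hd true (List.replicate k true) = true := by cases k <;> rfl
    have h2 : (List.replicate k true).tail = List.replicate (k - 1) true := by simp
    cases a <;> cases c <;> cases h : hd false X <;> simp [inf, h, h1, h2, ih, -List.tail_replicate,
      show hd true (List.replicate (k - 1) true) = true by cases k - 1 <;> rfl,
      show (List.replicate (k - 1) true).tail = List.replicate (k - 1 - 1) true by simp]

/-- A state without baskets describes another one, with larger solitons. -/
theorem fast_wrep (X : List Bool) (p : ℤ) : WRep (place (infl V (X.map vf)) p) p [] X [] := by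
  obtain ⟨k, h1, -⟩ := Seg.colors (X ++ [false]) false
  simp only [List.getLast?_append, List.getLast?_singleton, Option.some_or, Option.getD_some] at h1
  have h2 := h1.wrep (by
    intro s hs
    exact (noBaskets_map _).adm s (infl_map_mem _ _ s hs)) p
  obtain ⟨m, hm⟩ := infl_append_V (X.map vf) 1 V
  rw [List.map_append, List.map_singleton, show vf false = V from rfl, ← List.replicate_one, hm,
    place_append_V] at h2
  exact h2.congr' 0 _ (by simp; rfl) (Xeq_append_false X 1) fun t X => inf_true t false X k

/-- The inflation of a word that moves by `v` moves by `v + 1`. -/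
theorem T_infl {w : List Site} (hw : NoBaskets w) (v : ℕ) (h : ∀ p, T ⊤ (place w p) = place w (p + v))
    (p : ℤ) : T ⊤ (place (infl V w) p) = place (infl V w) (p + (v + 1 : ℕ)) := by
  obtain ⟨X, rfl⟩ := hw.exists_map
  have h1 := ((fast_wrep X p).cons.T ⊤ le_top).2
  have h2 := (fast_wrep X (p + (v + 1 : ℕ))).prepend
  rw [sub_add_cancel] at h1
  refine (h1.congr' v 0 ?_ ?_ ?_).eq h2
  · simp [List.replicate_succ]
  · rw [← XS_eq_iff, show (⊤ : ℕ∞) - 1 = ⊤ from rfl, ← T_XS ⊤ le_top,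
      show false :: X = List.replicate 1 false ++ X from rfl, XS_false_append, XS_false_append, XS,
      shift_place, shift_place, h]
    congr 1
    push_cast
    ring
  · intro t X
    rw [List.append_nil, inf_true, show [true] = List.replicate 1 true from rfl, inf_true]

/-- A slow word without baskets consists of single balls. -/
theorem NoBaskets.slow_fastWord (n : ℕ) : ∀ w : List Site, w.length ≤ n → NoBaskets w → SlowWord w →
    ∃ gs, w = fastWord 1 gs := by
  induction n with
  | zero =>
    intro w hw _ h
    exact absurd (List.length_eq_zero_iff.1 (by omega)) h.1.1
  | succ n ih =>
    intro w hw hB h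
    obtain ⟨⟨h1, h2, h3⟩, h4, h5⟩ := h
    rcases w with _ | ⟨s, w⟩
    · exact absurd rfl h1
    obtain rfl : s = F := by
      rcases hB s (by simp) with rfl | rfl
      · simp at h2
      · rfl
    rcases w with _ | ⟨s, w⟩
    · exact ⟨[], rfl⟩
    obtain rfl : s = V := by
      rcases hB s (by simp) with rfl | rfl
      · rfl
      · have := (List.isChain_cons_cons.1 (show NoTwo ((true, true) :: (true, true) :: enc w) from
          h5)).1 rfl
        simp at this
    obtain ⟨g, w', rfl, h6⟩ : ∃ g w', w = List.replicate g V ++ w' ∧ w'.head? ≠ some V := by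
      clear * -
      induction w with
      | nil => exact ⟨0, [], rfl, by simp⟩
      | cons s w ih =>
        by_cases hs : s = V
        · subst hs
          obtain ⟨g, w', rfl, h⟩ := ih
          exact ⟨g + 1, w', rfl, h⟩
        · exact ⟨0, s :: w, rfl, by simpa using hs⟩
    have h7 : w' ≠ [] := by
      rintro rfl
      apply h3
      rw [List.append_nil, ← List.replicate_succ, List.getLast?_cons, List.getLast?_replicate]
      simp
    have h8 : w' <:+ F :: V :: (List.replicate g V ++ w') :=
      ⟨F :: V :: List.replicate g V, by simp⟩
    obtain ⟨gs, rfl⟩ := ih w' (by simp at hw ⊢; omega) (fun s hs => hB s (h8.subset hs))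
      ⟨⟨h7, h6, by
        obtain ⟨A, hA⟩ := h8
        rw [← hA, List.getLast?_append] at h3
        obtain ⟨x, hx⟩ : ∃ x, w'.getLast? = some x := ⟨_, List.getLast?_eq_getLast_of_ne_nil h7⟩
        rwa [hx, Option.some_or, ← hx] at h3⟩, fun s hs => h4 s (h8.subset hs), by
          obtain ⟨A, hA⟩ := h8
          rw [← hA, enc_append] at h5
          exact h5.infix ⟨enc A, [], by simp⟩⟩
    exact ⟨g :: gs, by simp [fastWord, List.replicate_add, List.replicate_succ]⟩

theorem slowWord_fastWord (gs : List ℕ) : SlowWord (fastWord 1 gs) := by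
  obtain ⟨l, hl⟩ := fastWord_head 1 le_rfl gs
  refine ⟨⟨by simp [hl], by rw [hl, List.head?_cons]; decide, by rw [fastWord_last 1 le_rfl]; decide⟩,
    (noBaskets_fastWord _ _).adm, ?_⟩
  clear hl
  have h0 : ∀ (n : ℕ) (W : List Box), NoTwo W → NoTwo (List.replicate n (false, true) ++ W) := by
    intro n W hW
    induction n with
    | zero => exact hW
    | succ n ih =>
      rw [List.replicate_succ, List.cons_append]
      cases h : List.replicate n ((false, true) : Box) ++ W with
      | nil => exact List.isChain_singleton _
      | cons y U => exact List.isChain_cons_cons.2 ⟨by simp, h ▸ ih⟩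
  induction gs with
  | nil => exact List.isChain_singleton _
  | cons g gs ih =>
    rw [fastWord, List.replicate_one, enc_append, enc_append, enc_V,
      show enc [F] = [(true, true)] from rfl, add_comm, List.replicate_succ]
    exact List.isChain_cons_cons.2 ⟨by simp, h0 (g + 1) _ ih⟩

theorem isSoliton_fastWord (v : ℕ) (hv : 1 ≤ v) (gs : List ℕ) : IsSoliton (fastWord v gs) v := by
  induction v, hv using Nat.le_induction with
  | base => exact (slowWord_fastWord gs).isSoliton
  | succ v hv ih =>
    obtain ⟨l, hl⟩ := fastWord_head (v + 1) (by omega) gs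
    refine ⟨by simp [hl], by rw [hl, List.head?_cons]; decide, by rw [fastWord_last _ (by omega)]; decide,
      (noBaskets_fastWord _ _).adm, ?_⟩
    rw [← infl_fastWord v hv]
    exact T_infl (noBaskets_fastWord _ _) v ih.2.2.2.2

theorem IsSoliton.trimmed {w : List Site} {v : ℕ} (h : IsSoliton w v) : Trimmed w :=
  ⟨h.1, h.2.1, h.2.2.1⟩

theorem bev_false (room : ℕ → Bool) (X : List Bool) : bev room 0 (false :: X) = false :: bev room 0 X := by
  simp [bev, bout, bnext]

/-- Only the vacuum stays where it is, if the carrier may take up balls. -/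
theorem bev_fixed (room : ℕ → Bool) (h0 : room 0 = true) (X : List Bool)
    (h : Xeq (bev room 0 X) X) : Xeq X [] := by
  induction X with
  | nil => exact h
  | cons x X ih =>
    have h1 : x = false := by
      have := h.hd
      rw [bev_headD] at this
      cases x <;> simp [bout, h0] at this ⊢
    subst h1
    rw [bev_false] at h
    exact ((ih h.of_cons).cons false).trans (xeq_false 1)

/-- Only the vacuum may be moved to the left. -/
theorem bev_backward (room : ℕ → Bool) (X : List Bool) (h : Xeq (false :: bev room 0 X) X) :
    Xeq X [] := by
  induction X with
  | nil => exact fun i => rfl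
  | cons x X ih =>
    obtain rfl : x = false := by
      have := h 0
      simpa using this.symm
    have := h.of_cons
    rw [bev_false] at this
    exact ((ih this).cons false).trans (xeq_false 1)

theorem eq_const_of_periodic {d : Bool} {l : List Bool} {n : ℕ} (hn : 1 ≤ n)
    (h : ∀ i, l.getD i d = (List.replicate n d ++ l).getD i d) (i : ℕ) : l.getD i d = d := by
  induction i using Nat.strong_induction_on with
  | _ i ih =>
    rw [h]
    rcases lt_or_ge i n with hi | hi
    · rw [List.getD_append _ _ _ _ (by simpa using hi), getD_replicate_self]
    · rw [List.getD_append_right _ _ _ _ (by simpa using hi), List.length_replicate]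
      exact ih _ (by omega)

theorem eq_replicate_of_getD {d : Bool} {l : List Bool} (h : ∀ i, l.getD i d = d) :
    l = List.replicate l.length d := by
  rw [List.eq_replicate_iff]
  refine ⟨rfl, fun b hb => ?_⟩
  obtain ⟨i, hi, rfl⟩ := List.getElem_of_mem hb
  rw [← List.getD_eq_getElem _ d hi, h]

theorem WRep.noTwo {w : List Site} {p : ℤ} {t ys : List Bool} (h : WRep (place w p) p t [] ys) :
    NoTwo (enc w) := by
  obtain ⟨N₀, h⟩ := h
  obtain ⟨l, -, h2, h3⟩ := h (N₀ + ys.length + 1) (by omega)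
  have h4 := congrArg enc (place_eq_pad h3)
  rw [enc_append, enc_append, h2, enc_V, enc_V, ← inf_pad _ _ _ _ _ (by simp)] at h4
  exact (noTwo_inf _ ys).infix ⟨[], _, by rw [← h4, List.nil_append]⟩

/-- Every word but the vacuum is a trimmed word with vacuum on either side. -/
theorem exists_trim (l : List Site) (h : ∃ s ∈ l, s ≠ V) :
    ∃ i w j, l = List.replicate i V ++ (w ++ List.replicate j V) ∧ Trimmed w := by
  have h1 : ∀ l : List Site, (∃ s ∈ l, s ≠ V) → ∃ i w, l = List.replicate i V ++ w ∧ w ≠ [] ∧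
      w.head? ≠ some V := by
    intro l
    induction l with
    | nil => simp
    | cons s l ih =>
      intro h
      by_cases hs : s = V
      · subst hs
        obtain ⟨i, w, rfl, h2⟩ := ih (by simpa using h)
        exact ⟨i + 1, w, rfl, h2⟩
      · exact ⟨0, s :: l, rfl, by simp, by simpa using hs⟩
  obtain ⟨i, w, rfl, h2, h3⟩ := h1 l h
  obtain ⟨s, hs, hsV⟩ := h
  have hs' : s ∈ w := by
    rcases List.mem_append.1 hs with hs | hs
    · exact absurd (List.eq_of_mem_replicate hs) hsV
    · exact hs
  obtain ⟨j, u, h4, h5, h6⟩ := h1 w.reverse ⟨s, by simpa using hs', hsV⟩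
  have h7 : w = u.reverse ++ List.replicate j V := by
    rw [← List.reverse_reverse w, h4]
    simp
  refine ⟨i, u.reverse, j, by rw [h7], by simpa using h5, ?_, by simpa using h6⟩
  rw [h7] at h3
  have : u.reverse ≠ [] := by simpa using h5
  cases hu : u.reverse with
  | nil => exact absurd hu this
  | cons a u' => rw [hu] at h3; simpa using h3

theorem trimmed_infl {w : List Site} (h : Trimmed w) (hB : NoBaskets w) : Trimmed (infl V w) := by
  obtain ⟨h1, h2, h3⟩ := h
  have h4 : ∀ (l : List Site) (c : Site), l ≠ [] → (infl c l).getLast? = l.getLast? := by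
    intro l
    induction l with
    | nil => intro c h; exact absurd rfl h
    | cons s l ih =>
      intro c _
      rcases l with _ | ⟨s', l⟩
      · simp only [infl]
        split <;> rfl
      · have := ih s (by simp)
        have := ih c (by simp)
        simp only [infl] at *
        split <;> simp_all [List.getLast?_cons]
  refine ⟨?_, ?_, by rwa [h4 _ _ h1]⟩
  · rcases w with _ | ⟨s, w⟩
    · exact absurd rfl h1
    · simp only [infl]; split <;> simp
  · rcases w with _ | ⟨s, w⟩
    · exact absurd rfl h1
    · have : s ≠ V := by simpa using h2
      simp [infl, this]

/-- A state with a trivial description is vacuum. -/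
theorem WRep.false_of_trimmed {w : List Site} (hw : Trimmed w) {p : ℤ} {t X ys : List Bool}
    (h : WRep (place w p) p t X ys) (ht : ∀ i, t.getD i false = false) (hX : Xeq X [])
    (hy : ∀ i, ys.getD i true = true) : False := by
  have h1 := h.congr' (t' := []) (ys' := []) 0 t.length (by
    rw [List.replicate_zero, List.append_nil, List.nil_append]
    exact eq_replicate_of_getD ht) hX (fun t' X' => by
    rw [eq_replicate_of_getD hy, inf_true])
  have h2 := congrFun (h1.eq (wrep_vacuum p)) (p + (0 : ℕ))
  rw [place_add] at h2
  exact hw.getD_zero h2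

/-- The description of a soliton of speed `v` after one step is the original one, moved by `v` sites;
but it also keeps its skeleton and its marks, moved by one site only. For `v ≠ 1` both are periodic,
hence trivial. -/
theorem IsSoliton.exists_wrep {w : List Site} {v : ℕ} (h : IsSoliton w v) : ∃ t X ys,
    WRep (place w 0) 0 t X ys ∧ Xeq (false :: t) (List.replicate v false ++ t) ∧
    Xeq (false :: bev (cap ⊤) 0 X) (List.replicate v false ++ X) ∧
    ∀ i, (true :: ys).getD i true = (List.replicate v true ++ ys).getD i true := by
  obtain ⟨t, X, ys, h1, -, -⟩ := BoxBasketBall.exists_wrep w h.2.2.2.1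
  refine ⟨t, X, ys, h1 0, ?_⟩
  have h2 := ((h1 0).cons.T ⊤ le_top).2
  rw [h.2.2.2.2, bev_false] at h2
  have h3 := (h1 (0 + v)).prepend v
  exact h2.unique h3

/-- Solitons of speed `1` are the slow words, those of speed `v ≥ 2` consist of runs of `v` balls. -/
theorem IsSoliton.classify (v : ℕ) : ∀ w : List Site, IsSoliton w v →
    (v = 1 ∧ SlowWord w) ∨ (2 ≤ v ∧ ∃ gs, w = fastWord v gs) := by
  induction v with
  | zero =>
    intro w h
    obtain ⟨t, X, ys, h1, h2, h3, h4⟩ := h.exists_wrep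
    exact (h1.false_of_trimmed h.trimmed (eq_const_of_periodic (n := 1) le_rfl fun i => (h2 i).symm)
      (bev_backward _ X h3) (eq_const_of_periodic (n := 1) le_rfl fun i => (h4 i).symm)).elim
  | succ v ih =>
    intro w h
    obtain ⟨t, X, ys, h1, h2, h3, h4⟩ := h.exists_wrep
    rcases v with _ | v
    · refine Or.inl ⟨rfl, h.trimmed, h.2.2.2.1, ?_⟩
      -- The colours do not move, so that all slots are empty.
      have h5 := bev_fixed (cap ⊤) (by simp [cap]) X h3.of_cons
      exact (h1.congr' 0 0 rfl h5 fun _ _ => rfl).noTwo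
    · right
      rw [List.replicate_succ, List.cons_append] at h2 h3
      -- The skeleton and the marks are trivial, so that `w` is the inflation of a soliton in the slots.
      have h2' := eq_const_of_periodic (by omega) h2.of_cons
      have h3' := h3.of_cons
      have h4' := eq_const_of_periodic (d := true) (l := ys) (n := v + 1) (by omega) (by
        intro i
        have := h4 (i + 1)
        rwa [List.replicate_succ, List.cons_append, List.getD_cons_succ, List.getD_cons_succ] at this)
      have h5 := h1.congr' (t' := []) (ys' := []) 0 t.length (by
        rw [List.replicate_zero, List.append_nil, List.nil_append]
        exact eq_replicate_of_getD h2') (fun i => rfl) (fun t' X' => by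
        rw [eq_replicate_of_getD h4', inf_true])
      have h6 := h5.eq (fast_wrep X 0)
      by_cases hX : ∃ s ∈ X.map vf, s ≠ V
      · obtain ⟨i, u, j, h7, h8⟩ := exists_trim _ hX
        have hu : NoBaskets u := fun s hs => noBaskets_map X s (by rw [h7]; simp [hs])
        have hXS : XS X = place u i := by
          rw [XS, h7, place_V_append, place_append_V, zero_add]
        obtain ⟨m, hm⟩ := infl_append_V u j V
        rw [h7, infl_V, hm, place_V_append, place_append_V] at h6
        obtain ⟨rfl, h9⟩ := trimmed_place h.trimmed (trimmed_infl h8 hu) h6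
        obtain rfl : i = 0 := by omega
        have h10 : IsSoliton u (v + 1) := by
          refine ⟨h8.1, h8.2.1, h8.2.2, hu.adm, fun p => ?_⟩
          have h11 := T_XS ⊤ le_top X
          rw [(XS_eq_iff _ _).2 h3', XS_false_append, hXS, shift_place] at h11
          have h12 := T_shift_place u hu.adm (0 : ℕ) ⊤ le_top p
          rw [h11, shift_place] at h12
          rw [show p = ((0 : ℕ) : ℤ) + p by simp, h12]
          congr 1
          push_cast
          ring
        obtain ⟨gs, rfl⟩ : ∃ gs, u = fastWord (v + 1) gs := by
          rcases ih u h10 with ⟨h11, h12⟩ | ⟨h11, h12⟩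
          · obtain rfl : v = 0 := by omega
            exact hu.slow_fastWord _ _ le_rfl h12
          · exact h12
        exact ⟨by omega, gs, infl_fastWord _ (by omega) gs⟩
      · refine (h1.false_of_trimmed h.trimmed h2' ?_ h4').elim
        intro i
        rcases lt_or_ge i X.length with hi | hi
        · have : vf X[i] = V := by
            by_contra h'
            exact hX ⟨_, List.mem_map.2 ⟨_, List.getElem_mem hi, rfl⟩, h'⟩
          rw [List.getD_eq_getElem _ _ hi]
          exact vf_inj (b' := false) this
        · rw [List.getD_eq_default _ _ hi, List.getD_nil]

theorem replicate_isSoliton (v : ℕ) (hv : 1 ≤ v) : IsSoliton (List.replicate v F) v :=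
  isSoliton_fastWord v hv []

theorem SlowWord.isBasic {w : List Site} (h : SlowWord w) (hV : V ∉ w) : IsBasicSoliton w 1 := by
  refine ⟨h.isSoliton, ?_⟩
  rintro ⟨w₁, w₂, v₁, v₂, g, -, -, hg, rfl⟩
  apply hV
  obtain ⟨g, rfl⟩ : ∃ n, g = n + 1 := ⟨g - 1, by omega⟩
  simp [List.replicate_succ]

theorem replicate_isBasic (v : ℕ) (hv : 1 ≤ v) : IsBasicSoliton (List.replicate v F) v := by
  refine ⟨replicate_isSoliton v hv, ?_⟩
  rintro ⟨w₁, w₂, v₁, v₂, g, -, -, hg, h⟩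
  obtain ⟨g, rfl⟩ : ∃ n, g = n + 1 := ⟨g - 1, by omega⟩
  have : V ∈ List.replicate v F := by rw [h]; simp [List.replicate_succ]
  have := List.eq_of_mem_replicate this
  revert this
  decide

theorem NoTwo.of_append {l l' : List Site} (h : NoTwo (enc (l ++ l'))) :
    NoTwo (enc l) ∧ NoTwo (enc l') := by
  rw [enc_append] at h
  exact ⟨h.infix ⟨[], enc l', by simp⟩, h.infix ⟨enc l, [], by simp⟩⟩

/-- The basic solitons are the slow words without vacuum, and the runs of `v` balls of speed `v`. -/
theorem IsBasicSoliton.classify {w : List Site} {v : ℕ} (h : IsBasicSoliton w v) :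
    (v = 1 ∧ SlowWord w ∧ V ∉ w) ∨ (2 ≤ v ∧ w = List.replicate v F) := by
  obtain ⟨h1, h2⟩ := h
  rcases h1.classify v w with ⟨rfl, h3⟩ | ⟨hv, gs, rfl⟩
  · refine Or.inl ⟨rfl, h3, fun hV => h2 ?_⟩
    obtain ⟨⟨h3, h4, h5⟩, h6, h7⟩ := h3
    obtain ⟨A, B, rfl, hA⟩ := List.eq_append_cons_of_mem hV
    have hA' : A ≠ [] := by
      rintro rfl
      simp at h4
    have hB' : ∃ s ∈ B, s ≠ V := by
      by_contra hB
      push Not at hB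
      apply h5
      rw [List.getLast?_append, List.getLast?_cons]
      cases hB' : B.getLast? with
      | none => simp
      | some s => simp [hB s (List.mem_of_getLast? hB')]
    obtain ⟨i, u, j, rfl, hu⟩ := exists_trim B hB'
    obtain rfl : j = 0 := by
      by_contra hj
      apply h5
      rw [List.getLast?_append, List.getLast?_cons, List.getLast?_append, List.getLast?_append,
        List.getLast?_replicate, if_neg hj]
      simp
    simp only [List.replicate_zero, List.append_nil] at *
    refine ⟨A, u, 1, 1, i + 1, SlowWord.isSoliton ⟨⟨hA', ?_, ?_⟩, ?_, ?_⟩,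
      SlowWord.isSoliton ⟨hu, ?_, ?_⟩, by omega, by simp [List.replicate_succ]⟩
    · cases A with
      | nil => exact absurd rfl hA'
      | cons a A => simpa using h4
    · intro h
      exact hA (List.mem_of_getLast? h)
    · exact fun s hs => h6 s (by simp [hs])
    · exact h7.of_append.1
    · exact fun s hs => h6 s (by simp [hs])
    · rw [← List.singleton_append] at h7
      exact h7.of_append.2.of_append.2.of_append.2
  · refine Or.inr ⟨hv, ?_⟩
    rcases gs with _ | ⟨g, gs⟩
    · rfl
    · exact absurd ⟨_, _, v, v, v + g, replicate_isSoliton v (by omega),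
        isSoliton_fastWord v (by omega) gs, by omega, by simp [fastWord]⟩ h2

/-! ### Free propagation -/

/-- The wave `P`, translated by `k`. -/
def Wave.translate (k : ℤ) (P : Wave) : Wave := ⟨P.word, P.pos + k, P.speed⟩

theorem union_assoc (S S' S'' : State) : union (union S S') S'' = union S (union S' S'') := by
  funext i
  simp only [union]
  by_cases h : S i = V <;> simp [h]

theorem superpose_append (L L' : List Wave) :
    superpose (L ++ L') = union (superpose L) (superpose L') := by
  induction L with
  | nil =>
    funext i
    simp [superpose, union]
  | cons P L ih => rw [List.cons_append, superpose, ih, superpose, union_assoc]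

theorem superpose_translate (k : ℤ) (L : List Wave) :
    superpose (L.map (Wave.translate k)) = shift k (superpose L) := by
  induction L with
  | nil => rfl
  | cons P L ih =>
    rw [List.map_cons, superpose, ih, superpose]
    simp only [Wave.translate]
    rw [← shift_place]
    rfl

theorem speedAt_top (P : Wave) : P.speedAt ⊤ = P.speed := by simp [Wave.speedAt]

theorem speedAt_eq_one {ℓ : ℕ∞} (hl : 1 ≤ ℓ) {P : Wave} (h : P.speed = 1) : P.speedAt ℓ = 1 := by
  simp [Wave.speedAt, h, hl]

theorem speedAt_pos {ℓ : ℕ∞} (hl : 1 ≤ ℓ) {P : Wave} (h : 1 ≤ P.speed) : 1 ≤ P.speedAt ℓ := by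
  induction ℓ using ENat.recTopCoe with
  | top => simpa [Wave.speedAt] using h
  | coe n =>
    have : 1 ≤ n := by exact_mod_cast hl
    simp only [Wave.speedAt, cast_min', ENat.toNat_natCast]
    omega

theorem speedAt_infW {ℓ : ℕ∞} (hl : 1 ≤ ℓ) (a : ℤ) (P : Wave) :
    (infW a P).speedAt ℓ = P.speedAt (ℓ - 1) + 1 := by
  induction ℓ using ENat.recTopCoe with
  | top => simp [Wave.speedAt, infW]
  | coe n =>
    have : 1 ≤ n := by exact_mod_cast hl
    have h1 : ((n : ℕ∞) - 1) = ((n - 1 : ℕ) : ℕ∞) := by simp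
    simp only [Wave.speedAt, infW, h1, cast_min', ENat.toNat_natCast]
    omega

theorem move_eq_translate (ℓ : ℕ∞) (n : ℤ) (P : Wave) :
    P.move ℓ n = P.translate (n * P.speedAt ℓ) := rfl

theorem cnt_move (ℓ : ℕ∞) (n : ℤ) (P : Wave) : (P.move ℓ n).cnt = P.cnt := rfl

/-- Inflation turns free propagation under `T_{ℓ-1}` into free propagation under `T_ℓ`. -/
theorem infL_map_move {ℓ : ℕ∞} (hl : 1 ≤ ℓ) (n : ℤ) (R : List Wave) : ∀ a,
    (infL a R).map (Wave.move ℓ n) = infL (a + n) (R.map (Wave.move (ℓ - 1) n)) := by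
  induction R with
  | nil => intro a; rfl
  | cons P R ih =>
    intro a
    simp only [infL, List.map_cons, ih, cnt_move]
    congr 1
    · simp only [Wave.move, speedAt_infW hl]
      simp only [infW, Wave.mk.injEq, true_and, and_true]
      push_cast
      ring
    · congr 1
      ring

theorem mem_infL {R : List Wave} {Q : Wave} : ∀ {a : ℤ}, Q ∈ infL a R → ∃ b, ∃ P ∈ R, Q = infW b P := by
  induction R with
  | nil => intro a h; simp [infL] at h
  | cons P R ih =>
    intro a h
    rcases List.mem_cons.1 h with rfl | h
    · exact ⟨a, P, by simp, rfl⟩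
    · obtain ⟨b, P', h1, h2⟩ := ih h
      exact ⟨b, P', by simp [h1], h2⟩

theorem WellSeparated.infL {R : List Wave} (h : WellSeparated R) (hR : ∀ P ∈ R, Good P) : ∀ a : ℤ,
    WellSeparated (BoxBasketBall.infL a R) := by
  induction R with
  | nil => intro a; exact List.IsChain.nil
  | cons P R ih =>
    intro a
    rcases R with _ | ⟨Q, R⟩
    · exact List.isChain_singleton _
    · have h1 := (List.isChain_cons_cons.1 h).1
      refine List.isChain_cons_cons.2 ⟨?_, ih h.of_cons (fun P hP => hR P (by simp [hP])) _⟩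
      rw [infW_rightEnd (hR P (by simp))]
      simp only [infW] at h1 ⊢
      omega

theorem WellSeparated.gapped {R : List Wave} (h : WellSeparated R) (hR : ∀ P ∈ R, 1 ≤ P.speed) :
    Gapped R := by
  induction R with
  | nil => exact List.IsChain.nil
  | cons P R ih =>
    rcases R with _ | ⟨Q, R⟩
    · exact List.isChain_singleton _
    · have h1 := (List.isChain_cons_cons.1 h).1
      have h2 := hR P (by simp)
      exact List.isChain_cons_cons.2 ⟨by omega, ih h.of_cons fun P hP => hR P (by simp [hP])⟩

theorem Gapped.disjoint {R : List Wave} (h : Gapped R) : Disjoint' R :=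
  List.IsChain.imp (fun P Q h => by omega) h

theorem eventuallyFree_iff {ℓ : ℕ∞} {S : State} {R : List Wave} :
    EventuallyFree ℓ S R ↔ ∀ᶠ n : ℕ in Filter.atTop,
      (T ℓ)^[n] S = superpose (R.map (Wave.move ℓ n)) ∧ WellSeparated (R.map (Wave.move ℓ n)) :=
  Filter.eventually_atTop.symm

theorem eventually_forall_mem {α : Type*} {L : List α} {p : α → ℕ → Prop}
    (h : ∀ x ∈ L, ∀ᶠ n in Filter.atTop, p x n) : ∀ᶠ n in Filter.atTop, ∀ x ∈ L, p x n :=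
  (Filter.eventually_all_finite (List.finite_toSet L)).2 h

theorem eventually_le_add_mul (a b : ℤ) (k j : ℕ) (h : j < k) :
    ∀ᶠ n : ℕ in Filter.atTop, a + (n : ℤ) * j ≤ b + n * k := by
  refine Filter.eventually_atTop.2 ⟨(a - b).toNat, fun n hn => ?_⟩
  have h1 : (j : ℤ) + 1 ≤ k := by exact_mod_cast h
  nlinarith [show a - b ≤ n by omega, mul_le_mul_of_nonneg_left h1 (Int.natCast_nonneg n)]

theorem noBaskets_flat (L : List Wave) (hL : ∀ P ∈ L, Good P) : ∀ q, NoBaskets (flat q L) := by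
  induction L with
  | nil => intro q s hs; simp [flat] at hs
  | cons P L ih =>
    intro q s hs
    simp only [flat, List.mem_append, List.mem_replicate] at hs
    rcases hs with ⟨-, rfl⟩ | hs | hs
    · exact Or.inl rfl
    · exact (hL P (by simp)).1 s hs
    · exact ih (fun P hP => hL P (by simp [hP])) _ s hs

theorem map_move_slow {ℓ : ℕ∞} (hl : 1 ≤ ℓ) {L : List Wave} (hL : ∀ P ∈ L, P.speed = 1) (n : ℤ) :
    L.map (Wave.move ℓ n) = L.map (Wave.translate n) := by
  apply List.map_congr_left
  intro P hP
  rw [move_eq_translate, speedAt_eq_one hl (hL P hP)]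
  simp

theorem Gapped.wellSeparated_translate {L : List Wave} (h : Gapped L) (hL : ∀ P ∈ L, P.speed = 1)
    (n : ℤ) : WellSeparated (L.map (Wave.translate n)) := by
  induction L with
  | nil => exact List.IsChain.nil
  | cons P R ih =>
    rcases R with _ | ⟨Q, R⟩
    · exact List.isChain_singleton _
    · have h1 := (List.isChain_cons_cons.1 h).1
      have h2 := hL P (by simp)
      have h3 := hL Q (by simp)
      refine List.isChain_cons_cons.2 ⟨?_, ih h.of_cons fun P hP => hL P (by simp [hP])⟩
      simp only [Wave.translate, Wave.rightEnd, h2, h3] at h1 ⊢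
      omega

/-- If the system described by the slots eventually consists of the solitons `R`, the system itself
eventually consists of the slow solitons, followed by the larger copies of `R`. -/
theorem EventuallyFree.inflate {S : State} {p : ℤ} {t X ys : List Bool} (h : Rep S p t X ys)
    {ℓ : ℕ∞} (hl : 2 ≤ ℓ) {R : List Wave} (hR : EventuallyFree (ℓ - 1) (XS X) R)
    (hfast : ∀ P ∈ R, IsFast P) {A : ℕ} (hA : ys.length ≤ A) {l : List Site}
    (hl₀ : ∀ s ∈ l, s.Admissible) (he : enc l = inf false (t ++ List.replicate A false) [] ys)
    {L : List Wave} (hL : ∀ P ∈ L, P.speed = 1) (hg : Gapped L) (hLS : superpose L = place l p) :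
    EventuallyFree ℓ S (L ++ infL (p + l.length - (t.count false + A : ℕ)) R) := by
  have hl1 : 1 ≤ ℓ := le_trans (by norm_num) hl
  have hl2 : 1 ≤ ℓ - 1 := by
    induction ℓ using ENat.recTopCoe with
    | top => simp
    | coe n =>
      have : 2 ≤ n := by exact_mod_cast hl
      have h1 : ((n : ℕ∞) - 1) = ((n - 1 : ℕ) : ℕ∞) := by simp
      rw [h1]
      exact_mod_cast (show 1 ≤ n - 1 by omega)
  obtain ⟨Z, hZ⟩ : ∃ Z, Z = t.count false + A := ⟨_, rfl⟩
  obtain ⟨a, ha⟩ : ∃ a : ℤ, a = p + l.length - Z := ⟨_, rfl⟩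
  rw [← hZ, ← ha]
  rw [eventuallyFree_iff] at hR ⊢
  -- Finally all balls in the slots have passed the `Z` slots of the non-trivial part.
  have h1 : ∀ᶠ n : ℕ in Filter.atTop, ∀ P ∈ R, (Z : ℤ) ≤ (P.move (ℓ - 1) n).pos := by
    refine eventually_forall_mem fun P hP => ?_
    filter_upwards [eventually_le_add_mul Z P.pos (P.speedAt (ℓ - 1)) 0
      (speedAt_pos hl2 (hfast P hP).1)] with n hn
    simpa [Wave.move] using hn
  -- The inflated solitons have speed at least `2` and leave the slow ones behind.
  have h2 : ∀ᶠ n : ℕ in Filter.atTop, ∀ P ∈ L, ∀ Q ∈ infL a R,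
      (P.move ℓ n).rightEnd + (max (P.move ℓ n).speed (Q.move ℓ n).speed : ℕ) ≤
        (Q.move ℓ n).pos := by
    refine eventually_forall_mem fun P hP => eventually_forall_mem fun Q hQ => ?_
    obtain ⟨b, Q', hQ', rfl⟩ := mem_infL hQ
    have h3 : P.speedAt ℓ < (infW b Q').speedAt ℓ := by
      rw [speedAt_eq_one hl1 (hL P hP), speedAt_infW hl1]
      have := speedAt_pos hl2 (hfast Q' hQ').1
      omega
    filter_upwards [eventually_le_add_mul (P.rightEnd + (max P.speed (infW b Q').speed : ℕ))
      (infW b Q').pos _ _ h3] with n hn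
    simp only [Wave.move, Wave.rightEnd] at hn ⊢
    linarith
  filter_upwards [hR, h1, h2] with n hn h1 h2
  obtain ⟨h3, h4⟩ := hn
  have hG : ∀ P ∈ R.map (Wave.move (ℓ - 1) n), Good P := by
    intro P hP
    obtain ⟨Q, hQ, rfl⟩ := List.mem_map.1 hP
    exact (hfast Q hQ).good
  have hG1 : Gapped (R.map (Wave.move (ℓ - 1) n)) := h4.gapped fun P hP => by
    obtain ⟨Q, hQ, rfl⟩ := List.mem_map.1 hP
    exact (hfast Q hQ).1
  have hh : ∀ P ∈ (R.map (Wave.move (ℓ - 1) n)).head?, (Z : ℤ) ≤ P.pos := by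
    intro P hP
    obtain ⟨Q, hQ, rfl⟩ := List.mem_map.1 (List.mem_of_head? hP)
    exact h1 Q hQ
  obtain ⟨u, hu⟩ := (noBaskets_flat _ hG Z).exists_map
  have h5 := h.iterate ℓ hl1 n
  rw [XS_iterate _ hl2, superpose_eq _ Z hG1.disjoint hh, hu] at h3
  have h6 : Xeq ((bev (cap (ℓ - 1)) 0)^[n] X) (List.replicate Z false ++ u) := by
    rw [← XS_eq_iff, h3, XS_false_append, XS, shift_place, zero_add]
  rw [hZ] at h6
  have h7 := eval_place h5 A hA u h6 l hl₀ he
  have hmap : (L ++ infL a R).map (Wave.move ℓ n) = L.map (Wave.translate n) ++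
      infL (a + n) (R.map (Wave.move (ℓ - 1) n)) := by
    rw [List.map_append, infL_map_move hl1, map_move_slow hl1 hL]
  have hW := h4.infL hG (a + n)
  have hW1 : Gapped (infL (a + n) (R.map (Wave.move (ℓ - 1) n))) := hW.gapped fun P hP => by
    obtain ⟨b, Q, hQ, rfl⟩ := mem_infL hP
    simp [infW]
  constructor
  · rw [h7, hmap, superpose_append, superpose_translate, hLS, shift_place, ← hu,
      flat_infL _ Z (a + n) hG hG1 hh, ← union_place,
      superpose_eq _ (p + n + l.length) hW1.disjoint]
    · congr 3
      rw [ha]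
      ring
    · intro P hP
      rw [head?_infL, Option.mem_def, Option.map_eq_some_iff] at hP
      obtain ⟨Q, hQ, rfl⟩ := hP
      have := hh Q hQ
      simp only [infW]
      omega
  · rw [List.map_append]
    refine List.isChain_append.2 ⟨?_, ?_, ?_⟩
    · rw [map_move_slow hl1 hL]
      exact hg.wellSeparated_translate hL n
    · rw [infL_map_move hl1]
      exact hW
    · intro P hP Q hQ
      obtain ⟨P, hP', rfl⟩ := List.mem_map.1 (List.mem_of_getLast? hP)
      obtain ⟨Q, hQ', rfl⟩ := List.mem_map.1 (List.mem_of_head? hQ)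
      exact h2 P hP' Q hQ'

/-- A word is cut into its maximal pieces without vacuum. -/
theorem exists_split (n : ℕ) : ∀ (l : List Site) (p : ℤ), l.length ≤ n → ∃ L : List Wave,
    (∀ P ∈ L, P.speed = 1 ∧ P.word ≠ [] ∧ V ∉ P.word ∧ P.word <:+: l) ∧ Gapped L ∧
    (∀ P ∈ L.head?, p ≤ P.pos) ∧ superpose L = place l p := by
  induction n with
  | zero =>
    intro l p hl
    obtain rfl := List.length_eq_zero_iff.1 (Nat.le_zero.1 hl)
    exact ⟨[], by simp, List.IsChain.nil, by simp, (place_V 0 p).symm⟩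
  | succ n ih =>
    intro l p hl
    by_cases hV : V ∈ l
    · obtain ⟨A, B, rfl, hA⟩ := List.eq_append_cons_of_mem hV
      simp only [List.length_append, List.length_cons] at hl
      obtain ⟨L, h1, h2, h3, h4⟩ := ih B (p + A.length + 1) (by omega)
      have h5 : place (V :: B) (p + A.length) = superpose L := by
        have := place_V_append B (p + A.length) 1
        rw [h4]
        simpa using this
      have h6 : ∀ P ∈ L, P.speed = 1 ∧ P.word ≠ [] ∧ V ∉ P.word ∧ P.word <:+: A ++ V :: B := by
        intro P hP
        obtain ⟨a, b, c, d⟩ := h1 P hP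
        exact ⟨a, b, c, d.trans ⟨A ++ [V], [], by simp⟩⟩
      by_cases hA0 : A = []
      · subst hA0
        refine ⟨L, h6, h2, fun P hP => ?_, ?_⟩
        · have := h3 P hP
          simp at this
          omega
        · rw [← h5]
          simp
      · refine ⟨⟨A, p, 1⟩ :: L, ?_, ?_, by simp, ?_⟩
        · intro P hP
          rcases List.mem_cons.1 hP with rfl | hP
          · exact ⟨rfl, hA0, hA, ⟨[], V :: B, by simp⟩⟩
          · exact h6 P hP
        · rcases L with _ | ⟨Q, L⟩
          · exact List.isChain_singleton _
          · exact List.isChain_cons_cons.2 ⟨h3 Q (by simp), h2⟩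
        · rw [superpose, ← h5, union_place]
    · by_cases h0 : l = []
      · subst h0
        exact ⟨[], by simp, List.IsChain.nil, by simp, (place_V 0 p).symm⟩
      · refine ⟨[⟨l, p, 1⟩], ?_, List.isChain_singleton _, by simp, ?_⟩
        · intro P hP
          obtain rfl := List.mem_singleton.1 hP
          exact ⟨rfl, h0, hV, List.infix_refl _⟩
        · simp [superpose, union_V]

/-- The pieces between the vacuum sites of a state of empty slots are slow solitons. -/
theorem slowWord_of_infix {w l : List Site} (hl : ∀ s ∈ l, s.Admissible) (h : NoTwo (enc l))
    (hw : w <:+: l) (h0 : w ≠ []) (hV : V ∉ w) : SlowWord w := by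
  refine ⟨⟨h0, fun h => hV (List.mem_of_head? h), fun h => hV (List.mem_of_getLast? h)⟩,
    fun s hs => hl s (hw.subset hs), ?_⟩
  obtain ⟨A, B, rfl⟩ := hw
  exact h.of_append.1.of_append.2

/-- The slow solitons can be read off from the skeleton and the marks. -/
theorem EventuallyFree.exists_inflate {S : State} {p : ℤ} {t X ys : List Bool} (h : WRep S p t X ys)
    {R : List Wave} (hR : EventuallyFree ⊤ (XS (false :: X)) R) (hfast : ∀ P ∈ R, IsFast P) {A : ℕ}
    (hA : ys.length + 1 ≤ A) : ∃ (l : List Site) (L : List Wave) (a : ℤ), (∀ s ∈ l, s.Admissible) ∧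
      enc l = inf false (false :: t ++ List.replicate A false) [] (true :: ys) ∧
      (∀ P ∈ L, P.speed = 1 ∧ V ∉ P.word ∧ P.word <:+: l ∧ SlowWord P.word) ∧
      EventuallyFree ⊤ S (L ++ infL a R) := by
  obtain ⟨l, h1, h2⟩ := exists_enc (inf false (false :: t ++ List.replicate A false) [] (true :: ys))
    false (wf_inf _ _ _ _) (inf_head _ _ _ rfl)
  obtain ⟨L, h3, h4, -, h5⟩ := exists_split _ l (p - 1) le_rfl
  have hN : NoTwo (enc l) := h2 ▸ noTwo_inf _ _
  refine ⟨l, L, _, h1, h2, fun P hP => ?_, EventuallyFree.inflate (ℓ := ⊤) h.cons le_top hR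
    hfast hA h1 h2 (fun P hP => (h3 P hP).1) h4 h5⟩
  obtain ⟨a, b, c, d⟩ := h3 P hP
  exact ⟨a, c, d, slowWord_of_infix h1 hN d b c⟩

/-! ### Every state eventually consists of solitons -/

theorem inf_marked (t : List Bool) : ∀ (c : Bool) (X ys : List Bool),
    (∀ x ∈ inf c t X ys, x.2 = true) → inf c t X ys = inf c t X [] := by
  induction t with
  | nil => intro c X ys _; rfl
  | cons a t ih =>
    intro c X ys h
    cases a <;> cases c <;> cases hX : hd false X <;>
      simp [inf, hX] at h ⊢ <;> simp [h] <;>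
      exact ih _ _ _ (by simp; tauto)

/-- The baskets of a site are as many as its unmarked boxes. -/
theorem all_marked_iff {l : List Site} (hl : ∀ s ∈ l, s.Admissible) :
    (∀ x ∈ enc l, x.2 = true) ↔ NoBaskets l := by
  constructor
  · intro h s hs
    obtain ⟨x, u, h1, h2⟩ := encS_eq s (hl s hs)
    have h3 : u = [] := by
      cases u with
      | nil => rfl
      | cons y u =>
        have := h (y, false) (List.mem_flatMap.2 ⟨s, hs, by simp [h2]⟩)
        simp at this
    subst h3
    have h4 := hl s hs
    obtain ⟨a, b, c⟩ := s
    cases x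
    · have : block c a = block 0 1 := h1
      obtain ⟨h5, h6⟩ := block_inj this
      subst h5 h6
      left
      simp only [Site.Admissible] at h4
      obtain rfl : b = 0 := by omega
      rfl
    · have : block c a = block 1 0 := h1
      obtain ⟨h5, h6⟩ := block_inj this
      subst h5 h6
      right
      simp only [Site.Admissible] at h4
      obtain rfl : b = 0 := by omega
      rfl
  · intro h x hx
    obtain ⟨X, rfl⟩ := h.exists_map
    rw [enc_vf] at hx
    obtain ⟨y, -, rfl⟩ := List.mem_map.1 hx
    rfl

/-- The marks are trivial in a state without baskets. -/
theorem WRep.of_noBaskets {l : List Site} (hl : NoBaskets l) {p : ℤ} {t X ys : List Bool}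
    (h : WRep (place l p) p t X ys) : WRep (place l p) p t X [] := by
  obtain ⟨N₀, h⟩ := h
  refine ⟨N₀, fun N hN => ?_⟩
  obtain ⟨l', h1, h2, h3⟩ := h N hN
  refine ⟨l', h1, ?_, h3⟩
  rw [h2]
  apply inf_marked
  rw [← h2, all_marked_iff h1]
  intro s hs
  have h4 := place_eq_pad h3
  have h5 : s ∈ l ++ List.replicate l'.length V := by rw [h4]; simp [hs]
  rcases List.mem_append.1 h5 with h5 | h5
  · exact hl s h5
  · exact Or.inl (List.eq_of_mem_replicate h5)

theorem T_vacuum (ℓ : ℕ∞) (hl : 1 ≤ ℓ) : T ℓ (fun _ => V) = fun _ => V := by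
  rw [← XS_nil, T_XS ℓ hl]
  rfl

theorem eventuallyFree_vacuum (ℓ : ℕ∞) (hl : 1 ≤ ℓ) : EventuallyFree ℓ (fun _ => V) [] :=
  ⟨0, fun n _ => ⟨Function.iterate_fixed (T_vacuum ℓ hl) n, List.IsChain.nil⟩⟩

theorem XS_eq_vacuum {X : List Bool} (h : true ∉ X) : XS X = fun _ => V := by
  have : X = List.replicate X.length false := by
    rw [List.eq_replicate_iff]
    refine ⟨rfl, fun b hb => ?_⟩
    cases b
    · rfl
    · exact absurd hb h
  rw [this, XS, List.map_replicate]
  exact place_V _ _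

/-- A single run of balls, as many as its speed. -/
def IsRun (P : Wave) : Prop := 1 ≤ P.speed ∧ P.word = List.replicate P.speed F

theorem IsRun.isFast {P : Wave} (h : IsRun P) : IsFast P := ⟨h.1, [], h.2⟩

theorem IsRun.infW {P : Wave} (h : IsRun P) (a : ℤ) : IsRun (infW a P) := by
  refine ⟨by simp [BoxBasketBall.infW], ?_⟩
  simp only [BoxBasketBall.infW]
  rw [h.2]
  exact infl_fastWord P.speed h.1 []

theorem IsRun.isBasic {P : Wave} (h : IsRun P) : IsBasicSoliton P.word P.speed := by
  rw [h.2]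
  exact replicate_isBasic _ h.1

theorem sorted_inflate {L R : List Wave} (hL : ∀ P ∈ L, P.speed = 1) (h : Sorted ⊤ R)
    (a : ℤ) : Sorted ⊤ (L ++ infL a R) := by
  have h1 : ∀ a, Sorted ⊤ (infL a R) := by
    induction R with
    | nil => intro a; exact List.Pairwise.nil
    | cons P R ih =>
      intro a
      obtain ⟨h2, h3⟩ := List.pairwise_cons.1 h
      refine List.pairwise_cons.2 ⟨fun Q hQ => ?_, ih h3 _⟩
      obtain ⟨b, Q', hQ', rfl⟩ := mem_infL hQ
      have := h2 Q' hQ'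
      simp only [speedAt_top, BoxBasketBall.infW] at this ⊢
      omega
  refine List.pairwise_append.2 ⟨?_, h1 a, ?_⟩
  · refine List.pairwise_of_forall_mem_list fun P hP Q hQ => ?_
    rw [speedAt_top, speedAt_top, hL P hP, hL Q hQ]
  · intro P hP Q hQ
    obtain ⟨b, Q', hQ', rfl⟩ := mem_infL hQ
    rw [speedAt_top, speedAt_top, hL P hP]
    simp [BoxBasketBall.infW]

/-- Without baskets, all solitons that finally emerge are runs of balls. The system is described by
slots that contain fewer balls, and whose solitons are inflated. -/
theorem exists_eventuallyFree_runs (n : ℕ) : ∀ X : List Bool, X.count true ≤ n →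
    ∃ R : List Wave, (∀ P ∈ R, IsRun P) ∧ Sorted ⊤ R ∧ EventuallyFree ⊤ (XS X) R := by
  induction n with
  | zero =>
    intro X hX
    refine ⟨[], by simp, List.Pairwise.nil, ?_⟩
    rw [XS_eq_vacuum (List.count_eq_zero.1 (Nat.le_zero.1 hX))]
    exact eventuallyFree_vacuum ⊤ le_top
  | succ n ih =>
    intro X hX
    obtain ⟨t, X', ys, h1, h2, h3⟩ := exists_wrep (X.map vf) (noBaskets_map X).adm
    have h4 := (h1 0).of_noBaskets (noBaskets_map X)
    have hb : balls (enc (X.map vf)) = X.count true := by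
      rw [enc_vf, balls, List.map_map]
      simp [Function.comp_def]
    rw [hb] at h2 h3
    obtain ⟨R, h5, h6, h7⟩ := ih (false :: X') (by
      rw [List.count_cons_of_ne (by decide)]
      by_cases hX' : true ∈ X'
      · have := h3 hX'
        omega
      · rw [List.count_eq_zero.2 hX']
        omega)
    obtain ⟨l, L, a, h8, h9, h10, h11⟩ := h7.exists_inflate h4 (fun P hP => (h5 P hP).isFast) le_rfl
    refine ⟨_, ?_, sorted_inflate (fun P hP => (h10 P hP).1) h6 a, h11⟩
    intro P hP
    rcases List.mem_append.1 hP with hP | hP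
    · obtain ⟨h12, h13, h14, h15⟩ := h10 P hP
      have h16 : NoBaskets l := by
        rw [← all_marked_iff h8, h9]
        have h17 : inf false (false :: t ++ List.replicate (([] : List Bool).length + 1) false) []
            [true] = inf false (false :: t ++ List.replicate (([] : List Bool).length + 1) false)
              [] [] := inf_true _ _ _ 1
        rw [h17]
        have : ∀ t : List Bool, ∀ x ∈ inf false t [] [], x.2 = true := by
          intro t
          induction t with
          | nil => simp [inf]
          | cons b t ih => cases b <;> simpa [inf] using ih
        exact this _
      obtain ⟨gs, h17⟩ := NoBaskets.slow_fastWord _ P.word le_rfl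
        (fun s hs => h16 s (h14.subset hs)) h15
      refine ⟨h12.ge, ?_⟩
      rcases gs with _ | ⟨g, gs⟩
      · rw [h17, h12]
        rfl
      · exact absurd (by rw [h17]; simp [fastWord, List.replicate_add]) h13
    · obtain ⟨b, Q, hQ, rfl⟩ := mem_infL hP
      exact (h5 Q hQ).infW b

/-- Every state eventually consists of basic solitons: the slots form a system without baskets, whose
solitons are inflated, and the slow solitons that remain are given by the skeleton and the marks. -/
theorem exists_eventuallyFree (S : State) (hS : IsState S) :
    ∃ R : List Wave, (∀ P ∈ R, IsBasicSoliton P.word P.speed) ∧ Sorted ⊤ R ∧ EventuallyFree ⊤ S R := by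
  obtain ⟨l, p, hl, rfl⟩ := exists_place S hS
  obtain ⟨t, X, ys, h1, -, -⟩ := exists_wrep l hl
  obtain ⟨R, h5, h6, h7⟩ := exists_eventuallyFree_runs _ (false :: X) le_rfl
  obtain ⟨l', L, a, h8, h9, h10, h11⟩ :=
    h7.exists_inflate (h1 p) (fun P hP => (h5 P hP).isFast) le_rfl
  refine ⟨_, ?_, sorted_inflate (fun P hP => (h10 P hP).1) h6 a, h11⟩
  intro P hP
  rcases List.mem_append.1 hP with hP | hP
  · obtain ⟨h12, h13, h14, h15⟩ := h10 P hP
    rw [h12]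
    exact h15.isBasic h13
  · obtain ⟨b, Q, hQ, rfl⟩ := mem_infL hP
    exact ((h5 Q hQ).infW b).isBasic

/-! ### Amplitudes -/

/-- The lengths of the runs of `false`, if `g` entries `false` have been read before. -/
def runsAux : ℕ → List Bool → Multiset ℕ
  | g, [] => if g = 0 then 0 else {g}
  | g, true :: ys => (if g = 0 then 0 else {g}) + runsAux 0 ys
  | g, false :: ys => runsAux (g + 1) ys

/-- The lengths of the runs of `false`. -/
def falseRuns (ys : List Bool) : Multiset ℕ := runsAux 0 ys

theorem runsAux_append (ys ys' : List Bool) : ∀ g,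
    runsAux g (ys ++ true :: ys') = runsAux g ys + falseRuns ys' := by
  induction ys with
  | nil => intro g; rfl
  | cons y ys ih =>
    intro g
    cases y <;> simp [runsAux, ih, add_assoc]

theorem falseRuns_append_true (ys : List Bool) (n : ℕ) :
    falseRuns (ys ++ List.replicate n true) = falseRuns ys := by
  induction n with
  | zero => simp
  | succ n ih =>
    rw [List.replicate_succ', ← List.append_assoc, falseRuns, runsAux_append]
    exact (add_zero _).trans ih

theorem falseRuns_true_append (ys : List Bool) (n : ℕ) :
    falseRuns (List.replicate n true ++ ys) = falseRuns ys := by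
  induction n with
  | zero => rfl
  | succ n ih =>
    rw [List.replicate_succ, List.cons_append, falseRuns, runsAux, if_pos rfl, zero_add]
    exact ih

theorem Xeq.count {t t' : List Bool} (h : Xeq t t') : t.count true = t'.count true := by
  have := congrArg (List.count true) (eq_pad_of_getD h)
  simpa [List.count_replicate] using this

theorem falseRuns_congr {ys ys' : List Bool} (h : ∀ i, ys.getD i true = ys'.getD i true) :
    falseRuns ys = falseRuns ys' := by
  have := congrArg falseRuns (eq_pad_of_getD h)
  rwa [falseRuns_append_true, falseRuns_append_true] at this

/-- The amplitudes of the ball solitons: each ball that does not belong to a slot is one of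
amplitude `1`, the others are those of the system described by the slots, increased by `1`. -/
inductive BallContent : State → Multiset ℕ → Prop
  | vacuum : BallContent (fun _ => V) 0
  | step {S : State} {p : ℤ} {t X ys : List Bool} {m : Multiset ℕ} (h : WRep S p t X ys)
      (hX : BallContent (XS X) m) :
      BallContent S (m.map (· + 1) + Multiset.replicate (t.count true) 1)

/-- The amplitudes of the basket solitons: the lengths of the runs of `false` among the marks. -/
def BasketContent (S : State) (m : Multiset ℕ) : Prop :=
  ∃ p t X ys, WRep S p t X ys ∧ falseRuns ys = m

theorem BallContent.shift {S : State} {m : Multiset ℕ} (h : BallContent S m) (k : ℤ) :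
    BallContent (shift k S) m := by
  cases h with
  | vacuum => exact BallContent.vacuum
  | step h hX => exact BallContent.step (h.shift k) hX

theorem BallContent.of_vacuum {S : State} {m : Multiset ℕ} (h : BallContent S m) :
    S = (fun _ => V) → m = 0 := by
  induction h with
  | vacuum => intro _; rfl
  | @step S p t X ys m h hX ih =>
    rintro rfl
    obtain ⟨h1, h2, -⟩ := h.unique (wrep_vacuum p)
    rw [ih (((XS_eq_iff _ _).2 h2).trans XS_nil), h1.count]
    rfl

/-- Two descriptions of the same state that start at different places. -/
theorem WRep.compare {S : State} {p p' : ℤ} {t X ys t' X' ys' : List Bool} (h : WRep S p t X ys)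
    (h' : WRep S p' t' X' ys') : t.count true = t'.count true ∧
      (∃ k, XS X = BoxBasketBall.shift k (XS X')) ∧ falseRuns ys = falseRuns ys' := by
  obtain ⟨n, hn⟩ : ∃ n : ℕ, p = min p p' + n := ⟨(p - min p p').toNat, by omega⟩
  obtain ⟨n', hn'⟩ : ∃ n : ℕ, p' = min p p' + n := ⟨(p' - min p p').toNat, by omega⟩
  have h1 := (hn ▸ h).prepend n
  have h2 := (hn' ▸ h').prepend n'
  obtain ⟨h3, h4, h5⟩ := h1.unique h2
  refine ⟨?_, ⟨(n' : ℤ) - n, ?_⟩, ?_⟩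
  · simpa [List.count_replicate] using h3.count
  · rw [← XS_eq_iff, XS_false_append, XS_false_append] at h4
    have := congrArg (BoxBasketBall.shift (-n)) h4
    rw [shift_shift, shift_shift, add_neg_cancel, shift_zero] at this
    rw [this]
    rfl
  · have := falseRuns_congr h5
    rwa [falseRuns_true_append, falseRuns_true_append] at this

theorem BallContent.unique {S : State} {m : Multiset ℕ} (h : BallContent S m) :
    ∀ {m'}, BallContent S m' → m = m' := by
  induction h with
  | vacuum => intro m' h'; exact (h'.of_vacuum rfl).symm
  | @step S p t X ys m h hX ih =>
    intro m' h'
    cases h' with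
    | vacuum => exact (BallContent.step h hX).of_vacuum rfl
    | @step _ p' t' X' ys' m' h' hX' =>
      obtain ⟨h1, ⟨k, h2⟩, -⟩ := h.compare h'
      rw [ih (h2 ▸ hX'.shift k), h1]

theorem BasketContent.unique {S : State} {m m' : Multiset ℕ} (h : BasketContent S m)
    (h' : BasketContent S m') : m = m' := by
  obtain ⟨p, t, X, ys, h1, rfl⟩ := h
  obtain ⟨p', t', X', ys', h2, rfl⟩ := h'
  exact (h1.compare h2).2.2

theorem BallContent.T {S : State} {m : Multiset ℕ} (h : BallContent S m) :
    ∀ {ℓ : ℕ∞}, 1 ≤ ℓ → BallContent (T ℓ S) m := by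
  induction h with
  | vacuum => intro ℓ hl; rw [T_vacuum ℓ hl]; exact BallContent.vacuum
  | @step S p t X ys m h hX ih =>
    intro ℓ hl
    have h1 : XS (false :: X) = BoxBasketBall.shift 1 (XS X) := XS_false_append 1 X
    have h2 : BallContent (XS (bev (cap (ℓ - 1)) 0 (false :: X))) m := by
      by_cases h0 : ℓ - 1 = 0
      · rw [h0, bev_zero, h1]
        exact hX.shift 1
      · have hl' : 1 ≤ ℓ - 1 := Order.one_le_iff_ne_zero.2 h0
        rw [← T_XS _ hl', h1, XS, shift_place, T_shift_place _ (noBaskets_map X).adm _ _ hl']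
        exact (ih hl').shift 1
    simpa using BallContent.step (h.cons.T ℓ hl).2 h2

theorem BasketContent.T {S : State} {m : Multiset ℕ} (h : BasketContent S m) {ℓ : ℕ∞}
    (hl : 1 ≤ ℓ) : BasketContent (T ℓ S) m := by
  obtain ⟨p, t, X, ys, h1, rfl⟩ := h
  exact ⟨_, _, _, _, (h1.cons.T ℓ hl).2, falseRuns_true_append ys 1⟩

theorem exists_ballContent (n : ℕ) : ∀ X : List Bool, X.count true ≤ n → ∃ m, BallContent (XS X) m := by
  induction n with
  | zero =>
    intro X hX
    rw [XS_eq_vacuum (List.count_eq_zero.1 (Nat.le_zero.1 hX))]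
    exact ⟨0, BallContent.vacuum⟩
  | succ n ih =>
    intro X hX
    obtain ⟨t, X', ys, h1, h2, h3⟩ := exists_wrep (X.map vf) (noBaskets_map X).adm
    have hb : balls (enc (X.map vf)) = X.count true := by
      rw [enc_vf, balls, List.map_map]
      simp [Function.comp_def]
    rw [hb] at h2 h3
    obtain ⟨m, hm⟩ := ih X' (by
      by_cases hX' : true ∈ X'
      · have := h3 hX'
        omega
      · rw [List.count_eq_zero.2 hX']
        omega)
    exact ⟨_, BallContent.step (h1 0) hm⟩

/-- The amplitudes of the ball solitons and of the basket solitons. -/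
def AmpContent (S : State) (c : Multiset ℕ × Multiset ℕ) : Prop :=
  BallContent S c.1 ∧ BasketContent S c.2

theorem WRep.exists_ampContent {S : State} {p : ℤ} {t X ys : List Bool} (h : WRep S p t X ys) :
    ∃ m, BallContent (XS X) m ∧
      AmpContent S (m.map (· + 1) + Multiset.replicate (t.count true) 1, falseRuns ys) := by
  obtain ⟨m, hm⟩ := exists_ballContent _ X le_rfl
  exact ⟨m, hm, BallContent.step h hm, p, t, X, ys, h, rfl⟩

theorem AmpContent.unique {S : State} {c c' : Multiset ℕ × Multiset ℕ} (h : AmpContent S c)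
    (h' : AmpContent S c') : c = c' :=
  Prod.ext (h.1.unique h'.1) (h.2.unique h'.2)

theorem AmpContent.T {S : State} {c : Multiset ℕ × Multiset ℕ} (h : AmpContent S c) {ℓ : ℕ∞}
    (hl : 1 ≤ ℓ) (n : ℕ) : AmpContent ((T ℓ)^[n] S) c := by
  induction n with
  | zero => exact h
  | succ n ih =>
    rw [Function.iterate_succ_apply']
    exact ⟨ih.1.T hl, ih.2.T hl⟩

/-! ### The content of a disjoint union of basic solitons -/

theorem emptyMarks_append (W W' : List Box) :
    emptyMarks (W ++ W') = emptyMarks W ++ emptyMarks W' := by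
  simp [emptyMarks]

theorem runsAux_false (n : ℕ) (ys : List Bool) : ∀ g,
    runsAux g (List.replicate n false ++ ys) = runsAux (g + n) ys := by
  induction n with
  | zero => intro g; rfl
  | succ n ih =>
    intro g
    rw [List.replicate_succ, List.cons_append, runsAux, ih, Nat.add_right_comm, Nat.add_assoc]

/-- In a slow word, the letters without balls are those whose marked box is empty; so the chunks of
baskets between the cuts are runs of unmarked ones among the empty boxes. -/
theorem runsAux_emptyMarks (l : List Site) (hl : ∀ s ∈ l, s.Admissible) : NoTwo (enc l) → ∀ g,
    runsAux g (emptyMarks (enc l)) = basketAmplitudesAux g l := by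
  induction l with
  | nil => intro _ g; rfl
  | cons s l ih =>
    intro h g
    have h1 : NoTwo (enc [s]) := by
      rw [← List.singleton_append] at h
      exact h.of_append.1
    have h2 : NoTwo (enc l) := by
      rw [← List.singleton_append] at h
      exact h.of_append.2
    have ih := ih (fun s hs => hl s (by simp [hs])) h2
    obtain ⟨a, b, c⟩ := s
    have hs := hl _ List.mem_cons_self
    simp only [Site.Admissible] at hs
    rw [enc_cons, emptyMarks_append]
    rcases c with _ | _ | c
    · obtain rfl : a = b + 1 := by omega
      have : emptyMarks (encS ⟨b + 1, b, 0⟩) = true :: List.replicate b false := by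
        simp [emptyMarks, encS, block, List.replicate_succ, mk_false]
      rw [this, List.cons_append, runsAux, runsAux_false, ih, basketAmplitudesAux]
      simp
    · obtain rfl : a = b := by omega
      have : emptyMarks (encS ⟨a, a, 1⟩) = List.replicate a false := by
        simp [emptyMarks, encS, block, mk_false]
      rw [this, runsAux_false, ih, basketAmplitudesAux]
      simp
    · exfalso
      have : enc [⟨a, b, c + 2⟩] = (true, true) :: (true, false) :: ((block c a).map fun y => (y, false)) := by
        simp [enc, encS, block, List.replicate_succ, mk_false]
      rw [this] at h1
      have := (List.isChain_cons_cons.1 h1).1 rfl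
      simp at this

theorem ballAmplitudes_slow {w : List Site} (h : SlowWord w) :
    ballAmplitudes w = Multiset.replicate (w.map Site.c).sum 1 := by
  rw [ballAmplitudes]
  split
  · rename_i hF
    obtain ⟨⟨h1, -, -⟩, -, h2⟩ := h
    rcases w with _ | ⟨s, _ | ⟨s', w⟩⟩
    · exact absurd rfl h1
    · obtain rfl := hF s (by simp)
      rfl
    · obtain rfl := hF s (by simp)
      obtain rfl := hF s' (by simp)
      have := (List.isChain_cons_cons.1 (show NoTwo ((true, true) :: (true, true) :: enc w) from
        h2)).1 rfl
      simp at this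
  · rfl

theorem ballAmplitudes_run (v : ℕ) : ballAmplitudes (List.replicate v F) = {v} := by
  rw [ballAmplitudes, if_pos (fun s hs => List.eq_of_mem_replicate hs), List.length_replicate]

theorem basketAmplitudes_run (v : ℕ) : basketAmplitudes (List.replicate v F) = 0 := by
  rw [basketAmplitudes]
  induction v with
  | zero => rfl
  | succ v ih => rw [List.replicate_succ, basketAmplitudesAux, if_neg (by decide)]; exact ih

/-- A run of balls, followed by vacuum, is described by slots alone. -/
theorem Seg.run (v : ℕ) (hv : 1 ≤ v) : ∃ k,
    Seg false false (enc (List.replicate (v + 1) F ++ List.replicate (v + 1) V))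
      (List.replicate (2 * v) false) (List.replicate v true ++ List.replicate v false)
      (List.replicate k true) ∧ k = 2 * v + 1 := by
  obtain ⟨u, rfl⟩ : ∃ u, v = u + 1 := ⟨v - 1, by omega⟩
  obtain ⟨k, h1, h2⟩ := Seg.colors (List.replicate (u + 1) true ++ List.replicate (u + 1) false) false
  have h3 : infl V ((List.replicate (u + 1) true ++ List.replicate (u + 1) false).map vf) =
      List.replicate (u + 1 + 1) F ++ List.replicate (u + 1 + 1) V := by
    rw [List.map_append, List.map_replicate, List.map_replicate, show vf true = F from rfl,
      show vf false = V from rfl, infl_other V F (by decide)]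
    have := infl_other F V (by decide) u []
    rw [List.append_nil] at this
    rw [this]
    simp [infl]
  have h4 : (List.replicate (u + 1) true ++ List.replicate (u + 1) false).getLast?.getD false =
      false := by
    simp [List.getLast?_append, List.getLast?_replicate]
  have h5 : cntF V ((List.replicate (u + 1) true ++ List.replicate (u + 1) false).map vf) = 1 := by
    rw [List.map_append, List.map_replicate, List.map_replicate, cntF_append]
    have := cntF_fastWord (u + 1) (by omega) []
    simp only [fastWord, List.length_nil] at this
    rw [show vf true = F from rfl, this, show vf false = V from rfl, cntF_V]
  rw [h4, show vf false = V from rfl, h3] at h1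
  rw [h4, show vf false = V from rfl, h5] at h2
  simp only [List.length_append, List.length_replicate, Bool.toNat_false] at h1 h2
  refine ⟨k, ?_, by omega⟩
  rwa [show 2 * (u + 1) = u + 1 + (u + 1) by omega]

theorem count_true_replicate_false (n : ℕ) : (List.replicate n false).count true = 0 :=
  List.count_eq_zero.2 (by simp)

theorem content_cons (P : Wave) (L : List Wave) :
    content (P :: L) = (ballAmplitudes P.word + (content L).1,
      basketAmplitudes P.word + (content L).2) := by
  simp [content]

theorem content_translate (k : ℤ) (L : List Wave) :
    content (L.map (Wave.translate k)) = content L := by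
  simp [content, Function.comp_def, Wave.translate]

theorem Separated.translate {L : List Wave} (h : Separated L) (k : ℤ) :
    Separated (L.map (Wave.translate k)) := by
  refine (List.isChain_map _).2 (List.IsChain.imp (fun P Q h => ?_) h)
  simp only [Wave.translate, Wave.rightEnd] at h ⊢
  omega

theorem XS_append (X X' : List Bool) :
    XS (X ++ X') = union (XS X) (shift X.length (XS X')) := by
  rw [XS, XS, XS, shift_place, List.map_append, ← union_place, List.length_map]

theorem IsBasicSoliton.one_le {w : List Site} {v : ℕ} (h : IsBasicSoliton w v) : 1 ≤ v := by
  rcases h.classify with ⟨rfl, -⟩ | ⟨h, -⟩ <;> omega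

/-- What a basic soliton, followed by enough vacuum sites, contributes to the description. -/
theorem IsBasicSoliton.exists_seg {P : Wave} (h : IsBasicSoliton P.word P.speed) :
    ∃ (t X ys : List Bool) (R : List Wave),
      Seg false false (enc (P.word ++ List.replicate P.speed V)) t X ys ∧ XS X = superpose R ∧
      (∀ Q ∈ R, IsRun Q ∧ Q.speed + 1 = P.speed ∧ Q.pos = 0 ∧ Q.rightEnd + Q.speed = X.length) ∧
      R.length ≤ 1 ∧
      ballAmplitudes P.word = (content R).1.map (· + 1) + Multiset.replicate (t.count true) 1 ∧
      ∀ ys', falseRuns (ys ++ ys') = basketAmplitudes P.word + falseRuns ys' := by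
  obtain ⟨w, p, v⟩ := P
  simp only at h ⊢
  rcases h.classify with ⟨rfl, h1, -⟩ | ⟨hv, rfl⟩
  · obtain ⟨t, ys, h2, h3⟩ := slow_inf h1.2.1 h1.2.2
    have h4 := seg_inf t ys h2
    have h5 := emptyMarks_inf t ys h2
    have h6 := (balls_inf t ys).1
    rw [← h3] at h4 h5 h6
    refine ⟨t, _, ys, [], h4, ?_, by simp, by simp, ?_, fun ys' => ?_⟩
    · rw [XS_eq_vacuum (by simp)]
      rfl
    · rw [balls_enc] at h6
      rw [ballAmplitudes_slow h1, ← h6]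
      simp [content, V]
    · rw [enc_append, emptyMarks_append, show emptyMarks (enc [V]) = [true] from rfl] at h5
      rw [← h5, List.append_assoc, List.singleton_append, falseRuns, runsAux_append,
        runsAux_emptyMarks _ h1.2.1 h1.2.2]
      rfl
  · obtain ⟨u, rfl⟩ : ∃ u, v = u + 1 := ⟨v - 1, by omega⟩
    obtain ⟨k, h1, -⟩ := Seg.run u (by omega)
    refine ⟨_, _, _, [⟨List.replicate u F, 0, u⟩], h1, ?_, ?_, le_rfl, ?_, fun ys' => ?_⟩
    · rw [superpose, superpose, union_V, XS, List.map_append, List.map_replicate,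
        List.map_replicate]
      exact place_append_V _ _ _
    · intro Q hQ
      obtain rfl := List.mem_singleton.1 hQ
      exact ⟨⟨show 1 ≤ u by omega, rfl⟩, rfl, rfl, by simp [Wave.rightEnd]⟩
    · simp [content, ballAmplitudes_run, List.count_replicate]
    · rw [falseRuns_true_append, basketAmplitudes_run, zero_add]

theorem Separated.exists_seg {L : List Wave} (hL : ∀ P ∈ L, IsBasicSoliton P.word P.speed) :
    Separated L → ∀ q : ℤ, (∀ P ∈ L.head?, q ≤ P.pos) →
    ∃ (l : List Site) (t X ys : List Bool) (R : List Wave), (∀ s ∈ l, s.Admissible) ∧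
      superpose L = place l q ∧ Seg false false (enc l) t X ys ∧ XS X = superpose R ∧
      (∀ P ∈ R, IsRun P) ∧ Separated R ∧ (∀ P ∈ R.head?, 0 ≤ P.pos) ∧
      (∀ P ∈ R, ∃ Q ∈ L, P.speed + 1 = Q.speed) ∧
      (content L).1 = (content R).1.map (· + 1) + Multiset.replicate (t.count true) 1 ∧
      falseRuns ys = (content L).2 := by
  induction L with
  | nil =>
    intro _ q _
    exact ⟨[], [], [], [], [], by simp, (place_V 0 q).symm, Seg.nil _, XS_nil, by simp,
      List.IsChain.nil, by simp, by simp, by simp [content], rfl⟩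
  | cons P L ih =>
    intro hS q hq
    have hh := isChain_head hS
    obtain ⟨l, t, X, ys, R, h1, h2, h3, h4, h5, h6, h7, h8, h9, h10⟩ :=
      ih (fun P hP => hL P (by simp [hP])) hS.of_cons (P.rightEnd + P.speed) hh
    obtain ⟨t₀, X₀, ys₀, R₀, g1, g2, g3, g4, g5, g6⟩ := (hL P (by simp)).exists_seg
    obtain ⟨n, hn⟩ : ∃ n : ℕ, P.pos = q + n := ⟨(P.pos - q).toNat, by
      have := hq P (by simp)
      omega⟩
    refine ⟨List.replicate n V ++ ((P.word ++ List.replicate P.speed V) ++ l),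
      List.replicate n false ++ (t₀ ++ t), List.replicate n false ++ (X₀ ++ X),
      List.replicate n true ++ (ys₀ ++ ys),
      (R₀ ++ R.map (Wave.translate X₀.length)).map (Wave.translate n), ?_, ?_, ?_, ?_, ?_, ?_, ?_,
      ?_, ?_, ?_⟩
    · intro s hs
      simp only [List.mem_append, List.mem_replicate] at hs
      rcases hs with ⟨-, rfl⟩ | (hs | ⟨-, rfl⟩) | hs
      · exact adm_V
      · exact (hL P (by simp)).1.2.2.2.1 s hs
      · exact adm_V
      · exact h1 s hs
    · rw [superpose, h2, Wave.rightEnd, ← place_V_append, union_place, place_V_append, ← hn,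
        List.append_assoc]
    · rw [enc_append, enc_append]
      exact (Seg.vacuum n).append (g1.append h3)
    · rw [XS_false_append, XS_append, g2, h4, superpose_translate, superpose_append,
        superpose_translate]
    · intro Q hQ
      obtain ⟨Q, hQ', rfl⟩ := List.mem_map.1 hQ
      rcases List.mem_append.1 hQ' with hQ | hQ
      · exact (g3 Q hQ).1
      · obtain ⟨Q, hQ'', rfl⟩ := List.mem_map.1 hQ
        exact h5 Q hQ''
    · refine Separated.translate (List.isChain_append.2 ⟨?_, h6.translate _, ?_⟩) n
      · rcases R₀ with _ | ⟨a, _ | ⟨b, c⟩⟩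
        · exact List.IsChain.nil
        · exact List.isChain_singleton _
        · simp at g4
      · intro Q hQ Q' hQ'
        have := (g3 Q (List.mem_of_getLast? hQ)).2.2.2
        rw [List.head?_map, Option.mem_def, Option.map_eq_some_iff] at hQ'
        obtain ⟨Q'', hQ'', rfl⟩ := hQ'
        have := h7 Q'' hQ''
        simp only [Wave.translate]
        omega
    · intro Q hQ
      rw [List.head?_map, Option.mem_def, Option.map_eq_some_iff] at hQ
      obtain ⟨Q, hQ, rfl⟩ := hQ
      simp only [Wave.translate]
      rw [List.head?_append, Option.or_eq_some_iff] at hQ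
      rcases hQ with hQ | ⟨-, hQ⟩
      · have := (g3 Q (List.mem_of_head? hQ)).2.2.1
        omega
      · rw [List.head?_map, Option.map_eq_some_iff] at hQ
        obtain ⟨Q, hQ, rfl⟩ := hQ
        have := h7 Q hQ
        simp only [Wave.translate]
        omega
    · intro Q hQ
      obtain ⟨Q, hQ', rfl⟩ := List.mem_map.1 hQ
      rcases List.mem_append.1 hQ' with hQ | hQ
      · exact ⟨P, by simp, (g3 Q hQ).2.1⟩
      · obtain ⟨Q, hQ'', rfl⟩ := List.mem_map.1 hQ
        obtain ⟨Q', h11, h12⟩ := h8 Q hQ''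
        exact ⟨Q', by simp [h11], h12⟩
    · rw [content_translate, content_cons, g5, h9]
      have : (content (R₀ ++ R.map (Wave.translate X₀.length))).1 =
          (content R₀).1 + (content R).1 := by
        rw [← content_translate X₀.length R]
        simp [content]
      rw [this, Multiset.map_add]
      rw [List.count_append, List.count_append, count_true_replicate_false,
        zero_add, Multiset.replicate_add]
      ac_rfl
    · rw [falseRuns_true_append, g6, h10, content_cons]

/-- Disjoint unions of basic solitons have the expected content. -/
theorem Separated.ampContent (n : ℕ) : ∀ {L : List Wave}, (∀ P ∈ L, P.speed ≤ n) →
    (∀ P ∈ L, IsBasicSoliton P.word P.speed) → Separated L →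
    AmpContent (superpose L) (content L) := by
  induction n with
  | zero =>
    intro L hn hL _
    rcases L with _ | ⟨P, L⟩
    · exact ⟨BallContent.vacuum, 0, [], [], [], wrep_vacuum 0, rfl⟩
    · have h1 := hn P (by simp)
      have h2 := (hL P (by simp)).one_le
      omega
  | succ n ih =>
    intro L hn hL hS
    obtain ⟨q, hq⟩ : ∃ q : ℤ, ∀ P ∈ L.head?, q ≤ P.pos := by
      rcases L with _ | ⟨P, L⟩
      · exact ⟨0, by simp⟩
      · exact ⟨P.pos, by simp⟩
    obtain ⟨l, t, X, ys, R, h1, h2, h3, h4, h5, h6, h7, h8, h9, h10⟩ := hS.exists_seg hL q hq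
    have h11 := h3.wrep h1 q
    rw [← h2] at h11
    refine ⟨?_, q, t, X, ys, h11, h10⟩
    rw [h9]
    refine BallContent.step h11 ?_
    rw [h4]
    refine (ih (fun P hP => ?_) (fun P hP => (h5 P hP).isBasic) h6).1
    obtain ⟨Q, hQ, h12⟩ := h8 P hP
    have := hn Q hQ
    omega

/-! ### Scattering with many equal solitons -/

/-- The sites of `M` copies of `F_k`, each followed by `k` vacuum sites. -/
def trainWord (k : ℕ) : ℕ → List Site
  | 0 => []
  | M + 1 => (List.replicate k F ++ List.replicate k V) ++ trainWord k M

theorem trainWord_length (k M : ℕ) : (trainWord k M).length = 2 * k * M := by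
  induction M with
  | zero => rfl
  | succ M ih => simp [trainWord, ih]; ring

theorem superpose_train (k M : ℕ) (x : ℤ) : superpose (train k M x) = place (trainWord k M) x := by
  have h : ∀ (M j : ℕ), superpose ((List.range' j M).map fun i : ℕ =>
      (⟨List.replicate k F, x + 2 * k * i, k⟩ : Wave)) = place (trainWord k M) (x + 2 * k * j) := by
    intro M
    induction M with
    | zero => intro j; exact (place_V 0 _).symm
    | succ M ih =>
      intro j
      rw [List.range'_succ, List.map_cons, superpose, ih, trainWord, List.append_assoc,
        ← union_place, place_V_append]
      congr 2
      push_cast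
      simp
      ring
  have := h M 0
  simp only [Nat.cast_zero, mul_zero, add_zero] at this
  rw [← this, train, List.range_eq_range']
  simp [← List.map_eq_flatMap, Function.comp_def]

theorem noBaskets_trainWord (k M : ℕ) : NoBaskets (trainWord k M) := by
  induction M with
  | zero => intro s hs; simp [trainWord] at hs
  | succ M ih =>
    intro s hs
    simp only [trainWord, List.mem_append, List.mem_replicate] at hs
    rcases hs with (⟨-, rfl⟩ | ⟨-, rfl⟩) | hs
    · exact Or.inr rfl
    · exact Or.inl rfl
    · exact ih s hs

/-- The description of a train of solitons of amplitude at least `2`. -/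
theorem Seg.train (v : ℕ) (hv : 1 ≤ v) (M : ℕ) : ∃ X : List Bool, X.map vf = trainWord v M ∧
    Seg false false (enc (trainWord (v + 1) M)) (List.replicate (2 * v * M) false) X
      (List.replicate ((2 * v + 1) * M) true) := by
  induction M with
  | zero => exact ⟨[], rfl, Seg.nil false⟩
  | succ M ih =>
    obtain ⟨X, h1, h2⟩ := ih
    obtain ⟨k, h3, rfl⟩ := Seg.run v hv
    refine ⟨(List.replicate v true ++ List.replicate v false) ++ X, ?_, ?_⟩
    · rw [List.map_append, h1, List.map_append, List.map_replicate, List.map_replicate]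
      rfl
    · have := h3.append h2
      rw [← List.replicate_add, ← List.replicate_add, ← enc_append] at this
      rwa [show 2 * v * (M + 1) = 2 * v + 2 * v * M by ring,
        show (2 * v + 1) * (M + 1) = 2 * v + 1 + (2 * v + 1) * M by ring]

/-- The description of a train of solitons of amplitude `1`. -/
theorem Seg.train_one (M : ℕ) : Seg false false (enc (trainWord 1 M)) (List.replicate M true) []
    (List.replicate M true) := by
  induction M with
  | zero => exact Seg.nil false
  | succ M ih =>
    have h : Seg false false (enc [F, V]) [true] [] [true] :=
      ⟨rfl, fun _ _ _ => by simp [inf, enc, encS_V, show encS F = [(true, true)] from rfl]⟩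
    exact h.append ih

theorem WRep.train {l : List Site} {p : ℤ} {t X ys : List Bool} (h : WRep (place l p) p t X ys)
    (n : ℕ) {w : List Site} (hw : ∀ s ∈ w, s.Admissible) {t' X' ys' : List Bool}
    (h' : Seg false false (enc w) t' X' ys') :
    WRep (place (w ++ (List.replicate n V ++ l)) (p - n - w.length)) (p - n - w.length)
      (t' ++ (List.replicate n false ++ t)) (X' ++ (List.replicate n false ++ X))
      (ys' ++ (List.replicate n true ++ ys)) := by
  rw [← union_place]
  refine h'.wrep_union hw ?_
  rw [sub_add_cancel, place_V_append, sub_add_cancel]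
  refine WRep.prepend n ?_
  rwa [sub_add_cancel]

/-- Copies of `F_k` to the left of a state contribute `k` each. They become shorter by one in the slots,
until they are slow balls. -/
theorem BallContent.train (k : ℕ) (hk : 1 ≤ k) : ∀ {l : List Site} {m : Multiset ℕ} {p : ℤ},
    (∀ s ∈ l, s.Admissible) → BallContent (place l p) m → ∀ (n M : ℕ) (q : ℤ),
    BallContent (place (trainWord k M ++ (List.replicate n V ++ l)) q)
      (m + Multiset.replicate M k) := by
  induction k, hk using Nat.le_induction with
  | base =>
    intro l m p hl h n M q
    obtain ⟨t, X, ys, h1, -, -⟩ := exists_wrep l hl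
    obtain ⟨m', h2, h3⟩ := (h1 p).exists_ampContent
    obtain rfl := h.unique h3.1
    obtain ⟨q, rfl⟩ : ∃ q', q = q' - n - (trainWord 1 M).length := ⟨q + n + (trainWord 1 M).length, by ring⟩
    have h4 := (h1 q).train n (noBaskets_trainWord 1 M).adm (Seg.train_one M)
    have h5 := BallContent.step h4 (m := m') (by
      rw [List.nil_append, XS_false_append]
      exact h2.shift n)
    convert h5 using 1
    rw [List.count_append, List.count_append, count_true_replicate_false,
      zero_add, List.count_replicate_self, Multiset.replicate_add]
    ac_rfl
  | succ k hk ih =>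
    intro l m p hl h n M q
    obtain ⟨t, X, ys, h1, -, -⟩ := exists_wrep l hl
    obtain ⟨m', h2, h3⟩ := (h1 p).exists_ampContent
    obtain rfl := h.unique h3.1
    obtain ⟨q, rfl⟩ : ∃ q', q = q' - n - (trainWord (k + 1) M).length :=
      ⟨q + n + (trainWord (k + 1) M).length, by ring⟩
    obtain ⟨X', h6, h7⟩ := Seg.train k hk M
    have h4 := (h1 q).train n (noBaskets_trainWord (k + 1) M).adm h7
    have h5 := BallContent.step h4 (m := m' + Multiset.replicate M k) (by
      rw [XS, List.map_append, h6, List.map_append, List.map_replicate]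
      exact ih (noBaskets_map X).adm h2 n M 0)
    convert h5 using 1
    rw [List.count_append, List.count_append, count_true_replicate_false,
      count_true_replicate_false, zero_add, zero_add,
      Multiset.map_add, Multiset.map_replicate]
    ac_rfl

theorem infix_of_notMem {α : Type*} {x : α} {w a b : List α} (h : x ∉ w) (hw : w <:+: a ++ x :: b) :
    w <:+: a ∨ w <:+: b := by
  obtain ⟨A, B, hAB⟩ := hw
  rcases List.append_eq_append_iff.1 hAB with ⟨c, h1, -⟩ | ⟨c, h1, h2⟩
  · exact Or.inl ⟨A, c, h1.symm⟩
  · rcases c with _ | ⟨y, c⟩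
    · exact Or.inl ⟨A, [], by simpa using h1⟩
    · rw [List.cons_append, List.cons.injEq] at h2
      obtain ⟨rfl, rfl⟩ := h2
      rcases List.append_eq_append_iff.1 h1 with ⟨d, -, h3⟩ | ⟨d, -, h3⟩
      · exact absurd (by rw [h3]; simp) h
      · rcases d with _ | ⟨y, d⟩
        · exact absurd (by rw [← List.nil_append w, ← h3]; simp) h
        · rw [List.cons_append, List.cons.injEq] at h3
          obtain ⟨rfl, rfl⟩ := h3
          exact Or.inr ⟨d, B, rfl⟩

theorem inf_append_true (t t' ys : List Bool) :
    inf false (t ++ t') [] (List.replicate t.length true ++ ys) =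
      inf false t [] [] ++ inf false t' [] ys := by
  induction t with
  | nil => rfl
  | cons a t ih => cases a <;> simpa [inf, List.replicate_succ] using ih

theorem marked_inf_nil (t : List Bool) : ∀ x ∈ inf false t [] [], x.2 = true := by
  induction t with
  | nil => simp [inf]
  | cons b t ih => cases b <;> simpa [inf] using ih

/-- If the first marks are trivial and the remaining part of the skeleton consists of slots, the
slow solitons are pure. -/
theorem isPure_of_infix {l : List Site} (hl : ∀ s ∈ l, s.Admissible) {t ys : List Bool} {n : ℕ}
    (h : enc l = inf false (t ++ false :: List.replicate n false) []
      (List.replicate t.length true ++ true :: ys)) (hy : hd true ys = true) {w : List Site}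
    (hw : w <:+: l) (hV : V ∉ w) (hS : SlowWord w) : IsPure w := by
  rw [inf_append_true] at h
  have h1 : inf false (false :: List.replicate n false) [] (true :: ys) =
      [(false, true)] ++ inf false (List.replicate n false) [] ys := by simp [inf]
  rw [h1] at h
  obtain ⟨l₁, l', rfl, h2, h3⟩ := enc_split l _ _ hl h (by simp)
  obtain ⟨l₂, l₃, rfl, h4, h5⟩ := enc_split l' _ _ (fun s hs => hl s (by simp [hs])) h3
    (inf_head _ _ _ hy)
  obtain rfl : l₂ = [V] := enc_inj _ _ (fun s hs => hl s (by simp [hs])) (by simp [adm_V])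
    (by rw [h4]; rfl)
  have hl₁ : ∀ s ∈ l₁, s.Admissible := fun s hs => hl s (by simp [hs])
  refine ⟨hS.1.1, ?_⟩
  rw [List.singleton_append] at hw
  rcases infix_of_notMem hV hw with h6 | h6
  · left
    have h7 : NoBaskets l₁ := by
      rw [← all_marked_iff hl₁, h2]
      exact marked_inf_nil t
    intro s hs
    rcases h7 s (h6.subset hs) with rfl | rfl
    · exact absurd hs hV
    · rfl
  · right
    intro s hs
    have h7 := balls_enc l₃
    rw [h5, (balls_inf _ _).1, count_true_replicate_false] at h7
    have h8 : s.c = 0 := by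
      have := List.sum_eq_zero_iff.1 h7.symm s.c (List.mem_map.2 ⟨s, h6.subset hs, rfl⟩)
      exact this
    have h9 := hS.2.1 s hs
    obtain ⟨a, b, c⟩ := s
    simp only [Site.Admissible] at h8 h9
    subst h8
    refine ⟨b, ?_, ?_⟩
    · by_contra hb
      obtain rfl : b = 0 := by omega
      obtain rfl : a = 1 := by omega
      exact hV hs
    · obtain rfl : a = b + 1 := by omega
      rfl

/-- Since the amplitudes are conserved, they can be read off from the final solitons. -/
theorem EventuallyFree.content_eq {S : State} {R : List Wave} (h : EventuallyFree ⊤ S R)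
    (hR : ∀ P ∈ R, IsBasicSoliton P.word P.speed) {c : Multiset ℕ × Multiset ℕ}
    (hc : AmpContent S c) : content R = c := by
  obtain ⟨N, h⟩ := h
  obtain ⟨h1, h2⟩ := h N le_rfl
  have h3 := hc.T (ℓ := ⊤) le_top N
  rw [h1] at h3
  have h4 : Separated (R.map (Wave.move ⊤ N)) := List.IsChain.imp (fun P Q h => by omega) h2
  obtain ⟨m, hm⟩ : ∃ m, ∀ P ∈ R.map (Wave.move ⊤ N), P.speed ≤ m :=
    ⟨((R.map (Wave.move ⊤ N)).map Wave.speed).sum, fun P hP =>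
      List.le_sum_of_mem (List.mem_map.2 ⟨P, hP, rfl⟩)⟩
  have h5 := h4.ampContent m hm (by
    intro P hP
    obtain ⟨Q, hQ, rfl⟩ := List.mem_map.1 hP
    exact hR Q hQ)
  rw [h3.unique h5]
  simp [content, Function.comp_def, Wave.move]

/-- Copies of `F_k` with `k ≥ 2` have no effect on the basket amplitudes. -/
theorem AmpContent.train {l : List Site} {p : ℤ} {c : Multiset ℕ × Multiset ℕ}
    (hl : ∀ s ∈ l, s.Admissible) (h : AmpContent (place l p) c) {k : ℕ} (hk : 2 ≤ k) (M : ℕ) (x : ℤ)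
    (hx : x ≤ p - 2 * k * M) :
    AmpContent (union (superpose (train k M x)) (place l p)) (c.1 + Multiset.replicate M k, c.2) := by
  obtain ⟨n, hn⟩ : ∃ n : ℕ, p = x + (trainWord k M).length + n := ⟨(p - x - 2 * k * M).toNat, by
    rw [trainWord_length]
    push_cast
    omega⟩
  have hS : union (superpose (BoxBasketBall.train k M x)) (place l p) =
      place (trainWord k M ++ (List.replicate n V ++ l)) x := by
    rw [superpose_train, hn, ← place_V_append, union_place]
  rw [hS]
  refine ⟨h.1.train k (by omega) hl n M x, ?_⟩
  obtain ⟨t, X, ys, h1, -, -⟩ := exists_wrep l hl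
  obtain ⟨v, rfl⟩ : ∃ v, k = v + 1 := ⟨k - 1, by omega⟩
  obtain ⟨X', h2, h3⟩ := Seg.train v (by omega) M
  have h4 := (h1 p).train n (noBaskets_trainWord _ M).adm h3
  rw [show p - n - (trainWord (v + 1) M).length = x by rw [hn]; ring] at h4
  refine ⟨_, _, _, _, h4, ?_⟩
  rw [falseRuns_true_append, falseRuns_true_append]
  obtain ⟨_, -, h5⟩ := (h1 p).exists_ampContent
  exact h5.2.unique h.2

/-- A long train of fast solitons puts so many trivial marks in front that all baskets end up to the
right of the slow balls; then the final solitons are pure. -/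
theorem AmpContent.hasContent {l : List Site} {p : ℤ} {c : Multiset ℕ × Multiset ℕ}
    (hl : ∀ s ∈ l, s.Admissible) (h : AmpContent (place l p) c) : HasContent (place l p) c := by
  intro k hk
  obtain ⟨t, X, ys, h1, -, -⟩ := exists_wrep l hl
  -- The train has `M` more marks than slots, which is enough to reach beyond the skeleton `t`.
  refine ⟨t.length + 2, fun M hM => ⟨p - 2 * k * M, fun x hx => ?_⟩⟩
  have hA := h.train hl hk M x hx
  obtain ⟨n, hn⟩ : ∃ n : ℕ, p = x + (trainWord k M).length + n := ⟨(p - x - 2 * k * M).toNat, by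
    rw [trainWord_length]
    push_cast
    omega⟩
  obtain ⟨v, rfl⟩ : ∃ v, k = v + 1 := ⟨k - 1, by omega⟩
  have hS : union (superpose (BoxBasketBall.train (v + 1) M x)) (place l p) =
      place (trainWord (v + 1) M ++ (List.replicate n V ++ l)) x := by
    rw [superpose_train, hn, ← place_V_append, union_place]
  obtain ⟨X', h2, h3⟩ := Seg.train v (by omega) M
  have h4 := (h1 p).train n (noBaskets_trainWord _ M).adm h3
  rw [show p - n - (trainWord (v + 1) M).length = x by rw [hn]; ring, ← hS] at h4
  obtain ⟨R, h5, -, h6⟩ := exists_eventuallyFree_runs _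
    (false :: (X' ++ (List.replicate n false ++ X))) le_rfl
  obtain ⟨l', L, a, h8, h9, h10, h11⟩ :=
    h6.exists_inflate h4 (fun P hP => (h5 P hP).isFast) le_rfl
  have hP : ∀ P ∈ L ++ infL a R, IsBasicSoliton P.word P.speed ∧ IsPure P.word := by
    intro P hP
    rcases List.mem_append.1 hP with hP | hP
    · obtain ⟨g1, g2, g3, g4⟩ := h10 P hP
      refine ⟨g1 ▸ g4.isBasic g2, ?_⟩
      obtain ⟨j, hj⟩ : ∃ j, M = t.length + 2 + j := ⟨M - t.length - 2, by omega⟩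
      rw [List.replicate_succ] at h9
      refine isPure_of_infix (t := false :: (List.replicate (2 * v * M) false ++
        (List.replicate n false ++ t))) (ys := List.replicate (j + 1) true ++ ys)
        (n := (List.replicate ((2 * v + 1) * M) true ++ (List.replicate n true ++ ys)).length)
        h8 ?_ rfl g3 g2 g4
      rw [h9]
      have e1 (a b : ℕ) : true :: (List.replicate a true ++ (List.replicate b true ++ ys)) =
          List.replicate (a + b + 1) true ++ ys := by
        rw [← List.append_assoc, ← List.replicate_add, List.replicate_succ, List.cons_append]
      have e2 (a b : ℕ) : List.replicate a true ++ true :: (List.replicate b true ++ ys) =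
          List.replicate (a + b + 1) true ++ ys := by
        rw [← List.cons_append, ← List.replicate_succ, ← List.append_assoc, ← List.replicate_add,
          add_assoc]
      rw [e1, e2]
      congr 3
      simp only [List.length_cons, List.length_append, List.length_replicate]
      rw [hj]
      ring
    · obtain ⟨b, Q, hQ, rfl⟩ := mem_infL hP
      have g := (h5 Q hQ).infW b
      refine ⟨g.isBasic, g.isBasic.1.1, Or.inl fun s hs => ?_⟩
      rw [g.2] at hs
      exact List.eq_of_mem_replicate hs
  exact ⟨_, hP, h11, h11.content_eq (fun P hP' => (hP P hP').1) hA⟩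

/-- Any content in the sense of scattering consists of the amplitudes that are read off from a
description, because those are conserved; hence it is unique. -/
theorem HasContent.ampContent {l : List Site} {p : ℤ} {c : Multiset ℕ × Multiset ℕ}
    (hl : ∀ s ∈ l, s.Admissible) (h : HasContent (place l p) c) : AmpContent (place l p) c := by
  obtain ⟨t, X, ys, h1, -, -⟩ := exists_wrep l hl
  obtain ⟨m, -, h2⟩ := (h1 p).exists_ampContent
  obtain ⟨c', hc'⟩ : ∃ c', AmpContent (place l p) c' := ⟨_, h2⟩
  obtain ⟨M, h3⟩ := h 2 le_rfl
  obtain ⟨x₀, h4⟩ := h3 M le_rfl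
  obtain ⟨R, h5, h6, h7⟩ := h4 (min x₀ (p - 2 * (2 : ℕ) * M)) (min_le_left _ _)
  have h8 := h6.content_eq (fun P hP => (h5 P hP).1)
    (hc'.train hl le_rfl M _ (min_le_right _ _))
  rw [h7] at h8
  have h9 := congrArg Prod.fst h8
  have h10 := congrArg Prod.snd h8
  simp only [add_left_inj] at h9 h10
  rw [Prod.ext h9 h10]
  exact hc'

/-! ### Ball solitons and basket solitons are well defined and conserved -/

theorem existsUnique_hasContent (S : State) (hS : IsState S) :
    (∃! c : Multiset ℕ × Multiset ℕ, HasContent S c) ∧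
      ∀ c : Multiset ℕ × Multiset ℕ, HasContent S c →
        ∀ ℓ : ℕ∞, 1 ≤ ℓ → ∀ t : ℕ, HasContent ((T ℓ)^[t] S) c := by
  obtain ⟨l, p, hl, rfl⟩ := exists_place S hS
  obtain ⟨t, X, ys, h1, -, -⟩ := exists_wrep l hl
  obtain ⟨m, -, h2⟩ := (h1 p).exists_ampContent
  refine ⟨⟨_, h2.hasContent hl, fun c hc => (hc.ampContent hl).unique h2⟩, fun c hc ℓ hl' n => ?_⟩
  obtain ⟨-, N₀, h3⟩ := (h1 p).cons.iterate ℓ hl' n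
  obtain ⟨l', h4, -, h5⟩ := h3 N₀ le_rfl
  have h6 := (hc.ampContent hl).T hl' n
  rw [h5] at h6 ⊢
  exact h6.hasContent h4

/-- `Separated.ampContent` without a bound on the speeds. -/
theorem Separated.ampContent' {L : List Wave} (hL : ∀ P ∈ L, IsBasicSoliton P.word P.speed)
    (hS : Separated L) : AmpContent (superpose L) (content L) :=
  hS.ampContent (L.map Wave.speed).sum
    (fun P hP => List.le_sum_of_mem (List.mem_map.2 ⟨P, hP, rfl⟩)) hL

theorem Separated.hasContent {L : List Wave} (hL : ∀ P ∈ L, IsBasicSoliton P.word P.speed)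
    (hS : Separated L) : HasContent (superpose L) (content L) := by
  obtain ⟨q, hq⟩ : ∃ q : ℤ, ∀ P ∈ L.head?, q ≤ P.pos := by
    rcases L with _ | ⟨P, L⟩
    · exact ⟨0, by simp⟩
    · exact ⟨P.pos, by simp⟩
  obtain ⟨l, -, -, -, -, h1, h2, -⟩ := hS.exists_seg hL q hq
  have h3 := hS.ampContent' hL
  rw [h2] at h3 ⊢
  exact h3.hasContent h1

/-! ### Slow solitons that are passed by fast ones -/

theorem inf_append_marks (t : List Bool) : ∀ (c : Bool) (X ys : List Bool) (k : ℕ),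
    inf c t X (ys ++ List.replicate k true) = inf c t X ys := by
  have h1 : ∀ (ys : List Bool) (k : ℕ), hd true (ys ++ List.replicate k true) = hd true ys := by
    intro ys k
    cases ys <;> cases k <;> rfl
  have h2 : ∀ (ys : List Bool) (k : ℕ), ∃ j,
      (ys ++ List.replicate k true).tail = ys.tail ++ List.replicate j true := by
    intro ys k
    cases ys
    · exact ⟨k - 1, by simp⟩
    · exact ⟨k, rfl⟩
  induction t with
  | nil => intro c X ys k; rfl
  | cons a t ih =>
    intro c X ys k
    obtain ⟨j, hj⟩ := h2 ys k
    obtain ⟨i, hi⟩ := h2 ys.tail j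
    cases a <;> simp only [inf, h1, hj, hi, ih]

/-- Descriptions that differ only by trivial entries at their ends describe the same state. -/
theorem WRep.recast {S : State} {p : ℤ} {t X ys t' X' ys' : List Bool} (h : WRep S p t X ys)
    (ht : Xeq t t') (hX : Xeq X X') (hy : ∀ i, ys.getD i true = ys'.getD i true) :
    WRep S p t' X' ys' :=
  h.congr' _ _ (eq_pad_of_getD ht) hX fun t X => by
    rw [← inf_append_marks t false X ys ys'.length, eq_pad_of_getD hy, inf_append_marks]

theorem getD_replicate_true (n : ℕ) (i : ℕ) :
    (List.replicate n true).getD i true = ([] : List Bool).getD i true := by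
  rw [getD_replicate_self]; rfl

/-- The slow state `S'` arises from `S` by `m` additional trivial marks in front, which is the effect
of `m` runs of balls that pass from left to right. Both states are described from the site `q`
on, which the runs shift by `-2 * m`. -/
def PushedAt (m : ℕ) (q : ℤ) (S S' : State) : Prop :=
  ∃ t ys, WRep S q t [] ys ∧ WRep S' (q - 2 * m) t [] (List.replicate m true ++ ys)

theorem PushedAt.lower {m : ℕ} {q : ℤ} {S S' : State} (n : ℕ) (h : PushedAt m (q + n) S S') :
    PushedAt m q S S' := by
  obtain ⟨t, ys, h1, h2⟩ := h
  have h0 : Xeq (List.replicate n false ++ []) [] := by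
    rw [List.append_nil]
    exact xeq_false n
  refine ⟨_, _, (h1.prepend n).recast (fun _ => rfl) h0 fun _ => rfl, ?_⟩
  rw [show q + n - 2 * m = q - 2 * m + n by ring] at h2
  refine (h2.prepend n).recast (fun _ => rfl) h0 fun i => ?_
  rw [← List.append_assoc, ← List.append_assoc, ← List.replicate_add, ← List.replicate_add, add_comm]

/-- `PushedAt`, with respect to some site. -/
def Pushed (m : ℕ) (S S' : State) : Prop := ∃ q, PushedAt m q S S'

theorem Pushed.exists_common {m m' : ℕ} {S S' U U' : State} (h : Pushed m S S')
    (h' : Pushed m' U U') : ∃ q, PushedAt m q S S' ∧ PushedAt m' q U U' := by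
  obtain ⟨q, h⟩ := h
  obtain ⟨q', h'⟩ := h'
  refine ⟨min q q', PushedAt.lower (q - min q q').toNat ?_, PushedAt.lower (q' - min q q').toNat ?_⟩
  · rwa [show min q q' + ((q - min q q').toNat : ℤ) = q by omega]
  · rwa [show min q q' + ((q' - min q q').toNat : ℤ) = q' by omega]

/-- The number of runs determines what they do to the slow state. -/
theorem Pushed.unique {m : ℕ} {S S' S'' : State} (h : Pushed m S S') (h' : Pushed m S S'') :
    S' = S'' := by
  obtain ⟨q, ⟨t, ys, h1, h2⟩, ⟨t', ys', h3, h4⟩⟩ := h.exists_common h'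
  obtain ⟨h5, -, h6⟩ := h3.unique h1
  refine h2.eq (h4.recast h5 (fun _ => rfl) fun i => ?_)
  rcases lt_or_ge i m with hi | hi
  · rw [List.getD_append _ _ _ _ (by simpa using hi), List.getD_append _ _ _ _ (by simpa using hi)]
  · rw [List.getD_append_right _ _ _ _ (by simpa using hi),
      List.getD_append_right _ _ _ _ (by simpa using hi), h6]

theorem Pushed.trans {m n : ℕ} {S S' S'' : State} (h : Pushed n S S') (h' : Pushed m S' S'') :
    Pushed (m + n) S S'' := by
  obtain ⟨q, h⟩ := h
  have h0 : Pushed n S S' := ⟨q, h⟩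
  obtain ⟨q', h'⟩ := h'
  obtain ⟨r, hr⟩ : ∃ r, r = min (q - 2 * n) q' := ⟨_, rfl⟩
  have h1 : PushedAt n (r + 2 * n) S S' := PushedAt.lower (q - 2 * n - r).toNat (by
    rwa [show r + 2 * n + ((q - 2 * n - r).toNat : ℤ) = q by omega])
  have h2 : PushedAt m r S' S'' := PushedAt.lower (q' - r).toNat (by
    rwa [show r + ((q' - r).toNat : ℤ) = q' by omega])
  obtain ⟨t, ys, h3, h4⟩ := h1
  obtain ⟨t', ys', h5, h6⟩ := h2
  rw [add_sub_cancel_right] at h4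
  obtain ⟨h7, -, h8⟩ := h5.unique h4
  refine ⟨r + 2 * n, t, ys, h3, ?_⟩
  rw [show r + 2 * n - 2 * ((m + n : ℕ) : ℤ) = r - 2 * m by push_cast; ring]
  refine h6.recast h7 (fun _ => rfl) fun i => ?_
  rw [List.replicate_add, List.append_assoc]
  rcases lt_or_ge i m with hi | hi
  · rw [List.getD_append _ _ _ _ (by simpa using hi), List.getD_append _ _ _ _ (by simpa using hi)]
  · rw [List.getD_append_right _ _ _ _ (by simpa using hi),
      List.getD_append_right _ _ _ _ (by simpa using hi), h8]

theorem Pushed.shift {m : ℕ} {S S' : State} (h : Pushed m S S') (k : ℤ) :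
    Pushed m (shift k S) (shift k S') := by
  obtain ⟨q, t, ys, h1, h2⟩ := h
  refine ⟨q + k, t, ys, h1.shift k, ?_⟩
  rw [show q + k - 2 * m = q - 2 * m + k by ring]
  exact h2.shift k

/-- Each site has one mark. -/
theorem length_eq_countP {l : List Site} (hl : ∀ s ∈ l, s.Admissible) :
    l.length = (enc l).countP Prod.snd := by
  induction l with
  | nil => rfl
  | cons s l ih =>
    obtain ⟨x, u, -, h⟩ := encS_eq s (hl s (by simp))
    rw [enc_cons, List.countP_append, ← ih fun s hs => hl s (by simp [hs]), h, List.countP_cons,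
      List.countP_eq_zero.2 (by simp)]
    simp
    ring

theorem countP_inf (t : List Bool) : ∀ ys : List Bool, ys.length = t.length →
    (inf false t [] ys).countP Prod.snd = t.count true + ys.count true := by
  induction t with
  | nil =>
    intro ys h
    obtain rfl := List.length_eq_zero_iff.1 h
    rfl
  | cons a t ih =>
    intro ys h
    rcases ys with _ | ⟨y, ys⟩
    · simp at h
    · have := ih ys (by simpa using h)
      cases a <;> cases y <;> simp [inf, this] <;> ring

theorem adm_append_V {l : List Site} (hl : ∀ s ∈ l, s.Admissible) (n : ℕ) :
    ∀ s ∈ l ++ List.replicate n V, s.Admissible := by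
  intro s hs
  rcases List.mem_append.1 hs with hs | hs
  · exact hl s hs
  · rw [List.eq_of_mem_replicate hs]
    exact adm_V

theorem adm_V_append {l : List Site} (hl : ∀ s ∈ l, s.Admissible) (n : ℕ) :
    ∀ s ∈ List.replicate n V ++ l, s.Admissible := by
  intro s hs
  rcases List.mem_append.1 hs with hs | hs
  · rw [List.eq_of_mem_replicate hs]
    exact adm_V
  · exact hl s hs

/-- What happens to a slow soliton that is passed by `m` runs: its skeleton stays the same, and its
marks are moved to the right by `m` entries. Space for this is provided by `m + 1` vacuum sites that
follow the soliton. -/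
theorem SlowWord.exists_pushed {Q : Wave} (h : SlowWord Q.word) (m : ℕ) :
    ∃ (Q' : Wave) (t ys : List Bool) (l' : List Site), Q'.speed = Q.speed ∧ SlowWord Q'.word ∧
      weight Q'.word = weight Q.word ∧ Q.pos - 2 * m ≤ Q'.pos ∧ Q'.rightEnd ≤ Q.rightEnd - m + 1 ∧
      (∀ s ∈ l', s.Admissible) ∧ l'.length = Q.word.length + (m + 1) ∧
      place l' (Q.pos - 2 * m) = place Q'.word Q'.pos ∧
      Seg false false (enc (Q.word ++ List.replicate (m + 1) V)) t
        (List.replicate (t.count false) false) (ys ++ List.replicate m true) ∧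
      Seg false false (enc l') t (List.replicate (t.count false) false)
        (List.replicate m true ++ ys) := by
  obtain ⟨hT, hl, hN⟩ := h
  obtain ⟨t₀, ys, h1, h2⟩ := slow_inf hl hN
  have h3 := seg_inf (t₀ ++ List.replicate m false) (ys ++ List.replicate m true) (by simp [h1])
  have h4 := seg_inf (t₀ ++ List.replicate m false) (List.replicate m true ++ ys) (by
    simp [h1, add_comm])
  have h5 : enc (Q.word ++ List.replicate (m + 1) V) =
      inf false (t₀ ++ List.replicate m false) [] (ys ++ List.replicate m true) := by
    have h := ((seg_inf t₀ ys h1).append (Seg.vacuum m)).2 [] [] []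
    rw [← h2, ← enc_append] at h
    simp only [List.append_nil, inf] at h
    rw [add_comm, List.replicate_add, ← List.append_assoc, List.replicate_one, ← h]
    refine Xeq.inf ?_ _ _ _
    rw [← List.replicate_add]
    exact xeq_false _
  -- The new marks still describe sites, since the first one is trivial if `m ≠ 0`.
  obtain ⟨l', h6, h7⟩ : ∃ l', (∀ s ∈ l', s.Admissible) ∧
      enc l' = inf false (t₀ ++ List.replicate m false) [] (List.replicate m true ++ ys) := by
    rcases m with _ | m
    · refine ⟨Q.word ++ List.replicate 1 V, adm_append_V hl 1, ?_⟩
      rw [h5]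
      simp
    · exact exists_enc _ false (wf_inf _ _ _ _) (inf_head _ _ _ rfl)
  have e5 : ys.length + m = (t₀ ++ List.replicate m false).length := by simp [h1]
  generalize t₀ ++ List.replicate m false = t at h3 h4 h5 h7 e5
  rw [← h5] at h3
  rw [← h7] at h4
  have hl₁ := adm_append_V hl (m + 1)
  have h8 : l'.length = Q.word.length + (m + 1) := by
    have e1 := length_eq_countP h6
    have e2 := length_eq_countP hl₁
    have e3 := countP_inf t (ys ++ List.replicate m true)
    have e4 := countP_inf t (List.replicate m true ++ ys)
    rw [← h7, ← e1] at e4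
    rw [← h5, ← e2] at e3
    have e6 := e3 (by simpa using e5)
    have e7 := e4 (by simpa [add_comm] using e5)
    rw [List.count_append] at e6 e7
    rw [List.length_append, List.length_replicate] at e6
    omega
  have hw : weight l' = weight Q.word := by
    have e1 := length_eq_weight h6 h7
    have e2 := length_eq_weight hl₁ h5
    rw [weight_append, weight_V, List.length_append, List.length_replicate] at e2
    rw [h8] at e1
    omega
  have hb := balls_enc l'
  have hb' := balls_enc (Q.word ++ List.replicate (m + 1) V)
  rw [h7, (balls_inf _ _).1] at hb
  rw [h5, (balls_inf _ _).1, hb, List.map_append, List.sum_append, List.map_replicate] at hb'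
  obtain ⟨i, w', j, h9, h10⟩ := exists_trim l' (by
    by_contra hV
    push Not at hV
    have e0 : l' = List.replicate l'.length V := List.eq_replicate_iff.2 ⟨rfl, hV⟩
    rw [e0, weight_V] at hw
    rw [e0, List.map_replicate, List.sum_replicate] at hb'
    have e1 : (Q.word.map Site.c).sum = 0 := by
      simpa [V] using hb'.symm
    have e2 : (Q.word.map Site.b).sum = 0 := by
      simp only [weight, e1] at hw
      omega
    rcases hQ : Q.word with _ | ⟨s, w⟩
    · exact hT.1 hQ
    · have hs := hl s (by rw [hQ]; simp)
      rw [hQ, List.map_cons, List.sum_cons] at e1 e2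
      apply hT.2.1
      rw [hQ, List.head?_cons]
      simp only [Site.Admissible] at hs
      congr 1
      ext <;> simp only [V] <;> omega)
  refine ⟨⟨w', Q.pos - 2 * m + i, Q.speed⟩, t, ys, l', rfl, ⟨h10, ?_, ?_⟩, ?_, by simp, ?_, h6, h8,
    ?_, h3, h4⟩
  · exact fun s hs => h6 s (by rw [h9]; simp [hs])
  · have := noTwo_inf t (List.replicate m true ++ ys)
    rw [← h7, h9] at this
    exact this.of_append.2.of_append.1
  · rw [← hw, h9, weight_append, weight_append, weight_V, weight_V]
    ring
  · have := congrArg List.length h9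
    rw [h8] at this
    simp only [List.length_append, List.length_replicate, Wave.rightEnd] at this ⊢
    omega
  · rw [h9, place_V_append, place_append_V]

open Classical in
/-- The slow soliton `Q` after `m` runs of balls have passed it (extrapolated to the time before the
scattering). -/
noncomputable def push (m : ℕ) (Q : Wave) : Wave :=
  if h : ∃ Q' : Wave, Q'.speed = Q.speed ∧ SlowWord Q'.word ∧
    Pushed m (place Q.word Q.pos) (place Q'.word Q'.pos) then h.choose else Q

theorem push_eq {m : ℕ} {Q Q' : Wave} (hs : Q'.speed = Q.speed) (hw : SlowWord Q'.word)
    (h : Pushed m (place Q.word Q.pos) (place Q'.word Q'.pos)) : push m Q = Q' := by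
  have h0 : ∃ Q' : Wave, Q'.speed = Q.speed ∧ SlowWord Q'.word ∧
    Pushed m (place Q.word Q.pos) (place Q'.word Q'.pos) := ⟨Q', hs, hw, h⟩
  obtain ⟨h1, h2, h3⟩ := h0.choose_spec
  rw [push, dif_pos h0]
  obtain ⟨h4, h5⟩ := trimmed_place h2.1 hw.1 (h3.unique h)
  obtain ⟨w, p, v⟩ := Q'
  generalize h0.choose = U at *
  obtain ⟨w', p', v'⟩ := U
  simp_all

theorem SlowWord.push_seg {Q : Wave} (h : SlowWord Q.word) (m : ℕ) :
    (push m Q).speed = Q.speed ∧ SlowWord (push m Q).word ∧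
      weight (push m Q).word = weight Q.word ∧ Q.pos - 2 * m ≤ (push m Q).pos ∧
      (push m Q).rightEnd ≤ Q.rightEnd - m + 1 ∧
      Pushed m (place Q.word Q.pos) (place (push m Q).word (push m Q).pos) ∧
      ∃ (t ys : List Bool) (l' : List Site),
      (∀ s ∈ l', s.Admissible) ∧ l'.length = Q.word.length + (m + 1) ∧
      place l' (Q.pos - 2 * m) = place (push m Q).word (push m Q).pos ∧
      Seg false false (enc (Q.word ++ List.replicate (m + 1) V)) t
        (List.replicate (t.count false) false) (ys ++ List.replicate m true) ∧
      Seg false false (enc l') t (List.replicate (t.count false) false)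
        (List.replicate m true ++ ys) := by
  obtain ⟨Q', t, ys, l', h1, h2, h3, h4, h5, h6, h7, h8, h9, h10⟩ := h.exists_pushed m
  have h11 : Pushed m (place Q.word Q.pos) (place Q'.word Q'.pos) := by
    have h12 := h9.wrep (adm_append_V h.2.1 _) Q.pos
    rw [place_append_V] at h12
    have h13 := h10.wrep h6 (Q.pos - 2 * m)
    rw [h8] at h13
    have h14 : ∀ i, (ys ++ List.replicate m true).getD i true = ys.getD i true := by
      intro i
      rcases lt_or_ge i ys.length with h | h
      · rw [List.getD_append _ _ _ _ h]
      · rw [List.getD_append_right _ _ _ _ h, List.getD_eq_default _ _ h, getD_replicate_self]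
    exact ⟨Q.pos, t, ys, h12.recast (fun _ => rfl) (xeq_false _) h14,
      h13.recast (fun _ => rfl) (xeq_false _) fun _ => rfl⟩
  rw [push_eq h1 h2 h11]
  exact ⟨h1, h2, h3, h4, h5, h11, t, ys, l', h6, h7, h8, h9, h10⟩

/-- Only the total number of runs matters, not the order of the fast solitons. -/
theorem SlowWord.push_push {Q : Wave} (h : SlowWord Q.word) (m n : ℕ) :
    push m (push n Q) = push (m + n) Q := by
  obtain ⟨h1, h2, -, -, -, h3, -⟩ := h.push_seg n
  obtain ⟨h4, h5, -, -, -, h6, -⟩ := h2.push_seg m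
  exact (push_eq (h4.trans h1) h5 (h3.trans h6)).symm

theorem SlowWord.push_zero {Q : Wave} (h : SlowWord Q.word) : push 0 Q = Q := by
  obtain ⟨t, ys, h1, h2⟩ := slow_inf h.2.1 h.2.2
  have h3 := slow_wrep h.2.1 h1 h2 Q.pos
  exact push_eq rfl h ⟨Q.pos, t, ys, h3, by simpa using h3⟩

theorem SlowWord.push_translate {Q : Wave} (h : SlowWord Q.word) (m : ℕ) (k : ℤ) :
    push m (Q.translate k) = (push m Q).translate k := by
  obtain ⟨h1, h2, -, -, -, h3, -⟩ := h.push_seg m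
  have h4 := h3.shift k
  rw [shift_place, shift_place] at h4
  exact push_eq h1 h2 h4

/-- The description of widely separated slow solitons before and after they are passed by `m`
runs. -/
theorem pushedAt_superpose (m : ℕ) (L : List Wave) (hL : ∀ Q ∈ L, SlowWord Q.word)
    (hg : L.IsChain fun (P Q : Wave) => P.rightEnd + ((m : ℤ) + 1) ≤ Q.pos) : ∀ q : ℤ, (∀ Q ∈ L.head?, q ≤ Q.pos) →
    PushedAt m q (superpose L) (superpose (L.map (push m))) := by
  induction L with
  | nil =>
    intro q _
    exact ⟨[], [], wrep_vacuum _, (wrep_vacuum _).recast (fun _ => rfl) (fun _ => rfl) fun i => by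
      rw [List.append_nil, getD_replicate_true]⟩
  | cons Q L ih =>
    intro q hq
    have hQ := hL Q (by simp)
    have hqQ := hq Q (by simp)
    obtain ⟨-, -, -, -, -, -, t, ys, l', h1, h2, h3, h4, h5⟩ := hQ.push_seg m
    obtain ⟨t', ys', h6, h7⟩ := ih (fun Q hQ => hL Q (by simp [hQ])) hg.of_cons
      (Q.rightEnd + (m + 1)) (isChain_head hg)
    obtain ⟨g, hg'⟩ : ∃ g : ℕ, Q.pos = q + g := ⟨(Q.pos - q).toNat, by omega⟩
    have h8 := (Seg.vacuum g).append h4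
    rw [← enc_append] at h8
    have h9 := (Seg.vacuum g).append h5
    rw [← enc_append] at h9
    have h10 := h8.wrep_union (S := superpose L) (p := q)
      (adm_V_append (adm_append_V hQ.2.1 _) _) (by
        convert h6 using 1
        simp only [List.length_append, List.length_replicate, Wave.rightEnd, hg']
        push_cast
        ring)
    have h11 := h9.wrep_union (S := superpose (L.map (push m))) (p := q - 2 * m)
      (adm_V_append h1 _) (by
        convert h7 using 1
        simp only [List.length_append, List.length_replicate, Wave.rightEnd, hg', h2]
        push_cast
        ring)
    rw [place_V_append, ← hg', place_append_V] at h10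
    rw [place_V_append, show q - 2 * m + g = Q.pos - 2 * m by rw [hg']; ring, h3] at h11
    have h12 : ∀ n k, Xeq ((List.replicate n false ++ List.replicate k false) ++ []) [] := by
      intro n k
      rw [List.append_nil, ← List.replicate_add]
      exact xeq_false _
    refine ⟨_, _, h10.recast (fun _ => rfl) (h12 _ _) fun _ => rfl,
      h11.recast (fun _ => rfl) (h12 _ _) fun i => ?_⟩
    congr 1
    simp only [← List.append_assoc, ← List.replicate_add, add_comm]

theorem gapped_push (m : ℕ) {L : List Wave} (hL : ∀ Q ∈ L, SlowWord Q.word)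
    (hg : L.IsChain fun (P Q : Wave) => P.rightEnd + ((m : ℤ) + 2) ≤ Q.pos) :
    Gapped (L.map (push m)) := by
  induction L with
  | nil => exact List.IsChain.nil
  | cons P R ih =>
    rcases R with _ | ⟨Q, R⟩
    · exact List.isChain_singleton _
    · have h1 := (List.isChain_cons_cons.1 hg).1
      obtain ⟨-, -, -, -, h2, -⟩ := (hL P (by simp)).push_seg m
      obtain ⟨-, -, -, h3, -⟩ := (hL Q (by simp)).push_seg m
      exact List.isChain_cons_cons.2 ⟨by omega, ih (fun P hP => hL P (by simp [hP])) hg.of_cons⟩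

theorem IsFast.slowWord {P : Wave} (h : IsFast P) (h1 : P.speed = 1) : SlowWord P.word := by
  obtain ⟨-, gs, h2⟩ := h
  rw [h2, h1]
  exact slowWord_fastWord gs

theorem IsFast.translate {P : Wave} (h : IsFast P) (k : ℤ) : IsFast (P.translate k) := h

/-- Balls of speed `1` without baskets are moved rigidly. -/
theorem pushedAt_noBaskets (m : ℕ) {S : State} {q : ℤ} {t ys : List Bool} (h : WRep S q t [] ys)
    {l : List Site} (hl : NoBaskets l) (hS : S = place l q) :
    PushedAt m q S (shift (-(2 * m : ℕ)) S) := by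
  rw [hS] at h ⊢
  have h1 := WRep.of_noBaskets hl h
  refine ⟨t, [], h1, ?_⟩
  rw [show q - 2 * (m : ℤ) = q + (-(2 * m : ℕ)) by push_cast; ring]
  refine (h1.shift _).recast (fun _ => rfl) (fun _ => rfl) fun i => ?_
  rw [List.append_nil, getD_replicate_true]

theorem IsFast.push_eq {P : Wave} (h : IsFast P) (h1 : P.speed = 1) (m : ℕ) :
    push m P = P.translate (-(2 * m : ℕ)) := by
  have h2 := h.slowWord h1
  obtain ⟨t, ys, h3, h4⟩ := slow_inf h2.2.1 h2.2.2
  have h5 := pushedAt_noBaskets m (slow_wrep h2.2.1 h3 h4 P.pos) h.good.1 rfl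
  rw [shift_place] at h5
  exact BoxBasketBall.push_eq rfl h2 ⟨_, h5⟩

theorem pushedAt_superpose_fast (m : ℕ) {L : List Wave} (hL : ∀ Q ∈ L, Q.speed = 1 ∧ IsFast Q)
    (hg : Gapped L) (q : ℤ) (hq : ∀ Q ∈ L.head?, q ≤ Q.pos) :
    PushedAt m q (superpose L) (superpose (L.map (push m))) ∧ Gapped (L.map (push m)) := by
  have h1 : L.map (push m) = L.map (Wave.translate (-(2 * m : ℕ))) :=
    List.map_congr_left fun Q hQ => (hL Q hQ).2.push_eq (hL Q hQ).1 m
  obtain ⟨t, ys, h2, -⟩ := pushedAt_superpose 0 L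
    (fun Q hQ => (hL Q hQ).2.slowWord (hL Q hQ).1) 
    (List.IsChain.imp (fun P Q h => by simpa only [Nat.cast_zero, zero_add] using h) hg) q hq
  rw [h1, superpose_translate]
  refine ⟨pushedAt_noBaskets m h2 (noBaskets_flat L (fun P hP => (hL P hP).2.good) q)
    (superpose_eq L q hg.disjoint hq), (List.isChain_map _).2 (List.IsChain.imp (fun P Q h => ?_) hg)⟩
  simp only [Wave.translate, Wave.rightEnd] at h ⊢
  omega

/-! ### The combinatorics of two-body scatterings -/

/-- The solitons: slow words with speed `1`, and runs of `v ≥ 2` balls with speed `v`. -/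
def Valid (P : Wave) : Prop := (P.speed = 1 ∧ SlowWord P.word) ∨ (2 ≤ P.speed ∧ IsFast P)

/-- The slower soliton `Q` after the faster soliton `P` has overtaken it. -/
noncomputable def outSlow (P Q : Wave) : Wave :=
  if Q.speed = 1 then push P.cnt Q else Q.translate (-(2 * Q.speed * P.cnt : ℕ))

/-- The faster soliton `P` after it has overtaken the slower soliton `Q`. -/
def outFast (P Q : Wave) : Wave := P.translate (weight Q.word)

theorem Valid.one_le {P : Wave} (h : Valid P) : 1 ≤ P.speed := by
  rcases h with ⟨h, -⟩ | ⟨h, -⟩ <;> omega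

theorem IsFast.valid {P : Wave} (h : IsFast P) : Valid P := by
  rcases Nat.lt_or_ge P.speed 2 with h1 | h1
  · have h2 : P.speed = 1 := by have := h.1; omega
    exact Or.inl ⟨h2, h.slowWord h2⟩
  · exact Or.inr ⟨h1, h⟩

theorem outSlow_of_eq {Q : Wave} (h : Q.speed = 1) (P : Wave) : outSlow P Q = push P.cnt Q := if_pos h

theorem outSlow_of_ne {Q : Wave} (h : Q.speed ≠ 1) (P : Wave) :
    outSlow P Q = Q.translate (-(2 * Q.speed * P.cnt : ℕ)) := if_neg h

theorem IsFast.outSlow_eq {Q : Wave} (h : IsFast Q) (P : Wave) :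
    outSlow P Q = Q.translate (-(2 * Q.speed * P.cnt : ℕ)) := by
  rw [outSlow]
  split
  · rename_i h1
    rw [h.push_eq h1, h1]
  · rfl

theorem Valid.outSlow {Q : Wave} (h : Valid Q) (P : Wave) : (outSlow P Q).speed = Q.speed ∧
    weight (outSlow P Q).word = weight Q.word ∧ Valid (outSlow P Q) := by
  rcases h with ⟨h1, h2⟩ | ⟨h1, h2⟩
  · rw [BoxBasketBall.outSlow, if_pos h1]
    obtain ⟨h3, h4, h5, -⟩ := h2.push_seg P.cnt
    exact ⟨h3, h5, Or.inl ⟨h3.trans h1, h4⟩⟩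
  · rw [BoxBasketBall.outSlow, if_neg (by omega)]
    exact ⟨rfl, rfl, Or.inr ⟨h1, h2⟩⟩

theorem speedAt_congr {P Q : Wave} (h : P.speed = Q.speed) (ℓ : ℕ∞) : P.speedAt ℓ = Q.speedAt ℓ := by
  rw [Wave.speedAt, Wave.speedAt, h]

theorem Valid.outSlow_translate {Q : Wave} (h : Valid Q) (P : Wave) (j k : ℤ) :
    BoxBasketBall.outSlow (P.translate j) (Q.translate k) =
      (BoxBasketBall.outSlow P Q).translate k := by
  rcases h with ⟨h1, h2⟩ | ⟨h1, h2⟩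
  · rw [outSlow_of_eq h1, outSlow_of_eq (Q := Q.translate k) h1]
    exact h2.push_translate _ _
  · have h3 : Q.speed ≠ 1 := by omega
    rw [outSlow_of_ne h3, outSlow_of_ne (Q := Q.translate k) h3]
    simp only [Wave.translate, Wave.mk.injEq, true_and, and_true, Wave.cnt]
    ring

/-- The slowest soliton `R` does not depend on the order in which `P` and `Q` overtake it and each
other. -/
theorem outSlow_outSlow {P Q R : Wave} (hQ : Q.speed ≠ 1) (hR : Valid R) :
    outSlow P (outSlow Q R) = outSlow (outSlow P Q) (outSlow (outFast P Q) R) := by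
  have hc : (outSlow P Q).cnt = Q.cnt := by rw [outSlow, if_neg hQ]; rfl
  have hc' : (outFast P Q).cnt = P.cnt := rfl
  rcases hR with ⟨h1, h2⟩ | ⟨h1, h2⟩
  · obtain ⟨h3, h4, -⟩ := h2.push_seg Q.cnt
    obtain ⟨h5, h6, -⟩ := h2.push_seg P.cnt
    rw [outSlow_of_eq h1, outSlow_of_eq h1, hc', outSlow_of_eq (h3.trans h1),
      outSlow_of_eq (h5.trans h1), hc, h2.push_push, h2.push_push, add_comm]
  · rw [h2.outSlow_eq, h2.outSlow_eq, (h2.translate _).outSlow_eq, (h2.translate _).outSlow_eq, hc, hc']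
    simp only [Wave.translate, Wave.mk.injEq, true_and, and_true]
    ring

/-- The middle soliton `Q` does not depend on the order of the scatterings. -/
theorem outSlow_outFast {P Q R : Wave} (hQ : Q.speed ≠ 1) (hR : Valid R) :
    outSlow (outFast P (outSlow Q R)) (outFast Q R) =
      outFast (outSlow P Q) (outSlow (outFast P Q) R) := by
  have hQ' : (outFast Q R).speed ≠ 1 := hQ
  rw [outFast.eq_1 (outSlow P Q), (hR.outSlow _).2.1, outSlow_of_ne hQ', outSlow_of_ne hQ]
  simp only [outFast, Wave.translate, Wave.mk.injEq, true_and, and_true, Wave.cnt]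
  ring

/-- The fastest soliton `P` does not depend on the order of the scatterings. -/
theorem outFast_outFast {P Q R : Wave} (hR : Valid R) :
    outFast (outFast P (outSlow Q R)) (outFast Q R) = outFast (outFast P Q) R := by
  simp only [outFast, (hR.outSlow _).2.1, Wave.translate, Wave.mk.injEq, true_and, and_true]
  ring

/-- The soliton `P`, coming from the left, overtakes the slower solitons at the beginning of a
list. -/
noncomputable def insertWave (ℓ : ℕ∞) : Wave → List Wave → List Wave
  | P, [] => [P]
  | P, Q :: L =>
      if Q.speedAt ℓ < P.speedAt ℓ then outSlow P Q :: insertWave ℓ (outFast P Q) L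
      else P :: Q :: L

/-- The outcome of the factorized scattering of a list of solitons. -/
noncomputable def scatter (ℓ : ℕ∞) : List Wave → List Wave
  | [] => []
  | P :: L => insertWave ℓ P (scatter ℓ L)

theorem insertWave_of_le {ℓ : ℕ∞} {P : Wave} {L : List Wave}
    (h : ∀ Q ∈ L.head?, P.speedAt ℓ ≤ Q.speedAt ℓ) : insertWave ℓ P L = P :: L := by
  rcases L with _ | ⟨Q, L⟩
  · rfl
  · rw [insertWave, if_neg (by have := h Q (by simp); omega)]

theorem forall_mem_insertWave {ℓ : ℕ∞} {p : Wave → Prop} (hs : ∀ P Q, p P → p Q → p (outSlow P Q))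
    (hf : ∀ P Q, p P → p Q → p (outFast P Q)) {L : List Wave} : ∀ {P : Wave}, p P → (∀ Q ∈ L, p Q) →
    ∀ Q ∈ insertWave ℓ P L, p Q := by
  induction L with
  | nil => intro P hP _; simpa [insertWave] using hP
  | cons Q L ih =>
    intro P hP hL
    have hQ := hL Q (by simp)
    rw [insertWave]
    split
    · intro R hR
      rcases List.mem_cons.1 hR with rfl | hR
      · exact hs P Q hP hQ
      · exact ih (hf P Q hP hQ) (fun R hR => hL R (by simp [hR])) R hR
    · intro R hR
      rcases List.mem_cons.1 hR with rfl | hR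
      · exact hP
      · exact hL R hR

theorem forall_mem_scatter {ℓ : ℕ∞} {p : Wave → Prop} (hs : ∀ P Q, p P → p Q → p (outSlow P Q))
    (hf : ∀ P Q, p P → p Q → p (outFast P Q)) {L : List Wave} (hL : ∀ Q ∈ L, p Q) :
    ∀ Q ∈ scatter ℓ L, p Q := by
  induction L with
  | nil => simp [scatter]
  | cons P L ih =>
    exact forall_mem_insertWave hs hf (hL P (by simp)) (ih fun Q hQ => hL Q (by simp [hQ]))

theorem valid_scatter {ℓ : ℕ∞} {L : List Wave} (hL : ∀ Q ∈ L, Valid Q) : ∀ Q ∈ scatter ℓ L, Valid Q :=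
  forall_mem_scatter (fun P _ _ hQ => (hQ.outSlow P).2.2) (fun _ _ hP _ => hP) hL

theorem isFast_scatter {ℓ : ℕ∞} {L : List Wave} (hL : ∀ Q ∈ L, IsFast Q) :
    ∀ Q ∈ scatter ℓ L, IsFast Q :=
  forall_mem_scatter (fun P Q _ hQ => by rw [hQ.outSlow_eq]; exact hQ) (fun _ _ hP _ => hP) hL

theorem sorted_insertWave {ℓ : ℕ∞} {L : List Wave} : ∀ {P : Wave}, Valid P → (∀ Q ∈ L, Valid Q) →
    Sorted ℓ L → Sorted ℓ (insertWave ℓ P L) := by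
  induction L with
  | nil => intro P _ _ _; exact List.pairwise_singleton _ _
  | cons Q L ih =>
    intro P hP hL h
    have hQ := hL Q (by simp)
    have hL' : ∀ Q ∈ L, Valid Q := fun R hR => hL R (by simp [hR])
    obtain ⟨h1, h2⟩ := List.pairwise_cons.1 h
    rw [insertWave]
    split
    · rename_i hlt
      refine List.pairwise_cons.2 ⟨fun R hR => ?_, ih (P := outFast P Q) hP hL' h2⟩
      rw [speedAt_congr (hQ.outSlow P).1]
      refine (forall_mem_insertWave (p := fun R => Valid R ∧ Q.speedAt ℓ ≤ R.speedAt ℓ) ?_ ?_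
        (P := outFast P Q) ⟨hP, hlt.le⟩ (fun R hR => ⟨hL' R hR, h1 R hR⟩) R hR).2
      · intro P R _ hR
        exact ⟨(hR.1.outSlow P).2.2, by rw [speedAt_congr (hR.1.outSlow P).1]; exact hR.2⟩
      · exact fun _ _ hP _ => hP
    · rename_i hlt
      refine List.pairwise_cons.2 ⟨fun R hR => ?_, h⟩
      rcases List.mem_cons.1 hR with rfl | hR
      · omega
      · have := h1 R hR
        omega

theorem sorted_scatter {ℓ : ℕ∞} {L : List Wave} (hL : ∀ Q ∈ L, Valid Q) : Sorted ℓ (scatter ℓ L) := by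
  induction L with
  | nil => exact List.Pairwise.nil
  | cons P L ih =>
    have hL' : ∀ Q ∈ L, Valid Q := fun R hR => hL R (by simp [hR])
    exact sorted_insertWave (hL P (by simp)) (valid_scatter hL') (ih hL')

theorem scatter_of_sorted {ℓ : ℕ∞} {L : List Wave} (hL : Sorted ℓ L) : scatter ℓ L = L := by
  induction L with
  | nil => rfl
  | cons P L ih =>
    obtain ⟨h1, h2⟩ := List.pairwise_cons.1 hL
    rw [scatter, ih h2]
    exact insertWave_of_le fun Q hQ => h1 Q (List.mem_of_head? hQ)

/-- Two-body scatterings commute: `P` may overtake `Q` before or after both have overtaken the slower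
solitons of `L`. -/
theorem insertWave_insertWave {ℓ : ℕ∞} (hl : 1 ≤ ℓ) {L : List Wave} : ∀ {P Q : Wave},
    (∀ R ∈ L, Valid R) → Q.speedAt ℓ < P.speedAt ℓ → Valid Q →
    insertWave ℓ P (insertWave ℓ Q L) =
      insertWave ℓ (outSlow P Q) (insertWave ℓ (outFast P Q) L) := by
  induction L with
  | nil =>
    intro P Q _ h hQ
    have h1 : (outSlow P Q).speedAt ℓ = Q.speedAt ℓ := speedAt_congr (hQ.outSlow P).1 ℓ
    have h2 : (outFast P Q).speedAt ℓ = P.speedAt ℓ := rfl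
    rw [insertWave.eq_1 ℓ Q, insertWave.eq_2, if_pos h, insertWave.eq_1, insertWave.eq_2,
      if_neg (by omega)]
  | cons R L ih =>
    intro P Q hL h hQ
    have h1 : (outSlow P Q).speedAt ℓ = Q.speedAt ℓ := speedAt_congr (hQ.outSlow P).1 ℓ
    have h2 : (outFast P Q).speedAt ℓ = P.speedAt ℓ := rfl
    have hR := hL R (by simp)
    by_cases h3 : R.speedAt ℓ < Q.speedAt ℓ
    · have hQ1 : Q.speed ≠ 1 := by
        intro h4
        rw [speedAt_eq_one hl h4] at h3
        have := speedAt_pos hl hR.one_le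
        omega
      have h4 : (outSlow Q R).speedAt ℓ = R.speedAt ℓ := speedAt_congr (hR.outSlow Q).1 ℓ
      have h5 : (outSlow (outFast P Q) R).speedAt ℓ = R.speedAt ℓ := speedAt_congr (hR.outSlow _).1 ℓ
      have h6 := ih (P := outFast P (outSlow Q R)) (Q := outFast Q R)
        (fun R hR => hL R (by simp [hR])) h hQ
      rw [insertWave.eq_2 ℓ Q, if_pos h3, insertWave, if_pos (by omega), h6,
        insertWave.eq_2 ℓ (outFast P Q), if_pos (by omega), insertWave, if_pos (by omega),
        outSlow_outSlow hQ1 hR, outSlow_outFast hQ1 hR, outFast_outFast hR]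
    · rw [insertWave.eq_2 ℓ Q, if_neg h3, insertWave, if_pos h, insertWave_of_le (P := outSlow P Q)]
      intro U hU
      rw [insertWave] at hU
      split at hU
      · obtain rfl : outSlow (outFast P Q) R = U := by simpa using hU
        rw [speedAt_congr (hR.outSlow _).1]
        omega
      · obtain rfl : outFast P Q = U := by simpa using hU
        omega

/-- A two-body scattering does not change the outcome of the whole scattering. -/
theorem scatter_step {ℓ : ℕ∞} (hl : 1 ≤ ℓ) {P Q : Wave} (h : Q.speedAt ℓ < P.speedAt ℓ) (hQ : Valid Q)
    {L₂ : List Wave} (hL : ∀ R ∈ L₂, Valid R) : ∀ L₁ : List Wave,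
    scatter ℓ (L₁ ++ P :: Q :: L₂) = scatter ℓ (L₁ ++ outSlow P Q :: outFast P Q :: L₂)
  | [] => insertWave_insertWave hl (valid_scatter hL) h hQ
  | R :: L₁ => congrArg (insertWave ℓ R) (scatter_step hl h hQ hL L₁)

/-! ### Scattering and inflation -/

/-- For fast solitons, the scattering under `T_ℓ` is the inflation of the one under `T_{ℓ-1}`. -/
theorem insertWave_infL {ℓ : ℕ∞} (hl : 1 ≤ ℓ) {M : List Wave} : ∀ {P : Wave} (a : ℤ),
    (∀ Q ∈ M, IsFast Q) → IsFast P →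
    insertWave ℓ (infW a P) (infL (a + 2 * P.cnt) M) = infL a (insertWave (ℓ - 1) P M) := by
  induction M with
  | nil => intro P a _ _; rfl
  | cons Q M ih =>
    intro P a hM hP
    have hQ := hM Q (by simp)
    have h1 := speedAt_infW hl (a + 2 * P.cnt) Q
    have h2 := speedAt_infW hl a P
    rw [infL, insertWave, insertWave]
    by_cases h : Q.speedAt (ℓ - 1) < P.speedAt (ℓ - 1)
    · rw [if_pos h, if_pos (by omega), infL, (hQ.infW _).outSlow_eq, hQ.outSlow_eq]
      congr 1
      · simp only [Wave.translate, hP.cnt_infW]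
        simp only [infW, Wave.mk.injEq, true_and, and_true]
        push_cast
        ring
      · have h3 := ih (P := outFast P Q) (a + 2 * Q.cnt) (fun Q hQ => hM Q (by simp [hQ])) hP
        have h4 : outFast (infW a P) (infW (a + 2 * P.cnt) Q) = infW (a + 2 * Q.cnt) (outFast P Q) := by
          rw [outFast, outFast, (hQ.infW _).weight_eq, hQ.weight_eq, hQ.cnt_infW]
          simp only [infW, Wave.translate, Wave.mk.injEq, true_and, and_true]
          push_cast
          ring
        rw [h4]
        have h5 : (Q.translate (-(2 * Q.speed * P.cnt : ℕ))).cnt = Q.cnt := rfl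
        have h6 : (outFast P Q).cnt = P.cnt := rfl
        rw [h5, ← h3, h6, add_right_comm]
    · rw [if_neg h, if_neg (by omega)]
      rfl

theorem insertWave_slow {ℓ : ℕ∞} (hl : 2 ≤ ℓ) {L : List Wave} : ∀ {P : Wave}, 2 ≤ P.speed →
    (∀ Q ∈ L, Q.speed = 1) → ∀ M : List Wave, insertWave ℓ P (L ++ M) =
      L.map (push P.cnt) ++
        insertWave ℓ (P.translate (L.map fun Q => weight Q.word).sum) M := by
  have hl1 : 1 ≤ ℓ := le_trans (by norm_num) hl
  induction L with
  | nil =>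
    intro P _ _ M
    simp [Wave.translate]
  | cons Q L ih =>
    intro P hP hL M
    have hQ := hL Q (by simp)
    have h1 : 2 ≤ P.speedAt ℓ := by
      have : ((2 : ℕ) : ℕ∞) ≤ min ℓ (P.speed : ℕ∞) := le_min hl (by exact_mod_cast hP)
      exact (ENat.toNat_natCast 2).symm.le.trans (ENat.toNat_le_toNat this (by simp))
    rw [List.cons_append, insertWave, if_pos (by rw [speedAt_eq_one hl1 hQ]; omega),
      ih (P := outFast P Q) hP (fun Q hQ => hL Q (by simp [hQ])), outSlow, if_pos hQ]
    simp only [outFast, Wave.translate, List.map_cons, List.sum_cons, List.cons_append, Wave.cnt,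
      add_assoc]

/-- The outcome of the scattering under `T_ℓ`, in terms of the scattering under `T_{ℓ-1}` of the fast
solitons alone: the latter emerge inflated, the slow solitons `L` are pushed by all their runs. -/
theorem scatter_infL {ℓ : ℕ∞} (hl : 2 ≤ ℓ) {L : List Wave} (hL : ∀ Q ∈ L, Q.speed = 1 ∧ SlowWord Q.word)
    {M : List Wave} : ∀ (a : ℤ), (∀ P ∈ M, IsFast P) →
    scatter ℓ (infL a M ++ L) = L.map (push (M.map Wave.cnt).sum) ++
      infL (a + (L.map fun Q => weight Q.word).sum) (scatter (ℓ - 1) M) := by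
  have hl1 : 1 ≤ ℓ := le_trans (by norm_num) hl
  induction M with
  | nil =>
    intro a _
    have h1 : L.map (push 0) = L :=
      (List.map_congr_left fun Q hQ => (hL Q hQ).2.push_zero).trans (List.map_id _)
    have h2 : Sorted ℓ L := by
      refine List.pairwise_of_forall_mem_list fun P hP Q hQ => ?_
      rw [speedAt_eq_one hl1 (hL P hP).1, speedAt_eq_one hl1 (hL Q hQ).1]
    simp [infL, scatter, h1, scatter_of_sorted h2]
  | cons P M ih =>
    intro a hM
    have hP := hM P (by simp)
    have hM' : ∀ P ∈ M, IsFast P := fun P hP => hM P (by simp [hP])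
    have h1 : (infW a P).translate (L.map fun Q => weight Q.word).sum =
        infW (a + (L.map fun Q => weight Q.word).sum) P := by
      simp only [Wave.translate, infW, Wave.mk.injEq, true_and, and_true]
      ring
    have h2 : (L.map (push (M.map Wave.cnt).sum)).map (fun Q => weight Q.word) =
        L.map fun Q => weight Q.word := by
      rw [List.map_map]
      exact List.map_congr_left fun Q hQ => ((hL Q hQ).2.push_seg _).2.2.1
    rw [infL, List.cons_append, scatter, ih _ hM', insertWave_slow hl
      (by have := hP.1; simp only [infW]; omega), hP.cnt_infW, scatter, h2, h1, add_right_comm a,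
      insertWave_infL hl1 _ (isFast_scatter hM') hP, List.map_map]
    · congr 1
      refine List.map_congr_left fun Q hQ => ?_
      rw [Function.comp_apply, (hL Q hQ).2.push_push, List.map_cons, List.sum_cons]
    · intro Q hQ
      obtain ⟨Q', hQ', rfl⟩ := List.mem_map.1 hQ
      exact ((hL Q' hQ').2.push_seg _).1.trans (hL Q' hQ').1

/-! ### Factorization of the scattering of many solitons -/

theorem WRep.T_eq_shift {S : State} {p : ℤ} {t X ys : List Bool} (h : WRep S p t X ys) {ℓ : ℕ∞}
    (hl : 1 ≤ ℓ) (hX : Xeq (bev (cap (ℓ - 1)) 0 (false :: X)) (false :: X)) :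
    BoxBasketBall.T ℓ S = BoxBasketBall.shift 1 S := by
  have h1 := (h.cons.T ℓ hl).2
  have h2 := (h.shift 1).cons.2
  rw [show p + 1 - 1 = p - 1 + 1 by ring] at h2
  exact (h1.recast (fun _ => rfl) hX fun _ => rfl).eq h2

theorem WellSeparated.translate {L : List Wave} (h : WellSeparated L) (k : ℤ) :
    WellSeparated (L.map (Wave.translate k)) := by
  refine (List.isChain_map _).2 (List.IsChain.imp (fun P Q h => ?_) h)
  simp only [Wave.translate, Wave.rightEnd] at h ⊢
  omega

theorem EventuallyFree.of_shift {L : List Wave} {p : ℤ} {t X ys : List Bool}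
    (h : WRep (superpose L) p t X ys) {ℓ : ℕ∞} (hl : 1 ≤ ℓ)
    (hT : BoxBasketBall.T ℓ (superpose L) = shift 1 (superpose L))
    (hL : ∀ P ∈ L, P.speedAt ℓ = 1) (hW : WellSeparated L) : EventuallyFree ℓ (superpose L) L := by
  refine ⟨0, fun n _ => ?_⟩
  have h1 : L.map (Wave.move ℓ n) = L.map (Wave.translate n) := by
    apply List.map_congr_left
    intro P hP
    rw [move_eq_translate, hL P hP]
    simp
  rw [h1]
  refine ⟨?_, hW.translate n⟩
  rw [superpose_translate]
  induction n with
  | zero => exact (shift_zero _).symm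
  | succ n ih =>
    rw [Function.iterate_succ_apply', ih (by omega) (by
      apply List.map_congr_left
      intro P hP
      rw [move_eq_translate, hL P hP]
      simp), h.T_shift ℓ hl, hT, shift_shift]
    push_cast
    ring_nf

theorem adm_flat {L : List Wave} (hL : ∀ P ∈ L, ∀ s ∈ P.word, s.Admissible) :
    ∀ q, ∀ s ∈ flat q L, s.Admissible := by
  induction L with
  | nil => intro q s hs; simp [flat] at hs
  | cons P L ih =>
    intro q s hs
    simp only [flat, List.mem_append, List.mem_replicate] at hs
    rcases hs with ⟨-, rfl⟩ | hs | hs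
    · exact adm_V
    · exact hL P (by simp) s hs
    · exact ih (fun P hP => hL P (by simp [hP])) _ s hs

theorem Separated.disjoint {L : List Wave} (h : Separated L) : Disjoint' L :=
  List.IsChain.imp (fun P Q h => by omega) h

theorem Separated.wellSeparated {L : List Wave} (h : Separated L)
    (hL : (L.map Wave.speed).Pairwise fun a b => b ≤ a) : WellSeparated L := by
  induction L with
  | nil => exact List.IsChain.nil
  | cons P R ih =>
    rcases R with _ | ⟨Q, R⟩
    · exact List.isChain_singleton _
    · have h1 := (List.isChain_cons_cons.1 h).1
      obtain ⟨h2, h3⟩ := List.pairwise_cons.1 hL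
      have h4 := h2 Q.speed (by simp)
      refine List.isChain_cons_cons.2 ⟨?_, ih h.of_cons h3⟩
      rw [max_eq_left h4]
      exact h1

theorem exists_le_head (L : List Wave) : ∃ q : ℤ, ∀ P ∈ L.head?, q ≤ P.pos := by
  rcases L with _ | ⟨P, L⟩
  · exact ⟨0, by simp⟩
  · exact ⟨P.pos, by simp⟩

theorem Valid.adm {P : Wave} (h : Valid P) : ∀ s ∈ P.word, s.Admissible := by
  rcases h with ⟨-, h⟩ | ⟨-, h⟩
  · exact h.2.1
  · exact h.good.1.adm

theorem weight_flat (L : List Wave) : ∀ q, weight (flat q L) = (L.map fun Q => weight Q.word).sum := by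
  induction L with
  | nil => intro q; rfl
  | cons P L ih => intro q; simp [flat, weight_append, weight_V, ih]

theorem weight_eq_of_superpose {L : List Wave} (hL : Disjoint' L) {l : List Site} {p : ℤ}
    (h : superpose L = place l p) : weight l = (L.map fun Q => weight Q.word).sum := by
  obtain ⟨q, hq⟩ := exists_le_head L
  obtain ⟨n, hn⟩ : ∃ n : ℕ, p = min p q + n := ⟨(p - min p q).toNat, by omega⟩
  have h1 := superpose_eq L (min p q) hL fun P hP => (min_le_right _ _).trans (hq P hP)
  rw [h, hn, ← place_V_append] at h1
  simp only [← hn] at h1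
  have h2 := congrArg weight (place_eq_pad h1)
  simpa [weight_append, weight_V, weight_flat] using h2

theorem cntF_flat (L : List Wave) (hL : ∀ P ∈ L, Good P) : Gapped L → ∀ q : ℤ,
    cntF V (flat q L) = (L.map Wave.cnt).sum := by
  induction L with
  | nil => intro _ q; rfl
  | cons P L ih =>
    intro hg q
    have hP := hL P (by simp)
    have h1 : cntF F (flat P.rightEnd L) = cntF V (flat P.rightEnd L) := by
      rcases L with _ | ⟨Q, L⟩
      · rfl
      · have h2 := isChain_head hg Q (by simp)
        obtain ⟨k, hk⟩ : ∃ k, (Q.pos - P.rightEnd).toNat = k + 1 :=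
          ⟨(Q.pos - P.rightEnd).toNat - 1, by omega⟩
        simp [flat, hk, List.replicate_succ, cntF, show V ≠ F by decide]
    have h3 : (List.replicate (P.pos - q).toNat V).getLast?.getD V = V := by
      rw [List.getLast?_replicate]
      split <;> rfl
    rw [flat, cntF_append, cntF_V, h3, cntF_append, hP.2.2, Option.getD_some, h1,
      ih (fun P hP => hL P (by simp [hP])) hg.of_cons, List.map_cons, List.sum_cons, zero_add]
    rfl

theorem flat_last (L : List Wave) (hL : ∀ P ∈ L, Good P) : Disjoint' L → ∀ q : ℤ,
    (∀ P ∈ L.head?, q ≤ P.pos) → ∀ P ∈ L.getLast?, (flat q L).getLast? = some F ∧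
      q + (flat q L).length = P.rightEnd := by
  induction L with
  | nil => simp
  | cons P L ih =>
    intro h q hq Q hQ
    have hP := hL P (by simp)
    have hqP := hq P (by simp)
    rcases L with _ | ⟨P', L⟩
    · obtain rfl : P = Q := by simpa using hQ
      constructor
      · simp [flat, List.getLast?_append, hP.2.2]
      · simp only [flat, List.length_append, List.length_replicate, Wave.rightEnd, List.length_nil]
        omega
    · obtain ⟨h1, h2⟩ := ih (fun P hP => hL P (by simp [hP])) h.of_cons P.rightEnd (isChain_head h) Q
        (by simpa [List.getLast?_cons_cons] using hQ)
      rw [flat]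
      generalize flat P.rightEnd (P' :: L) = u at h1 h2
      constructor
      · simp [List.getLast?_append, h1]
      · simp only [List.length_append, List.length_replicate, Wave.rightEnd] at h2 ⊢
        omega

theorem exists_deflateL {L : List Wave} (hL : ∀ P ∈ L, IsFast P ∧ 2 ≤ P.speed) : ∀ a : ℤ,
    ∃ M : List Wave, (∀ P ∈ M, IsFast P) ∧ infL a M = L := by
  induction L with
  | nil => intro a; exact ⟨[], by simp, rfl⟩
  | cons P L ih =>
    intro a
    obtain ⟨h1, h2⟩ := hL P (by simp)
    obtain ⟨Q, h3, h4⟩ := h1.exists_deflate h2 a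
    obtain ⟨M, h5, h6⟩ := ih (fun P hP => hL P (by simp [hP])) (a + 2 * Q.cnt)
    refine ⟨Q :: M, fun R hR => ?_, by rw [infL, h4, h6]⟩
    rcases List.mem_cons.1 hR with rfl | hR
    · exact h3
    · exact h5 R hR

theorem map_speed_infL (L : List Wave) : ∀ a, (infL a L).map Wave.speed = L.map (fun P => P.speed + 1) := by
  induction L with
  | nil => intro a; rfl
  | cons P L ih => intro a; rw [infL, List.map_cons, ih]; rfl

theorem map_cnt_infL (L : List Wave) (hL : ∀ P ∈ L, IsFast P) : ∀ a,
    (infL a L).map Wave.cnt = L.map Wave.cnt := by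
  induction L with
  | nil => intro a; rfl
  | cons P L ih =>
    intro a
    rw [infL, List.map_cons, ih (fun P hP => hL P (by simp [hP])), List.map_cons,
      (hL P (by simp)).cnt_infW]

theorem Separated.of_infL {L : List Wave} (hL : ∀ P ∈ L, Good P) : ∀ {a : ℤ}, Separated (infL a L) →
    Separated L := by
  induction L with
  | nil => intro a _; exact List.IsChain.nil
  | cons P R ih =>
    intro a h
    rcases R with _ | ⟨Q, R⟩
    · exact List.isChain_singleton _
    · have h1 := (List.isChain_cons_cons.1 h).1
      rw [infW_rightEnd (hL P (by simp))] at h1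
      simp only [infW] at h1
      exact List.isChain_cons_cons.2 ⟨by omega, ih (fun P hP => hL P (by simp [hP])) h.of_cons⟩

/-- Fast solitons are cut off from those with speed `1`. -/
theorem exists_append_speed (L : List Wave) (hL : ∀ P ∈ L, 1 ≤ P.speed)
    (h : (L.map Wave.speed).Pairwise fun a b => b ≤ a) : ∃ A B, L = A ++ B ∧ (∀ P ∈ A, 2 ≤ P.speed) ∧
      ∀ P ∈ B, P.speed = 1 := by
  induction L with
  | nil => exact ⟨[], [], rfl, by simp, by simp⟩
  | cons P L ih =>
    obtain ⟨h1, h2⟩ := List.pairwise_cons.1 h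
    by_cases hP : 2 ≤ P.speed
    · obtain ⟨A, B, rfl, h3, h4⟩ := ih (fun P hP => hL P (by simp [hP])) h2
      refine ⟨P :: A, B, rfl, fun Q hQ => ?_, h4⟩
      rcases List.mem_cons.1 hQ with rfl | hQ
      · exact hP
      · exact h3 Q hQ
    · refine ⟨[], P :: L, rfl, by simp, fun Q hQ => ?_⟩
      have h3 := hL Q hQ
      rcases List.mem_cons.1 hQ with rfl | hQ
      · omega
      · have := h1 Q.speed (List.mem_map.2 ⟨Q, hQ, rfl⟩)
        omega

/-- Under `T_1` all solitons have speed `1`. -/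
theorem eventuallyFree_one {L : List Wave} (hL : ∀ P ∈ L, Valid P) (h : Separated L)
    (hs : (L.map Wave.speed).Pairwise fun a b => b ≤ a) : EventuallyFree 1 (superpose L) L := by
  obtain ⟨q, hq⟩ := exists_le_head L
  have h1 := superpose_eq L q h.disjoint hq
  obtain ⟨t, X, ys, h2, -⟩ := exists_wrep (flat q L) (adm_flat (fun P hP => (hL P hP).adm) q)
  have h3 := h2 q
  rw [← h1] at h3
  refine EventuallyFree.of_shift h3 le_rfl (h3.T_eq_shift le_rfl ?_) (fun P hP => ?_)
    (h.wellSeparated hs)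
  · rw [show (1 : ℕ∞) - 1 = 0 from tsub_self _, bev_zero]
    exact fun _ => rfl
  · have : (1 : ℕ∞) ≤ P.speed := by exact_mod_cast (hL P hP).one_le
    rw [Wave.speedAt, min_eq_left this]
    rfl

theorem eventuallyFree_slow {ℓ : ℕ∞} (hl : 1 ≤ ℓ) {L : List Wave} (hL : ∀ P ∈ L, P.speed = 1)
    (h : Separated L) {q : ℤ} {t ys : List Bool} (hq : WRep (superpose L) q t [] ys) :
    EventuallyFree ℓ (superpose L) L := by
  refine EventuallyFree.of_shift hq hl (hq.T_eq_shift hl ?_) (fun P hP => speedAt_eq_one hl (hL P hP))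
    (h.wellSeparated ?_)
  · exact ((xeq_false 1).bev (cap (ℓ - 1)) 0).trans (xeq_false 1).symm
  · refine List.pairwise_of_forall_mem_list fun a ha b hb => ?_
    obtain ⟨P, hP, rfl⟩ := List.mem_map.1 ha
    obtain ⟨Q, hQ, rfl⟩ := List.mem_map.1 hb
    rw [hL P hP, hL Q hQ]

/-- The inductive step: the fast solitons, made shorter, are scattered in the system described by
the slots. -/
theorem EventuallyFree.scatter_infL {ℓ : ℕ∞} (hl : 2 ≤ ℓ) {M L : List Wave} {p : ℤ} (hM0 : M ≠ [])
    (hM : ∀ P ∈ M, IsFast P) (hp : ∀ P ∈ M.head?, 0 ≤ P.pos) {m : ℕ} (hm : m = (M.map Wave.cnt).sum)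
    (hL : ∀ Q ∈ L, Q.speed = 1 ∧ SlowWord Q.word) (hS : Separated (infL p M ++ L))
    (hg : Gapped (L.map (push m))) (hpush : ∀ q : ℤ, (∀ Q ∈ L.head?, q ≤ Q.pos) →
      PushedAt m q (superpose L) (superpose (L.map (push m))))
    (h : EventuallyFree (ℓ - 1) (superpose M) (scatter (ℓ - 1) M)) :
    EventuallyFree ℓ (superpose (infL p M ++ L)) (scatter ℓ (infL p M ++ L)) := by
  obtain ⟨hS1, hS2, hS3⟩ := List.isChain_append.1 hS
  have hMG : ∀ P ∈ M, Good P := fun P hP => (hM P hP).good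
  have hMS : Separated M := Separated.of_infL hMG hS1
  have hMg : Gapped M := by
    have : ∀ P ∈ M, 1 ≤ P.speed := fun P hP => (hM P hP).1
    clear * - hMS this
    induction M with
    | nil => exact List.IsChain.nil
    | cons P R ih =>
      rcases R with _ | ⟨Q, R⟩
      · exact List.isChain_singleton _
      · have h1 := (List.isChain_cons_cons.1 hMS).1
        have h2 := this P (by simp)
        exact List.isChain_cons_cons.2 ⟨by omega, ih hMS.of_cons fun P hP => this P (by simp [hP])⟩
  -- `X` are the colours of the slots. The additional empty slot completes the last run of balls.
  obtain ⟨X, hX⟩ := (noBaskets_flat M hMG 0).exists_map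
  obtain ⟨k, h1, h2⟩ := Seg.colors (X ++ [false]) false
  have h3 : infl V ((X ++ [false]).map vf) = flat p (infL p M) ++ List.replicate 2 V := by
    obtain ⟨P, hP⟩ : ∃ P, P ∈ M.getLast? := ⟨_, List.getLast?_eq_getLast_of_ne_nil hM0⟩
    rw [List.map_append, ← hX, infl_append, (flat_last M hMG hMg.disjoint 0 hp P hP).1,
      flat_infL M 0 p hMG hMg hp, zero_add]
    rfl
  have h4 : cntF V ((X ++ [false]).map vf) = m := by
    rw [List.map_append, ← hX, cntF_append, cntF_flat M hMG hMg, ← hm]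
    simp [cntF, vf, show V ≠ F by decide]
  have h5 := infl_length ((X ++ [false]).map vf) (noBaskets_map _) V (Or.inl rfl)
  have h6 : vf false = V := rfl
  rw [h6, h3] at h1
  rw [h6, h4] at h2
  rw [h3, h4, show ((X ++ [false]).map vf).getLast?.getD V = V by
    simp [List.getLast?_append, h6], if_neg (by decide), List.length_map] at h5
  rw [List.getLast?_append, List.getLast?_singleton, Option.some_or, Option.getD_some] at h1 h2
  rw [Bool.toNat_false] at h2
  obtain ⟨Z, hZ⟩ : ∃ Z, Z = (X ++ [false]).length := ⟨_, rfl⟩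
  rw [← hZ] at h1 h2 h5
  have hZ1 : 1 ≤ Z := by rw [hZ]; simp
  obtain ⟨W, hW⟩ : ∃ W, W = flat p (infL p M) ++ List.replicate 2 V := ⟨_, rfl⟩
  rw [← hW] at h1 h5
  have hp' : ∀ P ∈ (infL p M).head?, p ≤ P.pos := by
    intro P hP
    rw [head?_infL, Option.mem_def, Option.map_eq_some_iff] at hP
    obtain ⟨Q, hQ, rfl⟩ := hP
    have := hp Q hQ
    simp only [infW]
    omega
  have h7 : place W p = superpose (infL p M) := by
    rw [superpose_eq _ p (Separated.disjoint hS1) hp', hW, place_append_V]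
  have h8 : ∀ s ∈ W, s.Admissible := by
    rw [hW]
    refine adm_append_V (adm_flat (fun P hP => ?_) p) 2
    obtain ⟨b, Q, hQ, rfl⟩ := mem_infL hP
    exact ((hM Q hQ).infW b).good.1.adm
  obtain ⟨t, ys, h9, h10⟩ := hpush (p + W.length) (by
    intro Q hQ
    obtain ⟨P, hP⟩ : ∃ P, P ∈ (infL p M).getLast? := ⟨_, List.getLast?_eq_getLast_of_ne_nil (by
      rcases M with _ | ⟨P, M⟩
      · exact absurd rfl hM0
      · simp [infL])⟩
    have e1 := (flat_last _ (by
      intro P hP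
      obtain ⟨b, Q, hQ, rfl⟩ := mem_infL hP
      exact ((hM Q hQ).infW b).good) (Separated.disjoint hS1) p hp' P hP).2
    have e2 := hS3 P hP Q hQ
    have e3 : 2 ≤ P.speed := by
      obtain ⟨b, P', hP', rfl⟩ := mem_infL (List.mem_of_mem_getLast? hP)
      have := (hM P' hP').1
      simp only [infW]
      omega
    rw [hW, List.length_append, List.length_replicate]
    push_cast
    omega)
  have h11 := h1.wrep_union h8 h9
  rw [h7, ← superpose_append, List.append_nil] at h11
  have h12 : hd true (List.replicate k true ++ ys) = true := by
    obtain ⟨j, hj⟩ : ∃ j, k = j + 1 := ⟨k - 1, by omega⟩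
    rw [hj]
    rfl
  have h13 : XS (X ++ [false]) = superpose M := by
    rw [XS, List.map_append, ← hX, superpose_eq M 0 hMg.disjoint hp]
    exact place_append_V _ 0 1
  rw [show p + W.length - 2 * m = p + Z by omega] at h10
  have h14 := (h10.prepend Z).recast (X' := []) (ys' := List.replicate k true ++ ys) (fun _ => rfl)
    (by rw [List.append_nil]; exact xeq_false _) (fun i => by
      rw [show k = Z + m by omega, List.replicate_add, List.append_assoc])
  obtain ⟨N₀, h14⟩ := h14
  obtain ⟨A, hA⟩ : ∃ A, A = max N₀ (List.replicate k true ++ ys).length := ⟨_, rfl⟩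
  obtain ⟨l, h15, h16, h17⟩ := h14 A (hA ▸ le_max_left _ _)
  rw [← h13] at h
  -- The fast solitons bring `k = Z + m` marks for `Z` slots; the `m` additional ones push `L`.
  have h18 := EventuallyFree.inflate ⟨h12, h11⟩ hl h (isFast_scatter hM) (hA ▸ le_max_right _ _) h15
    h16 (L := L.map (push m)) (fun P hP => by
      obtain ⟨Q, hQ, rfl⟩ := List.mem_map.1 hP
      exact ((hL Q hQ).2.push_seg m).1.trans (hL Q hQ).1) hg h17
  rw [BoxBasketBall.scatter_infL hl hL p hM, ← hm]
  -- The word of the slow solitons is longer than the slots by its weight, which moves the fast ones.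
  convert h18 using 3
  have h19 := length_eq_weight h15 h16
  have h20 := weight_eq_of_superpose hg.disjoint h17
  rw [List.map_map] at h20
  have h21 : (L.map fun Q => weight Q.word) = L.map ((fun Q => weight Q.word) ∘ push m) :=
    List.map_congr_left fun Q hQ => ((hL Q hQ).2.push_seg m).2.2.1.symm
  rw [h19, h20, h21, List.count_append, List.count_replicate_self]
  push_cast
  ring

/-- Fast solitons, followed by slow ones that are sufficiently far apart, scatter as if only two
solitons interacted at a time. The induction is on a bound `n` for the speeds: in the slots, all
speeds and the capacity are smaller by one. -/
theorem eventuallyFree_scatter (n : ℕ) : ∀ {ℓ : ℕ∞}, 1 ≤ ℓ → ∀ {K L : List Wave},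
    (∀ P ∈ K, IsFast P ∧ 2 ≤ P.speed ∧ P.speed ≤ n) →
    ((K.map Wave.speed).Pairwise fun a b => b ≤ a) →
    (∀ Q ∈ L, Q.speed = 1 ∧ SlowWord Q.word) → Separated (K ++ L) →
    Gapped (L.map (push (K.map Wave.cnt).sum)) →
    (∀ q : ℤ, (∀ Q ∈ L.head?, q ≤ Q.pos) → PushedAt (K.map Wave.cnt).sum q (superpose L)
      (superpose (L.map (push (K.map Wave.cnt).sum)))) →
    EventuallyFree ℓ (superpose (K ++ L)) (scatter ℓ (K ++ L)) := by
  have slow : ∀ {ℓ : ℕ∞}, 1 ≤ ℓ → ∀ {L : List Wave}, (∀ Q ∈ L, Q.speed = 1 ∧ SlowWord Q.word) →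
      Separated L → (∀ q : ℤ, (∀ Q ∈ L.head?, q ≤ Q.pos) → PushedAt 0 q (superpose L)
      (superpose (L.map (push 0)))) → EventuallyFree ℓ (superpose L) (scatter ℓ L) := by
    intro ℓ hl L hL hS hp
    obtain ⟨q, hq⟩ := exists_le_head L
    obtain ⟨t, ys, h1, -⟩ := hp q hq
    rw [scatter_of_sorted]
    · exact eventuallyFree_slow hl (fun Q hQ => (hL Q hQ).1) hS h1
    · refine List.pairwise_of_forall_mem_list fun P hP Q hQ => ?_
      rw [speedAt_eq_one hl (hL P hP).1, speedAt_eq_one hl (hL Q hQ).1]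
  induction n with
  | zero =>
    intro ℓ hl K L hK _ hL hS _ hp
    obtain rfl : K = [] := List.eq_nil_iff_forall_not_mem.2 fun P hP => by
      have := hK P hP
      omega
    exact slow hl hL hS hp
  | succ n ih =>
    intro ℓ hl K L hK hs hL hS hg hp
    by_cases hK0 : K = []
    · subst hK0
      exact slow hl hL hS hp
    have hV : ∀ P ∈ K ++ L, Valid P := by
      intro P hP
      rcases List.mem_append.1 hP with hP | hP
      · exact (hK P hP).1.valid
      · exact Or.inl (hL P hP)
    by_cases hl1 : ℓ = 1
    · subst hl1
      rw [scatter_of_sorted]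
      · refine eventuallyFree_one hV hS ?_
        rw [List.map_append]
        refine List.pairwise_append.2 ⟨hs, List.pairwise_of_forall_mem_list fun a ha b hb => ?_, ?_⟩
        · obtain ⟨P, hP, rfl⟩ := List.mem_map.1 ha
          obtain ⟨Q, hQ, rfl⟩ := List.mem_map.1 hb
          rw [(hL P hP).1, (hL Q hQ).1]
        · intro a ha b hb
          obtain ⟨P, hP, rfl⟩ := List.mem_map.1 ha
          obtain ⟨Q, hQ, rfl⟩ := List.mem_map.1 hb
          have := hK P hP
          rw [(hL Q hQ).1]
          omega
      · have h1 : ∀ P ∈ K ++ L, P.speedAt 1 = 1 := by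
          intro P hP
          have : (1 : ℕ∞) ≤ P.speed := by exact_mod_cast (hV P hP).one_le
          rw [Wave.speedAt, min_eq_left this]
          rfl
        refine List.pairwise_of_forall_mem_list fun P hP Q hQ => ?_
        rw [h1 P hP, h1 Q hQ]
    have hl2 : 2 ≤ ℓ := by
      induction ℓ using ENat.recTopCoe with
      | top => exact le_top
      | coe j =>
        have h1 : 1 ≤ j := by exact_mod_cast hl
        have h2 : j ≠ 1 := fun h => hl1 (by rw [h]; rfl)
        exact_mod_cast (show 2 ≤ j by omega)
    have hl3 : 1 ≤ ℓ - 1 := by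
      induction ℓ using ENat.recTopCoe with
      | top => simp
      | coe j =>
        have h1 : 2 ≤ j := by exact_mod_cast hl2
        have h2 : ((j : ℕ∞) - 1) = ((j - 1 : ℕ) : ℕ∞) := by simp
        rw [h2]
        exact_mod_cast (show 1 ≤ j - 1 by omega)
    obtain ⟨p, hpos⟩ := exists_le_head K
    obtain ⟨M, hM, rfl⟩ := exists_deflateL (fun P hP => ⟨(hK P hP).1, (hK P hP).2.1⟩) p
    rw [map_cnt_infL M hM] at hg hp
    have hM0 : M ≠ [] := by
      rintro rfl
      exact hK0 rfl
    rw [map_speed_infL] at hs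
    have hs' : (M.map Wave.speed).Pairwise fun a b => b ≤ a := by
      rw [List.pairwise_map] at hs ⊢
      exact hs.imp fun h => by omega
    have hpos' : ∀ P ∈ M.head?, 0 ≤ P.pos := by
      intro P hP
      have := hpos (infW p P) (by rw [head?_infL, Option.mem_def.1 hP]; rfl)
      simp only [infW] at this
      omega
    refine EventuallyFree.scatter_infL hl2 hM0 hM hpos' rfl hL hS hg hp ?_
    have hspeed : ∀ P ∈ M, P.speed ≤ n := by
      intro P hP
      have h1 : P.speed + 1 ∈ (infL p M).map Wave.speed := by
        rw [map_speed_infL]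
        exact List.mem_map.2 ⟨P, hP, rfl⟩
      obtain ⟨Q, hQ, h2⟩ := List.mem_map.1 h1
      have := (hK Q hQ).2.2
      omega
    have hMS : Separated M :=
      Separated.of_infL (fun P hP => (hM P hP).good) (List.isChain_append.1 hS).1
    -- In the slots, the solitons of speed `2` are slow; having no baskets, they are moved rigidly.
    obtain ⟨A, B, rfl, hA, hB⟩ := exists_append_speed M (fun P hP => (hM P hP).1) hs'
    have hB' : ∀ Q ∈ B, Q.speed = 1 ∧ IsFast Q := fun Q hQ => ⟨hB Q hQ, hM Q (by simp [hQ])⟩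
    have hBg : Gapped B := by
      have h1 : Separated B := (List.isChain_append.1 hMS).2.1
      exact (h1.wellSeparated (by
        rw [List.map_append] at hs'
        exact (List.pairwise_append.1 hs').2.1)).gapped fun P hP => (hB P hP).ge
    refine ih hl3 (fun P hP => ⟨hM P (by simp [hP]), hA P hP, hspeed P (by simp [hP])⟩) ?_
      (fun Q hQ => ⟨hB Q hQ, (hB' Q hQ).2.slowWord (hB Q hQ)⟩) hMS ?_ fun q hq => ?_
    · rw [List.map_append] at hs'
      exact (List.pairwise_append.1 hs').1
    · obtain ⟨q, hq⟩ := exists_le_head B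
      exact (pushedAt_superpose_fast _ hB' hBg q hq).2
    · exact (pushedAt_superpose_fast _ hB' hBg q hq).1

/-! ### Solitons sufficiently far apart -/

theorem IsSoliton.valid {P : Wave} (h : IsSoliton P.word P.speed) : Valid P := by
  rcases h.classify with h | ⟨h1, gs, h2⟩
  · exact Or.inl h
  · exact Or.inr ⟨h1, by omega, gs, h2⟩

theorem Valid.isSoliton {P : Wave} (h : Valid P) : IsSoliton P.word P.speed := by
  rcases h with ⟨h1, h2⟩ | ⟨-, h1, gs, h2⟩
  · rw [h1]
    exact h2.isSoliton
  · rw [h2]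
    exact isSoliton_fastWord _ h1 gs

/-- Solitons of non-increasing speeds scatter as if only two solitons interacted at a time, if those
with speed `1` are sufficiently far apart. -/
theorem Separated.eventuallyFree_scatter {ℓ : ℕ∞} (hl : 1 ≤ ℓ) {L : List Wave}
    (hL : ∀ P ∈ L, Valid P) (hs : (L.map Wave.speed).Pairwise fun a b => b ≤ a) (hS : Separated L)
    {D : ℕ} (hD : (L.map Wave.cnt).sum + 2 ≤ D)
    (hg : L.IsChain fun (P Q : Wave) => P.speed = 1 → P.rightEnd + D ≤ Q.pos) :
    EventuallyFree ℓ (superpose L) (scatter ℓ L) := by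
  obtain ⟨A, B, rfl, hA, hB⟩ := exists_append_speed L (fun P hP => (hL P hP).one_le) hs
  have hB' : ∀ Q ∈ B, Q.speed = 1 ∧ SlowWord Q.word := by
    intro Q hQ
    have h1 := hB Q hQ
    rcases hL Q (by simp [hQ]) with h | ⟨h, -⟩
    · exact h
    · omega
  rw [List.map_append, List.sum_append] at hD
  have hg' : B.IsChain fun (P Q : Wave) => P.rightEnd + (((A.map Wave.cnt).sum : ℤ) + 2) ≤ Q.pos := by
    have h1 := (List.isChain_append.1 hg).2.1
    clear * - h1 hB hD
    induction B with
    | nil => exact List.IsChain.nil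
    | cons P R ih =>
      rcases R with _ | ⟨Q, R⟩
      · exact List.isChain_singleton _
      · have h2 := (List.isChain_cons_cons.1 h1).1 (hB P (by simp))
        simp only [List.map_cons, List.sum_cons] at hD ih
        refine List.isChain_cons_cons.2 ⟨by omega, ih (by omega) (fun P hP => hB P (by simp [hP]))
          h1.of_cons⟩
  rw [List.map_append] at hs
  refine BoxBasketBall.eventuallyFree_scatter (A.map Wave.speed).sum hl (fun P hP => ?_)
    (List.pairwise_append.1 hs).1 hB' hS (gapped_push _ (fun Q hQ => (hB' Q hQ).2) hg')
    (pushedAt_superpose _ B (fun Q hQ => (hB' Q hQ).2) (List.IsChain.imp (fun P Q h => by omega) hg'))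
  refine ⟨?_, hA P hP, List.le_sum_of_mem (List.mem_map.2 ⟨P, hP, rfl⟩)⟩
  rcases hL P (by simp [hP]) with ⟨h, -⟩ | ⟨-, h⟩
  · have := hA P hP
    omega
  · exact h

/-! ### Two-body scattering -/

theorem speed_lt_of_speedAt_lt {ℓ : ℕ∞} {P Q : Wave} (h : Q.speedAt ℓ < P.speedAt ℓ) :
    Q.speed < P.speed := by
  by_contra h1
  push Not at h1
  have h2 : min ℓ (P.speed : ℕ∞) ≤ min ℓ (Q.speed : ℕ∞) := min_le_min le_rfl (by exact_mod_cast h1)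
  have h3 := ENat.toNat_le_toNat h2 (ne_top_of_le_ne_top (ENat.natCast_ne_top Q.speed) (min_le_right _ _))
  rw [Wave.speedAt, Wave.speedAt] at h
  omega

/-- The outcome of a two-body scattering. -/
theorem twoBody_out {ℓ : ℕ∞} (hl : 1 ≤ ℓ) {P Q : Wave} (hP : Valid P) (hQ : Valid Q)
    (h : Q.speedAt ℓ < P.speedAt ℓ) : TwoBody ℓ P Q (outSlow P Q) (outFast P Q) := by
  have h1 := speed_lt_of_speedAt_lt h
  have h2 := hQ.one_le
  refine ⟨hP.isSoliton, rfl, (hQ.outSlow P).2.2.isSoliton, (hQ.outSlow P).1, fun s hs => ?_⟩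
  have h3 : scatter ℓ [P.move ℓ s, Q.move ℓ s] =
      [(outSlow P Q).move ℓ s, (outFast P Q).move ℓ s] := by
    have h4 : (Q.move ℓ s).speedAt ℓ < (P.move ℓ s).speedAt ℓ := h
    rw [scatter, scatter, scatter, insertWave, insertWave, if_pos h4, insertWave, move_eq_translate,
      move_eq_translate, hQ.outSlow_translate, move_eq_translate, move_eq_translate,
      speedAt_congr (hQ.outSlow P).1]
    congr 2
    simp only [outFast, Wave.translate, Wave.mk.injEq, true_and, and_true]
    rw [add_right_comm]
    rfl
  rw [← h3]
  -- The faster soliton has speed at least `2`, so that no minimal distance is required.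
  refine hs.eventuallyFree_scatter hl ?_ ?_ le_rfl ?_
  · intro R hR
    simp only [List.mem_cons, List.not_mem_nil, or_false] at hR
    rcases hR with rfl | rfl
    · exact hP
    · exact hQ
  · simp only [List.map_cons, List.map_nil, List.pairwise_cons, List.mem_singleton]
    refine ⟨fun a ha => ?_, by simp⟩
    rw [ha]
    exact h1.le
  · refine List.isChain_cons_cons.2 ⟨fun h4 => ?_, List.isChain_singleton _⟩
    have h5 : P.speed = 1 := h4
    omega

theorem place_of_le (w : List Site) (p i : ℤ) (h : p + w.length ≤ i) : place w p i = V := by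
  rw [place]
  split
  · rw [List.getD_eq_default _ _ (by omega)]
  · rfl

/-- Two waves that are sufficiently far apart can be read off from their union. -/
theorem eq_of_superpose_pair {P Q P' Q' : Wave} (hP : Trimmed P.word) (hQ : Trimmed Q.word)
    (hP' : Trimmed P'.word) (hQ' : Trimmed Q'.word) (h : superpose [Q, P] = superpose [Q', P'])
    (h1 : Q.rightEnd ≤ P.pos) (h2 : Q'.rightEnd ≤ P'.pos) (h3 : Q.rightEnd ≤ P'.pos)
    (h4 : Q'.rightEnd ≤ P.pos) :
    (Q.word = Q'.word ∧ Q.pos = Q'.pos) ∧ P.word = P'.word ∧ P.pos = P'.pos := by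
  simp only [superpose, union_V] at h
  simp only [Wave.rightEnd] at h1 h2 h3 h4
  constructor
  · refine trimmed_place hQ hQ' (funext fun i => ?_)
    by_cases hi : i < P.pos ∧ i < P'.pos
    · have h5 (w : List Site) (p : ℤ) : (if place w p i = V then V else place w p i) = place w p i := by
        split <;> simp_all
      have := congrFun h i
      simpa only [union, place_of_lt _ _ _ hi.1, place_of_lt _ _ _ hi.2, h5] using this
    · rw [place_of_le _ _ _ (by omega), place_of_le _ _ _ (by omega)]
  · refine trimmed_place hP hP' (funext fun i => ?_)
    by_cases hi : i < P.pos ∧ i < P'.pos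
    · rw [place_of_lt _ _ _ hi.1, place_of_lt _ _ _ hi.2]
    · have := congrFun h i
      simpa [union, place_of_le Q.word Q.pos i (by omega), place_of_le Q'.word Q'.pos i (by omega)]
        using this

theorem wave_ext {P Q : Wave} (h1 : P.word = Q.word) (h2 : P.pos = Q.pos) (h3 : P.speed = Q.speed) :
    P = Q := by
  obtain ⟨w, p, v⟩ := P
  obtain ⟨w', p', v'⟩ := Q
  simp_all

/-- A two-body scattering has at most one outcome. -/
theorem TwoBody.unique {ℓ : ℕ∞} {P Q Q₁ P₁ Q₂ P₂ : Wave} (hlt : Q.speedAt ℓ < P.speedAt ℓ)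
    (h₁ : TwoBody ℓ P Q Q₁ P₁) (h₂ : TwoBody ℓ P Q Q₂ P₂) : Q₁ = Q₂ ∧ P₁ = P₂ := by
  obtain ⟨a1, a2, a3, a4, a5⟩ := h₁
  obtain ⟨b1, b2, b3, b4, b5⟩ := h₂
  obtain ⟨N, hN⟩ := Filter.eventually_atTop.1 (eventually_le_add_mul (P.rightEnd + P.speed) Q.pos _ _ hlt)
  have h0 : Separated [P.move ℓ (-N : ℤ), Q.move ℓ (-N : ℤ)] := by
    refine List.isChain_cons_cons.2 ⟨?_, List.isChain_singleton _⟩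
    have := hN N le_rfl
    simp only [Wave.move, Wave.rightEnd] at this ⊢
    linarith
  -- From a time at which `P` and `Q` are separated, both outcomes describe the same state; when their
  -- solitons are sufficiently far apart, they have to agree.
  generalize (-N : ℤ) = s at h0
  have hA := eventuallyFree_iff.1 (a5 s h0)
  have hB := eventuallyFree_iff.1 (b5 s h0)
  have e1 : ∀ {Q' P' : Wave}, Q'.speed = Q.speed → P'.speed = P.speed →
      (Q'.move ℓ s).speedAt ℓ < (P'.move ℓ s).speedAt ℓ := by
    intro Q' P' h1 h2
    rw [speedAt_congr (show (Q'.move ℓ s).speed = Q.speed from h1),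
      speedAt_congr (show (P'.move ℓ s).speed = P.speed from h2)]
    exact hlt
  obtain ⟨n, ⟨g1, -⟩, ⟨g2, -⟩, g3, g4, g5, g6⟩ := (hA.and (hB.and
    ((eventually_le_add_mul (Q₁.move ℓ s).rightEnd (P₁.move ℓ s).pos _ _ (e1 a4 a2)).and
    ((eventually_le_add_mul (Q₂.move ℓ s).rightEnd (P₂.move ℓ s).pos _ _ (e1 b4 b2)).and
    ((eventually_le_add_mul (Q₁.move ℓ s).rightEnd (P₂.move ℓ s).pos _ _ (e1 a4 b2)).and
    (eventually_le_add_mul (Q₂.move ℓ s).rightEnd (P₁.move ℓ s).pos _ _ (e1 b4 a2))))))).exists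
  rw [g1] at g2
  obtain ⟨⟨c1, c2⟩, c3, c4⟩ := eq_of_superpose_pair (P := (P₁.move ℓ s).move ℓ n)
    (Q := (Q₁.move ℓ s).move ℓ n) (P' := (P₂.move ℓ s).move ℓ n) (Q' := (Q₂.move ℓ s).move ℓ n)
    a1.trimmed a3.trimmed b1.trimmed b3.trimmed g2
    (by simp only [Wave.move, Wave.rightEnd] at g3 ⊢; linarith)
    (by simp only [Wave.move, Wave.rightEnd] at g4 ⊢; linarith)
    (by simp only [Wave.move, Wave.rightEnd] at g5 ⊢; linarith)
    (by simp only [Wave.move, Wave.rightEnd] at g6 ⊢; linarith)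
  have d1 := speedAt_congr (a4.trans b4.symm) ℓ
  have d2 := speedAt_congr (a2.trans b2.symm) ℓ
  refine ⟨wave_ext c1 ?_ (a4.trans b4.symm), wave_ext c3 ?_ (a2.trans b2.symm)⟩
  · simp only [move_eq_translate, Wave.translate] at c2
    have c5 : Wave.speedAt ℓ ⟨Q₁.word, Q₁.pos + s * (Q₁.speedAt ℓ), Q₁.speed⟩ = Q₁.speedAt ℓ := rfl
    have c6 : Wave.speedAt ℓ ⟨Q₂.word, Q₂.pos + s * (Q₂.speedAt ℓ), Q₂.speed⟩ = Q₂.speedAt ℓ := rfl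
    rw [c5, c6, d1] at c2
    linarith
  · simp only [move_eq_translate, Wave.translate] at c4
    have c5 : Wave.speedAt ℓ ⟨P₁.word, P₁.pos + s * (P₁.speedAt ℓ), P₁.speed⟩ = P₁.speedAt ℓ := rfl
    have c6 : Wave.speedAt ℓ ⟨P₂.word, P₂.pos + s * (P₂.speedAt ℓ), P₂.speed⟩ = P₂.speedAt ℓ := rfl
    rw [c5, c6, d2] at c4
    linarith

/-- The outcome `scatter` of the whole scattering is the same before and after each two-body
scattering. -/
theorem Scatters.valid_and_eq {ℓ : ℕ∞} (hl : 1 ≤ ℓ) {L R : List Wave} (hL : ∀ P ∈ L, Valid P)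
    (h : Scatters ℓ L R) : (∀ P ∈ R, Valid P) ∧ scatter ℓ R = scatter ℓ L := by
  induction h with
  | refl => exact ⟨hL, rfl⟩
  | tail _ hstep ih =>
    obtain ⟨h1, h2⟩ := ih
    obtain ⟨L₁, L₂, P, Q, Q', P', h3, h4, rfl, rfl⟩ := hstep
    have hP := h1 P (by simp)
    have hQ := h1 Q (by simp)
    obtain ⟨rfl, rfl⟩ := h4.unique h3 (twoBody_out hl hP hQ h3)
    refine ⟨fun R hR => ?_, ?_⟩
    · simp only [List.mem_append, List.mem_cons] at hR h1
      rcases hR with hR | rfl | rfl | hR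
      · exact h1 R (Or.inl hR)
      · exact (hQ.outSlow P).2.2
      · exact hP
      · exact h1 R (Or.inr (Or.inr (Or.inr hR)))
    · rw [← h2, scatter_step hl h3 hQ fun R hR => h1 R (by simp [hR])]

theorem Scatters.cons {ℓ : ℕ∞} {L R : List Wave} (h : Scatters ℓ L R) (P : Wave) :
    Scatters ℓ (P :: L) (P :: R) := by
  refine Relation.ReflTransGen.lift (P :: ·) ?_ _ _ h
  intro L R h
  obtain ⟨L₁, L₂, P', Q, Q', P'', h3, h4, rfl, rfl⟩ := h
  exact ⟨P :: L₁, L₂, P', Q, Q', P'', h3, h4, rfl, rfl⟩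

theorem scatters_insertWave {ℓ : ℕ∞} (hl : 1 ≤ ℓ) {L : List Wave} (hL : ∀ P ∈ L, Valid P) :
    ∀ {P : Wave}, Valid P → Scatters ℓ (P :: L) (insertWave ℓ P L) := by
  induction L with
  | nil => intro P _; exact Relation.ReflTransGen.refl
  | cons Q L ih =>
    intro P hP
    rw [insertWave]
    split
    · rename_i h
      exact Relation.ReflTransGen.head
        ⟨[], L, P, Q, _, _, h, twoBody_out hl hP (hL Q (by simp)) h, rfl, rfl⟩
        (Scatters.cons (ih (fun R hR => hL R (by simp [hR])) (P := outFast P Q) hP) _)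
    · exact Relation.ReflTransGen.refl

theorem scatters_scatter {ℓ : ℕ∞} (hl : 1 ≤ ℓ) {L : List Wave} (hL : ∀ P ∈ L, Valid P) :
    Scatters ℓ L (scatter ℓ L) := by
  induction L with
  | nil => exact Relation.ReflTransGen.refl
  | cons P L ih =>
    have hL' : ∀ P ∈ L, Valid P := fun R hR => hL R (by simp [hR])
    exact (Scatters.cons (ih hL') P).trans
      (scatters_insertWave hl (valid_scatter hL') (hL P (by simp)))

/-- The scattering of solitons is factorized. -/
theorem factorized_scattering (A : List (List Site × ℕ)) (hA : ∀ X ∈ A, IsSoliton X.1 X.2)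
    (hs : A.Pairwise fun X Y => Y.2 ≤ X.2) : ∃ D : ℕ, ∀ ℓ : ℕ∞, 1 ≤ ℓ → ∀ L : List Wave,
    L.map (fun P => (P.word, P.speed)) = A → Separated L →
    L.IsChain (fun (P Q : Wave) => P.speed = 1 → P.rightEnd + D ≤ Q.pos) →
    (∃ R : List Wave, Scatters ℓ L R ∧ Sorted ℓ R) ∧
    (∀ R : List Wave, Scatters ℓ L R → Sorted ℓ R → EventuallyFree ℓ (superpose L) R) ∧
    (∀ (L₁ L₂ : List Wave) (P Q : Wave), Scatters ℓ L (L₁ ++ P :: Q :: L₂) →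
      Q.speedAt ℓ < P.speedAt ℓ → ∃ Q' P' : Wave, TwoBody ℓ P Q Q' P') := by
  -- A slow soliton that is passed by `m` runs needs `m + 2` vacuum sites; `m` is at most the number
  -- of all runs.
  refine ⟨(A.map fun X => cntF V X.1).sum + 2, fun ℓ hl L hLA hS hg => ?_⟩
  have hL : ∀ P ∈ L, Valid P := fun P hP =>
    IsSoliton.valid (hA (P.word, P.speed) (hLA ▸ List.mem_map.2 ⟨P, hP, rfl⟩))
  have hs' : (L.map Wave.speed).Pairwise fun a b => b ≤ a := by
    rw [← hLA, List.pairwise_map] at hs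
    exact List.pairwise_map.2 hs
  refine ⟨⟨_, scatters_scatter hl hL, sorted_scatter hL⟩, fun R hR hR' => ?_,
    fun L₁ L₂ P Q h hlt => ?_⟩
  · have h1 := (hR.valid_and_eq hl hL).2
    rw [scatter_of_sorted hR'] at h1
    rw [h1]
    refine hS.eventuallyFree_scatter hl hL hs' (le_of_eq ?_) hg
    rw [← hLA, List.map_map]
    rfl
  · have h1 := (h.valid_and_eq hl hL).1
    exact ⟨_, _, twoBody_out hl (h1 P (by simp)) (h1 Q (by simp)) hlt⟩

end BoxBasketBall

theorem mainTheorem1 :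
    -- every state eventually becomes a disjoint union of basic solitons
    (∀ S : State, IsState S →
      ∃ R : List Wave, (∀ P ∈ R, IsBasicSoliton P.word P.speed) ∧ Sorted ⊤ R ∧
        EventuallyFree ⊤ S R) ∧
    -- ball solitons and basket solitons are well defined and conserved
    ((∀ S : State, IsState S →
        (∃! c : Multiset ℕ × Multiset ℕ, HasContent S c) ∧
        ∀ c : Multiset ℕ × Multiset ℕ, HasContent S c →
          ∀ ℓ : ℕ∞, 1 ≤ ℓ → ∀ t : ℕ, HasContent ((T ℓ)^[t] S) c) ∧
      (∀ L : List Wave, (∀ P ∈ L, IsBasicSoliton P.word P.speed) → Separated L →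
        HasContent (superpose L) (content L)) ∧
      (∀ L L' : List Wave, (∀ P ∈ L, IsBasicSoliton P.word P.speed) → Separated L →
        (∀ P ∈ L', IsBasicSoliton P.word P.speed) → Separated L' →
        ∀ ℓ : ℕ∞, 1 ≤ ℓ → ∀ t : ℕ, (T ℓ)^[t] (superpose L) = superpose L' →
          content L' = content L)) ∧
    -- the scattering of `n` solitons is factorized into two-body scatterings, in every order
    (∀ A : List (List Site × ℕ), (∀ X ∈ A, IsSoliton X.1 X.2) →
      A.Pairwise (fun X Y => Y.2 ≤ X.2) →
      ∃ D : ℕ, ∀ ℓ : ℕ∞, 1 ≤ ℓ → ∀ L : List Wave, L.map (fun P => (P.word, P.speed)) = A →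
        Separated L → L.IsChain (fun (P Q : Wave) => P.speed = 1 → P.rightEnd + D ≤ Q.pos) →
        (∃ R : List Wave, Scatters ℓ L R ∧ Sorted ℓ R) ∧
        (∀ R : List Wave, Scatters ℓ L R → Sorted ℓ R → EventuallyFree ℓ (superpose L) R) ∧
        (∀ (L₁ L₂ : List Wave) (P Q : Wave), Scatters ℓ L (L₁ ++ P :: Q :: L₂) →
          Q.speedAt ℓ < P.speedAt ℓ → ∃ Q' P' : Wave, TwoBody ℓ P Q Q' P')) := by
  refine ⟨exists_eventuallyFree, ⟨existsUnique_hasContent, fun L hL hS => hS.hasContent hL,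
    fun L L' hL hS hL' hS' ℓ hl t h => ?_⟩, factorized_scattering⟩
  have h1 := (hS.ampContent' hL).T hl t
  rw [h] at h1
  exact (hS'.ampContent' hL').unique h1
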